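/- **Theorem 1 (Nonholonomic implicit Euler–Lagrange equations with collisions).** Let $Q$ be a smooth $n$-dimensional manifold with boundary $\partial Q$ ($n\ge 1$), $L:TQ\to\mathbb R$ a smooth (possibly degenerate) Lagrangian, $\Delta_Q\subset TQ$ a smooth distribution of constant rank, and $\nabla$ a smooth torsion-free linear connection on $TQ$, with dual connection $\nabla^*$ on $T^*Q$. Put $E(v_q,p_q)=p_q\cdot v_q-L(v_q)$; let $\frac{\delta L}{\delta v_q}(v_q)\cdot w_q=\frac{d}{ds}\big|_{s=0}L(v_q+s\,w_q)$ be the fibre derivative, and let $\frac{\delta L}{\delta q}(v_q)\cdot w_q$ be the derivative of $L$ at $v_q$ in the direction of the $\nabla$-horizontal lift of $w_q$ to $T_{v_q}(TQ)$. For a subspace $S\subset T_qQ$ let $S^\circ\subset T_q^*Q$ be its annihilator. Fix $\tau_0<\tilde\tau<\tau_1$. A *path* $\mathtt c=((\alpha_T,\alpha_Q),\nu,\pi)$ consists of $\alpha_T\in C^\infty([\tau_0,\tau_1])$ with $\alpha_T'>0$; a continuous $\alpha_Q:[\tau_0,\tau_1]\to Q$ with $\alpha_Q(\tilde\tau)\in\partial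 Q$ that is $C^2$ on $[\tau_0,\tilde\tau]$ and on $[\tilde\tau,\tau_1]$; and a velocity path $\nu$ in $TQ$ and a momentum path $\pi$ in $T^*Q$, both over $\alpha_Q$, which are $C^2$ on each of the two pieces up to the end points and may jump at $\tilde\tau$, with one-sided limits $\nu^\pm,\pi^\pm$ there. The path is *constrained* if $\nu$ (including $\nu^\pm$) takes values in $\Delta_Q$. The action is $$\mathbb S(\mathtt c)=\int_{\tau_0}^{\tau_1}\Big(L(\nu)+\pi\cdot\Big(\frac{\alpha_Q'}{\alpha_T'}-\nu\Big)\Big)\alpha_T'\,d\tau .$$ Its differential $d\mathbb S(\mathtt c)(\delta\mathtt c)$ in the direction of an infinitesimal variation $\delta\mathtt c=((\delta\alpha_T,\delta\alpha_Q),\delta\nu,\delta\pi)$ (with $\delta\alpha_Q$ a vector field along $\alpha_Q$, $\delta\nu$ one along $\nu$ in $T(TQ)$, $\delta\pi$ one along $\pi$ in $T(T^*Q)$) is the integral over $[\tau_0,\tau_1]$ of the differential of the integrand. A constrained path is *critical* for $\mathbb S$ if $d\mathbb S(\mathtt c)(\delta\mathtt c)=0$ for all variations with $\delta\alpha_T\in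 C^\infty([\tau_0,\tau_1])$, $\delta\alpha_Q$ continuous, $\delta\alpha_Q,\delta\nu,\delta\pi$ of class $C^2$ on each piece, $\delta\alpha_Q(\tilde\tau)\in T_{\alpha_Q(\tilde\tau)}\partial Q$, $d\pi_{TQ}\circ\delta\nu=d\pi_{T^*Q}\circ\delta\pi=\delta\alpha_Q\in\Delta_Q$ (where $\pi_{TQ}:TQ\to Q$ and $\pi_{T^*Q}:T^*Q\to Q$ are the projections), and $\delta\alpha_T$, $\delta\alpha_Q$ vanishing at $\tau_0$ and $\tau_1$. Then: 1. $d\mathbb S$ is the differential of $\mathbb S$: for every family $\mathtt c^s$ ($|s|<\varepsilon$) of paths that is jointly $C^2$ in $(s,\tau)$ on each piece, the derivative of $s\mapsto\mathbb S(\mathtt c^s)$ at $s=0$ exists and equals $d\mathbb S(\mathtt c^0)\big(\tfrac{d}{ds}\big|_{s=0}\mathtt c^s\big)$. 2. A constrained path is critical for $\mathbb S$ if and only if it satisfies, on $[\tau_0,\tilde\tau)\cup(\tilde\tau,\tau_1]$, the Lagrange–d'Alembert–Pontryagin equations $$\frac{\nabla^{*}\pi}{d\tau}-\alpha_T'\frac{\delta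 L}{\delta q}(\nu)\in\Delta_Q^\circ(\alpha_Q),\qquad \frac{d}{d\tau}E(\nu,\pi)=0,\qquad \pi=\frac{\delta L}{\delta v_q}(\nu),\qquad \nu=\frac{\alpha_Q'}{\alpha_T'}\in\Delta_Q(\alpha_Q),$$ together with the conditions for the elastic impact $$\pi^+-\pi^-\in\big(T_{\alpha_Q(\tilde\tau)}\partial Q\cap\Delta_Q(\alpha_Q(\tilde\tau))\big)^\circ=\big(T_{\alpha_Q(\tilde\tau)}\partial Q\big)^\circ+\Delta_Q^\circ(\alpha_Q(\tilde\tau)),\qquad E(\nu^+,\pi^+)=E(\nu^-,\pi^-).$$ -/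

import Mathlib

open Set
open scoped Manifold ContDiff Topology

noncomputable section

namespace CollisionMechanics

/-- The model vector space of an `n`-dimensional manifold with boundary. -/
abbrev Coord (n : ℕ) : Type := EuclideanSpace ℝ (Fin n)

/-- The cotangent bundle of an `n`-manifold with boundary, as the bundle of continuous linear
forms on the tangent spaces, with its vector bundle topology and charts. -/
abbrev CotangentBundle (n : ℕ) [NeZero n] (Q : Type*) [TopologicalSpace Q]
    [ChartedSpace (EuclideanHalfSpace n) Q] : Type _ :=
  Bundle.TotalSpace (Coord n →L[ℝ] ℝ) (fun q : Q => TangentSpace (𝓡∂ n) q →L[ℝ] ℝ)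

/-- The model with corners of the cotangent bundle. -/
abbrev cotangentModel (n : ℕ) [NeZero n] :
    ModelWithCorners ℝ (Coord n × (Coord n →L[ℝ] ℝ))
      (ModelProd (EuclideanHalfSpace n) (Coord n →L[ℝ] ℝ)) :=
  (𝓡∂ n).prod 𝓘(ℝ, Coord n →L[ℝ] ℝ)

/-- The two pieces of a path, before and after the collision. -/
inductive Side where
  | before
  | after

/-- The closed parameter interval of a piece: `[τ₀, τc]` or `[τc, τ₁]`. -/
def Side.dom (τ₀ τc τ₁ : ℝ) : Side → Set ℝ
  | .before => Icc τ₀ τc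
  | .after => Icc τc τ₁

/-- The parameter interval of a piece without the collision: `[τ₀, τc)` or `(τc, τ₁]`. -/
def Side.away (τ₀ τc τ₁ : ℝ) : Side → Set ℝ
  | .before => Ico τ₀ τc
  | .after => Ioc τc τ₁

variable {n : ℕ} [NeZero n] {Q : Type*} [TopologicalSpace Q]
  [ChartedSpace (EuclideanHalfSpace n) Q]

/-- The data `((α_T, α_Q), ν, π)` of a path: a time reparametrization, a configuration path, and
a velocity and a momentum path over it.  The configuration is continuous at the collision, while
the velocity and the momentum may jump there; they are given by their two branches, and the value
of a branch at `τc` is the corresponding one-sided limit. -/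
structure CollisionPath (n : ℕ) [NeZero n] (Q : Type*) [TopologicalSpace Q]
    [ChartedSpace (EuclideanHalfSpace n) Q] where
  /-- `α_T` -/
  time : ℝ → ℝ
  /-- `α_Q` -/
  pos : ℝ → Q
  /-- `ν`, a velocity field over `α_Q` -/
  vel : Side → (τ : ℝ) → TangentSpace (𝓡∂ n) (pos τ)
  /-- `π`, a momentum field over `α_Q` -/
  mom : Side → (τ : ℝ) → (TangentSpace (𝓡∂ n) (pos τ) →L[ℝ] ℝ)

/-- The velocity path as a curve in `TQ`. -/
def CollisionPath.velCurve (c : CollisionPath n Q) (σ : Side) (τ : ℝ) : TangentBundle (𝓡∂ n) Q :=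
  ⟨c.pos τ, c.vel σ τ⟩

/-- The momentum path as a curve in `T*Q`. -/
def CollisionPath.momCurve (c : CollisionPath n Q) (σ : Side) (τ : ℝ) : CotangentBundle n Q :=
  ⟨c.pos τ, c.mom σ τ⟩

/-- `α_T'` on `[τ₀, τ₁]`. -/
def CollisionPath.timeRate (c : CollisionPath n Q) (τ₀ τ₁ τ : ℝ) : ℝ :=
  derivWithin c.time (Icc τ₀ τ₁) τ

/-- `α_Q'` on the piece `σ` (one-sided at the ends of the piece). -/
def CollisionPath.posRate (c : CollisionPath n Q) (τ₀ τc τ₁ : ℝ) (σ : Side) (τ : ℝ) :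
    TangentSpace (𝓡∂ n) (c.pos τ) :=
  mfderivWithin 𝓘(ℝ, ℝ) (𝓡∂ n) c.pos (σ.dom τ₀ τc τ₁) τ (1 : ℝ)

/-- A smooth distribution of constant rank `k` on `Q`. -/
def IsSmoothDistribution [IsManifold (𝓡∂ n) ∞ Q] (k : ℕ)
    (Δ : (q : Q) → Submodule ℝ (TangentSpace (𝓡∂ n) q)) : Prop :=
  ∀ q : Q, ∃ U : Set Q, IsOpen U ∧ q ∈ U ∧
    ∃ X : Fin k → (x : Q) → TangentSpace (𝓡∂ n) x,
      (∀ i, ContMDiffOn (𝓡∂ n) (𝓡∂ n).tangent ∞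
        (fun x => (⟨x, X i x⟩ : TangentBundle (𝓡∂ n) Q)) U) ∧
      ∀ x ∈ U, LinearIndependent ℝ (fun i => X i x) ∧
        Δ x = Submodule.span ℝ (range fun i => X i x)

/-- The coordinates of a tangent vector in the preferred chart at its base point. -/
def coords {q : Q} (w : TangentSpace (𝓡∂ n) q) : Coord n := w

/-- The tangent space `T_q ∂Q ⊆ T_q Q` at a boundary point `q`.  A tangent vector at `q` is given
by its coordinates in the preferred chart at `q`, with values in the half-space `{x | 0 ≤ x 0}`, in
which the boundary of `Q` is `{x | x 0 = 0}`. -/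
def boundaryTangent (q : Q) : Submodule ℝ (TangentSpace (𝓡∂ n) q) where
  carrier := {w | coords w 0 = 0}
  zero_mem' := rfl
  add_mem' := by
    intro a b ha hb
    change coords a 0 + coords b 0 = 0
    rw [show coords a 0 = 0 from ha, show coords b 0 = 0 from hb, add_zero]
  smul_mem' := by
    intro r a ha
    change r * coords a 0 = 0
    rw [show coords a 0 = 0 from ha, mul_zero]

/-- The annihilator in `T_q^* Q` of a subspace of `T_q Q`. -/
def annihilator {q : Q} (S : Submodule ℝ (TangentSpace (𝓡∂ n) q)) :
    Submodule ℝ (TangentSpace (𝓡∂ n) q →L[ℝ] ℝ) where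
  carrier := {β | ∀ w ∈ S, β w = 0}
  zero_mem' := fun _ _ => rfl
  add_mem' := by
    intro a b ha hb w hw
    change a w + b w = 0
    rw [ha w hw, hb w hw, add_zero]
  smul_mem' := by
    intro r a ha w hw
    change r * a w = 0
    rw [ha w hw, mul_zero]

/-- The regularity conditions on `((α_T, α_Q), ν, π)`: `α_T` is smooth with positive derivative,
`α_Q` is continuous, hits the boundary at `τc`, and `α_Q`, `ν`, `π` are `C²` on each of the two
pieces, up to the end points of the pieces. -/
structure IsPath [IsManifold (𝓡∂ n) ∞ Q] (τ₀ τc τ₁ : ℝ) (c : CollisionPath n Q) : Prop where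
  time_smooth : ContDiffOn ℝ ∞ c.time (Icc τ₀ τ₁)
  time_pos : ∀ τ ∈ Icc τ₀ τ₁, 0 < c.timeRate τ₀ τ₁ τ
  pos_continuous : ContinuousOn c.pos (Icc τ₀ τ₁)
  pos_smooth : ∀ σ : Side, ContMDiffOn 𝓘(ℝ, ℝ) (𝓡∂ n) 2 c.pos (σ.dom τ₀ τc τ₁)
  pos_collision : c.pos τc ∈ (𝓡∂ n).boundary Q
  vel_smooth : ∀ σ : Side,
    ContMDiffOn 𝓘(ℝ, ℝ) (𝓡∂ n).tangent 2 (c.velCurve σ) (σ.dom τ₀ τc τ₁)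
  mom_smooth : ∀ σ : Side,
    ContMDiffOn 𝓘(ℝ, ℝ) (cotangentModel n) 2 (c.momCurve σ) (σ.dom τ₀ τc τ₁)

/-- The velocity path takes values in the constraint distribution. -/
def IsConstrained (Δ : (q : Q) → Submodule ℝ (TangentSpace (𝓡∂ n) q)) (τ₀ τc τ₁ : ℝ)
    (c : CollisionPath n Q) : Prop :=
  ∀ σ : Side, ∀ τ ∈ σ.dom τ₀ τc τ₁, c.vel σ τ ∈ Δ (c.pos τ)

section Action

variable (L : TangentBundle (𝓡∂ n) Q → ℝ)

/-- The energy `E(v_q, p_q) = p_q · v_q - L(v_q)`. -/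
def energy (q : Q) (v : TangentSpace (𝓡∂ n) q) (p : TangentSpace (𝓡∂ n) q →L[ℝ] ℝ) : ℝ :=
  p v - L ⟨q, v⟩

/-- The energy along the piece `σ` of a path. -/
def CollisionPath.energyAt (c : CollisionPath n Q) (σ : Side) (τ : ℝ) : ℝ :=
  energy L (c.pos τ) (c.vel σ τ) (c.mom σ τ)

/-- The integrand `(L(ν) + π · (α_Q' / α_T' - ν)) α_T'` of the action. -/
def actionDensity (τ₀ τc τ₁ : ℝ) (c : CollisionPath n Q) (σ : Side) (τ : ℝ) : ℝ :=
  (L (c.velCurve σ τ) +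
    c.mom σ τ ((c.timeRate τ₀ τ₁ τ)⁻¹ • c.posRate τ₀ τc τ₁ σ τ - c.vel σ τ)) *
    c.timeRate τ₀ τ₁ τ

/-- The Lagrange–d'Alembert–Pontryagin action: the integral of the density over `[τ₀, τ₁]`. -/
def action (τ₀ τc τ₁ : ℝ) (c : CollisionPath n Q) : ℝ :=
  (∫ τ in τ₀..τc, actionDensity L τ₀ τc τ₁ c .before τ) +
    ∫ τ in τc..τ₁, actionDensity L τ₀ τc τ₁ c .after τ

variable [IsManifold (𝓡∂ n) ∞ Q]

/-- An infinitesimal variation `((δα_T, δα_Q), δν, δπ)` of a path: `δα_Q` is a vector field along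
`α_Q`, `δν` is a vector field along `ν` with values in `T(TQ)` and `δπ` is one along `π` with values
in `T(T*Q)`. -/
structure Variation (c : CollisionPath n Q) where
  /-- `δα_T` -/
  time : ℝ → ℝ
  /-- `δα_Q` -/
  pos : (τ : ℝ) → TangentSpace (𝓡∂ n) (c.pos τ)
  /-- `δν` -/
  vel : (σ : Side) → (τ : ℝ) → TangentSpace (𝓡∂ n).tangent (c.velCurve σ τ)
  /-- `δπ` -/
  mom : (σ : Side) → (τ : ℝ) → TangentSpace (cotangentModel n) (c.momCurve σ τ)

variable {c : CollisionPath n Q}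

/-- `δα_Q` as a curve in `TQ`. -/
def Variation.posCurve (δ : Variation c) (τ : ℝ) : TangentBundle (𝓡∂ n) Q :=
  ⟨c.pos τ, δ.pos τ⟩

/-- `δν` as a curve in `T(TQ)`. -/
def Variation.velCurve (δ : Variation c) (σ : Side) (τ : ℝ) :
    TangentBundle (𝓡∂ n).tangent (TangentBundle (𝓡∂ n) Q) :=
  ⟨c.velCurve σ τ, δ.vel σ τ⟩

/-- `δπ` as a curve in `T(T*Q)`. -/
def Variation.momCurve (δ : Variation c) (σ : Side) (τ : ℝ) :
    TangentBundle (cotangentModel n) (CotangentBundle n Q) :=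
  ⟨c.momCurve σ τ, δ.mom σ τ⟩

/-- The projection `dπ_{TQ} ∘ δν`, a vector field along `α_Q`. -/
def Variation.velProj (δ : Variation c) (σ : Side) (τ : ℝ) : TangentSpace (𝓡∂ n) (c.pos τ) :=
  mfderiv (𝓡∂ n).tangent (𝓡∂ n) (fun x : TangentBundle (𝓡∂ n) Q => x.proj)
    (c.velCurve σ τ) (δ.vel σ τ)

/-- The projection `dπ_{T*Q} ∘ δπ`, a vector field along `α_Q`. -/
def Variation.momProj (δ : Variation c) (σ : Side) (τ : ℝ) : TangentSpace (𝓡∂ n) (c.pos τ) :=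
  mfderiv (cotangentModel n) (𝓡∂ n) (fun x : CotangentBundle n Q => x.proj)
    (c.momCurve σ τ) (δ.mom σ τ)

/-- The fibre component of `δν`, in the coordinates of the preferred chart at `α_Q(τ)`. -/
def Variation.velFibre (δ : Variation c) (σ : Side) (τ : ℝ) : TangentSpace (𝓡∂ n) (c.pos τ) :=
  Prod.snd (α := Coord n) (β := Coord n) (δ.vel σ τ)

/-- The fibre component of `δπ`, in the coordinates of the preferred chart at `α_Q(τ)`. -/
def Variation.momFibre (δ : Variation c) (σ : Side) (τ : ℝ) :
    TangentSpace (𝓡∂ n) (c.pos τ) →L[ℝ] ℝ :=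
  Prod.snd (α := Coord n) (β := Coord n →L[ℝ] ℝ) (δ.mom σ τ)

/-- The fibre component of the variation `δ(α_Q')` of the velocity of `α_Q`, in the coordinates of
the preferred chart at `α_Q(τ)`: the derivative of the coordinate expression of `δα_Q`.  (The
canonical flip of `T(TQ)`, which turns `(δα_Q)'` into `δ(α_Q')`, does not change it.) -/
def Variation.posRateFibre (τ₀ τc τ₁ : ℝ) (δ : Variation c) (σ : Side) (τ : ℝ) :
    TangentSpace (𝓡∂ n) (c.pos τ) :=
  Prod.snd (α := Coord n) (β := Coord n)
    (mfderivWithin 𝓘(ℝ, ℝ) (𝓡∂ n).tangent δ.posCurve (σ.dom τ₀ τc τ₁) τ (1 : ℝ))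

/-- `(δα_T)'`. -/
def Variation.timeRate (τ₀ τ₁ : ℝ) (δ : Variation c) (τ : ℝ) : ℝ :=
  derivWithin δ.time (Icc τ₀ τ₁) τ

/-- The differential `dL(x)(ξ)` of the Lagrangian. -/
def lagrangianDifferential (x : TangentBundle (𝓡∂ n) Q) (ξ : TangentSpace (𝓡∂ n).tangent x) : ℝ :=
  mfderiv (𝓡∂ n).tangent 𝓘(ℝ, ℝ) L x ξ

/-- The differential of the density `α_T' L(ν) + π · α_Q' - α_T' (π · ν)` in the direction of a
variation.  The differential of the pairing `p · w` in the direction `(δp, δw)` over a common base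
vector is `δp · w + p · δw`, where `δp` and `δw` are the fibre components in one chart. -/
def actionDensityVariation (τ₀ τc τ₁ : ℝ) (δ : Variation c) (σ : Side) (τ : ℝ) : ℝ :=
  δ.timeRate τ₀ τ₁ τ * L (c.velCurve σ τ)
  + c.timeRate τ₀ τ₁ τ * lagrangianDifferential L (c.velCurve σ τ) (δ.vel σ τ)
  + (δ.momFibre σ τ (c.posRate τ₀ τc τ₁ σ τ) + c.mom σ τ (δ.posRateFibre τ₀ τc τ₁ σ τ))
  - δ.timeRate τ₀ τ₁ τ * c.mom σ τ (c.vel σ τ)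
  - c.timeRate τ₀ τ₁ τ * (δ.momFibre σ τ (c.vel σ τ) + c.mom σ τ (δ.velFibre σ τ))

/-- The differential `dS(c)(δc)` of the action functional at a path in the direction of a
variation. -/
def actionVariation (τ₀ τc τ₁ : ℝ) (δ : Variation c) : ℝ :=
  (∫ τ in τ₀..τc, actionDensityVariation L τ₀ τc τ₁ δ .before τ) +
    ∫ τ in τc..τ₁, actionDensityVariation L τ₀ τc τ₁ δ .after τ

/-- The tangent vectors `δc` of the path space at `c` that are admissible in the variational
principle: they have the regularity of the path space, `δα_Q(τc)` is tangent to the boundary, `δν`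
and `δπ` project to `δα_Q`, which lies in the constraint distribution, and `δα_T` and `δα_Q` vanish
at the end points. -/
structure IsAdmissible (Δ : (q : Q) → Submodule ℝ (TangentSpace (𝓡∂ n) q)) (τ₀ τc τ₁ : ℝ)
    (δ : Variation c) : Prop where
  time_smooth : ContDiffOn ℝ ∞ δ.time (Icc τ₀ τ₁)
  pos_continuous : ContinuousOn δ.posCurve (Icc τ₀ τ₁)
  pos_smooth : ∀ σ : Side,
    ContMDiffOn 𝓘(ℝ, ℝ) (𝓡∂ n).tangent 2 δ.posCurve (σ.dom τ₀ τc τ₁)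
  pos_collision : δ.pos τc ∈ boundaryTangent (c.pos τc)
  vel_smooth : ∀ σ : Side,
    ContMDiffOn 𝓘(ℝ, ℝ) (𝓡∂ n).tangent.tangent 2 (δ.velCurve σ) (σ.dom τ₀ τc τ₁)
  mom_smooth : ∀ σ : Side,
    ContMDiffOn 𝓘(ℝ, ℝ) (cotangentModel n).tangent 2 (δ.momCurve σ) (σ.dom τ₀ τc τ₁)
  vel_constraint : ∀ σ : Side, ∀ τ ∈ σ.dom τ₀ τc τ₁, δ.velProj σ τ ∈ Δ (c.pos τ)
  vel_proj : ∀ σ : Side, ∀ τ ∈ σ.dom τ₀ τc τ₁, δ.velProj σ τ = δ.pos τ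
  mom_proj : ∀ σ : Side, ∀ τ ∈ σ.dom τ₀ τc τ₁, δ.momProj σ τ = δ.pos τ
  time_start : δ.time τ₀ = 0
  time_end : δ.time τ₁ = 0
  pos_start : δ.pos τ₀ = 0
  pos_end : δ.pos τ₁ = 0

/-- Criticality for the action: `dS(c)(δc) = 0` for every admissible variation. -/
def IsCritical (Δ : (q : Q) → Submodule ℝ (TangentSpace (𝓡∂ n) q)) (τ₀ τc τ₁ : ℝ)
    (c : CollisionPath n Q) : Prop :=
  ∀ δ : Variation c, IsAdmissible Δ τ₀ τc τ₁ δ → actionVariation L τ₀ τc τ₁ δ = 0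

/-- A curve `s ↦ C s` of paths, `|s| < ε`, which is jointly `C²` in `(s, τ)` on each piece. -/
structure IsPathFamily (τ₀ τc τ₁ ε : ℝ) (C : ℝ → CollisionPath n Q) : Prop where
  isPath : ∀ s ∈ Ioo (-ε) ε, IsPath τ₀ τc τ₁ (C s)
  time_smooth : ContDiffOn ℝ 2 (fun x : ℝ × ℝ => (C x.1).time x.2) (Ioo (-ε) ε ×ˢ Icc τ₀ τ₁)
  pos_smooth : ∀ σ : Side, ContMDiffOn 𝓘(ℝ, ℝ × ℝ) (𝓡∂ n) 2
    (fun x : ℝ × ℝ => (C x.1).pos x.2) (Ioo (-ε) ε ×ˢ σ.dom τ₀ τc τ₁)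
  vel_smooth : ∀ σ : Side, ContMDiffOn 𝓘(ℝ, ℝ × ℝ) (𝓡∂ n).tangent 2
    (fun x : ℝ × ℝ => (C x.1).velCurve σ x.2) (Ioo (-ε) ε ×ˢ σ.dom τ₀ τc τ₁)
  mom_smooth : ∀ σ : Side, ContMDiffOn 𝓘(ℝ, ℝ × ℝ) (cotangentModel n) 2
    (fun x : ℝ × ℝ => (C x.1).momCurve σ x.2) (Ioo (-ε) ε ×ˢ σ.dom τ₀ τc τ₁)

/-- `δc = d/ds|_{s=0} C s`. -/
structure IsVelocityAtZero (τ₀ τc τ₁ : ℝ) (C : ℝ → CollisionPath n Q) (δ : Variation (C 0)) :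
    Prop where
  time : ∀ τ ∈ Icc τ₀ τ₁, deriv (fun s => (C s).time τ) 0 = δ.time τ
  pos : ∀ τ ∈ Icc τ₀ τ₁,
    mfderiv 𝓘(ℝ, ℝ) (𝓡∂ n) (fun s : ℝ => (C s).pos τ) 0 (1 : ℝ) = δ.pos τ
  vel : ∀ σ : Side, ∀ τ ∈ σ.dom τ₀ τc τ₁,
    mfderiv 𝓘(ℝ, ℝ) (𝓡∂ n).tangent (fun s : ℝ => (C s).velCurve σ τ) 0 (1 : ℝ) = δ.vel σ τ
  mom : ∀ σ : Side, ∀ τ ∈ σ.dom τ₀ τc τ₁,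
    mfderiv 𝓘(ℝ, ℝ) (cotangentModel n) (fun s : ℝ => (C s).momCurve σ τ) 0 (1 : ℝ) = δ.mom σ τ

end Action

section Equations

variable [IsManifold (𝓡∂ n) ∞ Q] (L : TangentBundle (𝓡∂ n) Q → ℝ)

/-- A linear connection on `TQ`. In Mathlib's convention `cov X q w` is `(∇_w X)(q)`. -/
abbrev LinearConnection (n : ℕ) [NeZero n] (Q : Type*) [TopologicalSpace Q]
    [ChartedSpace (EuclideanHalfSpace n) Q] [IsManifold (𝓡∂ n) ∞ Q] : Type _ :=
  CovariantDerivative (𝓡∂ n) (Coord n) (fun q : Q => TangentSpace (𝓡∂ n) q)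

/-- An extension of a tangent vector `w` at `q` to a vector field which is smooth near `q`.  The
definitions below do not depend on the choice of the extension. -/
def extendVector {q : Q} (w : TangentSpace (𝓡∂ n) q) : (x : Q) → TangentSpace (𝓡∂ n) x :=
  FiberBundle.extend (Coord n) w

/-- The fibre derivative `δL/δv (v) · w = d/ds|_{s=0} L(v + s w)`. -/
def fibreDerivative (q : Q) (v w : TangentSpace (𝓡∂ n) q) : ℝ :=
  deriv (fun s : ℝ => L ⟨q, v + s • w⟩) 0

/-- The vertical lift of `w` at `v`: the velocity of `s ↦ v + s w` at `s = 0`. -/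
def verticalLift (q : Q) (v w : TangentSpace (𝓡∂ n) q) :
    TangentSpace (𝓡∂ n).tangent (⟨q, v⟩ : TangentBundle (𝓡∂ n) Q) :=
  mfderiv 𝓘(ℝ, ℝ) (𝓡∂ n).tangent
    (fun s : ℝ => (⟨q, v + s • w⟩ : TangentBundle (𝓡∂ n) Q)) 0 (1 : ℝ)

/-- The value `dV(w)` at `q` of the differential of the extension `V : Q → TQ` of `v`; it lies in the
tangent space at `V(q) = v`. -/
def extensionDifferential (q : Q) (v w : TangentSpace (𝓡∂ n) q) :
    TangentSpace (𝓡∂ n).tangent (⟨q, v⟩ : TangentBundle (𝓡∂ n) Q) :=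
  mfderiv (𝓡∂ n) (𝓡∂ n).tangent
    (fun x : Q => (⟨x, extendVector v x⟩ : TangentBundle (𝓡∂ n) Q)) q w

/-- The horizontal lift of `w` at `v`, i.e. the initial velocity of the horizontal lift starting
at `v` of a curve with initial velocity `w`: it is `dV(w)` minus the vertical lift of `∇_w V`, for
any vector field `V` through `v`. -/
def horizontalLift (cov : LinearConnection n Q) (q : Q) (v w : TangentSpace (𝓡∂ n) q) :
    TangentSpace (𝓡∂ n).tangent (⟨q, v⟩ : TangentBundle (𝓡∂ n) Q) :=
  extensionDifferential q v w - verticalLift q v (cov (extendVector v) q w)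

/-- The horizontal derivative `δL/δq (v) · w`. -/
def horizontalDerivative (cov : LinearConnection n Q) (q : Q) (v w : TangentSpace (𝓡∂ n) q) : ℝ :=
  lagrangianDifferential L ⟨q, v⟩ (horizontalLift cov q v w)

/-- The covariant derivative of the momentum for the dual connection, paired with a vector `w`:
`(∇*π/dτ) · w = d/dτ (π · W) - π · ∇_{α_Q'} W`, for any vector field `W` through `w`. -/
def momentumCovDerivative (cov : LinearConnection n Q) (τ₀ τc τ₁ : ℝ) (c : CollisionPath n Q)
    (σ : Side) (τ : ℝ) (w : TangentSpace (𝓡∂ n) (c.pos τ)) : ℝ :=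
  derivWithin (fun t => c.mom σ t (extendVector w (c.pos t))) (σ.dom τ₀ τc τ₁) τ
  - c.mom σ τ (cov (extendVector w) (c.pos τ) (c.posRate τ₀ τc τ₁ σ τ))

/-- The implicit Euler–Lagrange (Lagrange–d'Alembert–Pontryagin) equations away from the
collision. The field `momentum` says that `∇*π/dτ - α_T' δL/δq (ν)` annihilates `Δ`. -/
structure ImplicitEulerLagrange (cov : LinearConnection n Q)
    (Δ : (q : Q) → Submodule ℝ (TangentSpace (𝓡∂ n) q)) (τ₀ τc τ₁ : ℝ)
    (c : CollisionPath n Q) : Prop where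
  momentum : ∀ σ : Side, ∀ τ ∈ σ.away τ₀ τc τ₁, ∀ w ∈ Δ (c.pos τ),
    momentumCovDerivative cov τ₀ τc τ₁ c σ τ w
      - c.timeRate τ₀ τ₁ τ * horizontalDerivative L cov (c.pos τ) (c.vel σ τ) w = 0
  energy : ∀ σ : Side, ∀ τ ∈ σ.away τ₀ τc τ₁,
    HasDerivWithinAt (c.energyAt L σ) 0 (σ.dom τ₀ τc τ₁) τ
  legendre : ∀ σ : Side, ∀ τ ∈ σ.away τ₀ τc τ₁, ∀ w : TangentSpace (𝓡∂ n) (c.pos τ),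
    c.mom σ τ w = fibreDerivative L (c.pos τ) (c.vel σ τ) w
  velocity : ∀ σ : Side, ∀ τ ∈ σ.away τ₀ τc τ₁,
    c.vel σ τ = (c.timeRate τ₀ τ₁ τ)⁻¹ • c.posRate τ₀ τc τ₁ σ τ ∧ c.vel σ τ ∈ Δ (c.pos τ)

/-- The conditions for the elastic impact at the collision. -/
structure ElasticImpact (Δ : (q : Q) → Submodule ℝ (TangentSpace (𝓡∂ n) q)) (τc : ℝ)
    (c : CollisionPath n Q) : Prop where
  momentum : c.mom .after τc - c.mom .before τc ∈
    annihilator (boundaryTangent (c.pos τc) ⊓ Δ (c.pos τc))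
  energy : c.energyAt L .after τc = c.energyAt L .before τc

end Equations

end CollisionMechanics

end

open CollisionMechanics

open Set
open scoped Manifold ContDiff Topology

noncomputable section

namespace CollisionMechanics

section TotalSpace

open Bundle

variable {EB : Type*} [NormedAddCommGroup EB] [NormedSpace ℝ EB] {HB : Type*} [TopologicalSpace HB]
  {IB : ModelWithCorners ℝ EB HB} {B : Type*} [TopologicalSpace B] [ChartedSpace HB B]
  {F : Type*} [NormedAddCommGroup F] [NormedSpace ℝ F] {V : B → Type*}
  [TopologicalSpace (TotalSpace F V)] [∀ b, TopologicalSpace (V b)] [FiberBundle F V]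

theorem extChartAt_totalSpace_apply (p x : TotalSpace F V)
    (hx : x.proj ∈ (trivializationAt F V p.proj).baseSet) :
    extChartAt (IB.prod 𝓘(ℝ, F)) p x =
      (extChartAt IB p.proj x.proj, (trivializationAt F V p.proj x).2) := by
  rw [FiberBundle.extChartAt]
  refine Prod.ext ?_ rfl
  exact congrArg (extChartAt IB p.proj)
    ((trivializationAt F V p.proj).coe_fst ((trivializationAt F V p.proj).mem_source.2 hx))

theorem mem_extChartAt_totalSpace_source (p x : TotalSpace F V) :
    x ∈ (extChartAt (IB.prod 𝓘(ℝ, F)) p).source ↔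
      x.proj ∈ (trivializationAt F V p.proj).baseSet ∧ x.proj ∈ (extChartAt IB p.proj).source := by
  have key : ∀ hx : x.proj ∈ (trivializationAt F V p.proj).baseSet,
      (trivializationAt F V p.proj x).1 = x.proj := fun hx =>
    (trivializationAt F V p.proj).coe_fst ((trivializationAt F V p.proj).mem_source.2 hx)
  rw [FiberBundle.extChartAt, PartialEquiv.trans_source]
  refine ⟨fun h => ?_, fun h => ⟨(trivializationAt F V p.proj).mem_source.2 h.1, ?_, mem_univ _⟩⟩
  · have h1 := (trivializationAt F V p.proj).mem_source.1 h.1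
    refine ⟨h1, ?_⟩
    have h2 := h.2.1
    rwa [← key h1]
  · have := h.2
    rwa [← key h.1] at this

theorem extChartAt_totalSpace_symm (p : TotalSpace F V) {y : EB × F}
    (hy : y ∈ (extChartAt (IB.prod 𝓘(ℝ, F)) p).target) :
    extChartAt IB p.proj ((extChartAt (IB.prod 𝓘(ℝ, F)) p).symm y).proj = y.1 ∧
      (trivializationAt F V p.proj ((extChartAt (IB.prod 𝓘(ℝ, F)) p).symm y)).2 = y.2 := by
  have h1 := (extChartAt (IB.prod 𝓘(ℝ, F)) p).map_target hy
  have h2 := (extChartAt (IB.prod 𝓘(ℝ, F)) p).right_inv hy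
  rw [extChartAt_totalSpace_apply _ _ ((mem_extChartAt_totalSpace_source _ _).1 h1).1] at h2
  exact ⟨congrArg Prod.fst h2, congrArg Prod.snd h2⟩

theorem hasMFDerivAt_totalSpace_proj (p : TotalSpace F V) :
    HasMFDerivAt (IB.prod 𝓘(ℝ, F)) IB (TotalSpace.proj : TotalSpace F V → B) p
      (ContinuousLinearMap.fst ℝ EB F) := by
  refine ⟨(FiberBundle.continuous_proj F V).continuousAt, ?_⟩
  refine (ContinuousLinearMap.fst ℝ EB F).hasFDerivWithinAt.congr_of_eventuallyEq ?_ ?_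
  · filter_upwards [extChartAt_target_mem_nhdsWithin (I := IB.prod 𝓘(ℝ, F)) p] with y hy
    exact (extChartAt_totalSpace_symm p hy).1
  · exact (extChartAt_totalSpace_symm p (mem_extChartAt_target p)).1

theorem hasMFDerivAt_trivializationAt_snd (p : TotalSpace F V) :
    HasMFDerivAt (IB.prod 𝓘(ℝ, F)) 𝓘(ℝ, F)
      (fun x : TotalSpace F V => (trivializationAt F V p.proj x).2) p
      (ContinuousLinearMap.snd ℝ EB F) := by
  refine ⟨?_, ?_⟩
  · exact continuous_snd.continuousAt.comp
      ((trivializationAt F V p.proj).continuousAt FiberBundle.mem_trivializationAt_proj_source)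
  refine (ContinuousLinearMap.snd ℝ EB F).hasFDerivWithinAt.congr_of_eventuallyEq ?_ ?_
  · filter_upwards [extChartAt_target_mem_nhdsWithin (I := IB.prod 𝓘(ℝ, F)) p] with y hy
    exact (extChartAt_totalSpace_symm p hy).2
  · exact (extChartAt_totalSpace_symm p (mem_extChartAt_target p)).2

variable {EM : Type*} [NormedAddCommGroup EM] [NormedSpace ℝ EM] {HM : Type*} [TopologicalSpace HM]
  {IM : ModelWithCorners ℝ EM HM} {M : Type*} [TopologicalSpace M] [ChartedSpace HM M]

theorem _root_.HasMFDerivWithinAt.totalSpace_proj {f : M → TotalSpace F V} {s : Set M} {x : M}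
    {f' : TangentSpace IM x →L[ℝ] TangentSpace (IB.prod 𝓘(ℝ, F)) (f x)}
    (h : HasMFDerivWithinAt IM (IB.prod 𝓘(ℝ, F)) f s x f') :
    HasMFDerivWithinAt IM IB (fun y => (f y).proj) s x
      ((ContinuousLinearMap.fst ℝ EB F).comp f') :=
  (hasMFDerivAt_totalSpace_proj (f x)).comp_hasMFDerivWithinAt x h

theorem _root_.HasMFDerivWithinAt.trivializationAt_snd {f : M → TotalSpace F V} {s : Set M} {x : M}
    {f' : TangentSpace IM x →L[ℝ] TangentSpace (IB.prod 𝓘(ℝ, F)) (f x)}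
    (h : HasMFDerivWithinAt IM (IB.prod 𝓘(ℝ, F)) f s x f') :
    HasMFDerivWithinAt IM 𝓘(ℝ, F) (fun y => (trivializationAt F V (f x).proj (f y)).2) s x
      ((ContinuousLinearMap.snd ℝ EB F).comp f') :=
  (hasMFDerivAt_trivializationAt_snd (f x)).comp_hasMFDerivWithinAt x h

section Lift

variable [∀ b, AddCommGroup (V b)] [∀ b, Module ℝ (V b)] [VectorBundle ℝ F V]

/-- A section along a map, given by its coordinates in one trivialization, is smooth when the
coordinates are smooth and vanish where the map leaves the domain of the trivialization. -/
theorem contMDiffOn_trivialization_symmL {n : ℕ∞ω} [ContMDiffVectorBundle n F V IB]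
    (e : Trivialization F (TotalSpace.proj : TotalSpace F V → B)) [MemTrivializationAtlas e]
    {γ : M → B} {a : M → F} {s : Set M} (hγ : ContMDiffOn IM IB n γ s)
    (ha : ContMDiffOn IM 𝓘(ℝ, F) n a s)
    (h : ∀ x ∈ s, γ x ∈ e.baseSet ∨ ∀ᶠ y in 𝓝[s] x, a y = 0) :
    ContMDiffOn IM (IB.prod 𝓘(ℝ, F)) n
      (fun x => (⟨γ x, e.symmL ℝ (γ x) (a x)⟩ : TotalSpace F V)) s := by
  intro x hx
  rcases h x hx with hb | h0
  · rw [e.contMDiffWithinAt_iff (e.mem_source.2 hb)]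
    refine ⟨hγ x hx, (ha x hx).congr_of_eventuallyEq_of_mem ?_ hx⟩
    filter_upwards [(hγ x hx).continuousWithinAt (e.open_baseSet.mem_nhds hb)] with y hy
    rw [e.symmL_apply hy]
    exact congrArg Prod.snd (e.apply_mk_symm hy (a y))
  · have h1 : ContMDiffWithinAt IM (IB.prod 𝓘(ℝ, F)) n (fun x => zeroSection F V (γ x)) s x :=
      (contMDiff_zeroSection ℝ V).contMDiffAt.comp_contMDiffWithinAt x (hγ x hx)
    refine h1.congr_of_eventuallyEq_of_mem ?_ hx
    filter_upwards [h0] with y hy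
    rw [hy, map_zero]
    rfl

end Lift

end TotalSpace

theorem _root_.HasMFDerivWithinAt.hasDerivWithinAt_apply_one {F : Type*} [NormedAddCommGroup F]
    [NormedSpace ℝ F] {f : ℝ → F} {s : Set ℝ} {x : ℝ}
    {f' : TangentSpace 𝓘(ℝ, ℝ) x →L[ℝ] TangentSpace 𝓘(ℝ, F) (f x)}
    (h : HasMFDerivWithinAt 𝓘(ℝ, ℝ) 𝓘(ℝ, F) f s x f') :
    HasDerivWithinAt f (f' (1 : ℝ)) s x := by
  let A : ℝ →L[ℝ] F := f'
  have h' : HasFDerivWithinAt f A s x := h.hasFDerivWithinAt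
  exact h'.hasDerivWithinAt

section Tangent

open Bundle

variable {E : Type*} [NormedAddCommGroup E] [NormedSpace ℝ E] {H : Type*} [TopologicalSpace H]
  {I : ModelWithCorners ℝ E H} {M : Type*} [TopologicalSpace M] [ChartedSpace H M]

theorem trivializationAt_tangent_self [IsManifold I 1 M] (q : M) (v : TangentSpace I q) :
    (trivializationAt E (TangentSpace I) q ⟨q, v⟩).2 = v :=
  tangentCoordChange_self (I := I) (mem_extChartAt_source q)

theorem trivializationAt_tangent_coordChange [IsManifold I 1 M] {q x₀ : M} (x : TangentBundle I M)
    (hq : x.proj ∈ (chartAt H q).source) (hx : x.proj ∈ (chartAt H x₀).source) :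
    (trivializationAt E (TangentSpace I) x₀ x).2 =
      tangentCoordChange I q x₀ x.proj (trivializationAt E (TangentSpace I) q x).2 := by
  refine (tangentCoordChange_comp (I := I) (w := x.proj) (x := q) (y := x₀) (z := x.proj)
    (v := x.2) ?_).symm
  simp only [extChartAt_source]
  exact ⟨⟨mem_chart_source H x.proj, hq⟩, hx⟩

theorem trivializationAt_mfderivWithin [IsManifold I 1 M] {EM : Type*} [NormedAddCommGroup EM]
    [NormedSpace ℝ EM] {f : EM → M} {s : Set EM} {x : EM} {q : M}
    (hf : MDifferentiableWithinAt 𝓘(ℝ, EM) I f s x) (hs : UniqueDiffWithinAt ℝ s x)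
    (hq : f x ∈ (chartAt H q).source) (v : EM) :
    (trivializationAt E (TangentSpace I) q ⟨f x, mfderivWithin 𝓘(ℝ, EM) I f s x v⟩).2 =
      fderivWithin ℝ (extChartAt I q ∘ f) s x v := by
  have h1 : HasMFDerivAt I 𝓘(ℝ, E) (extChartAt I q) (f x) (mfderiv I 𝓘(ℝ, E) (extChartAt I q) (f x)) :=
    (mdifferentiableAt_extChartAt hq).hasMFDerivAt
  have h2 := h1.comp_hasMFDerivWithinAt x hf.hasMFDerivWithinAt
  let A : EM →L[ℝ] E :=
    (mfderiv I 𝓘(ℝ, E) (extChartAt I q) (f x)).comp (mfderivWithin 𝓘(ℝ, EM) I f s x)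
  have h3 : HasFDerivWithinAt (extChartAt I q ∘ f) A s x := h2.hasFDerivWithinAt
  refine Eq.trans ?_ (DFunLike.congr_fun (h3.fderivWithin hs) v).symm
  change _ = mfderiv I 𝓘(ℝ, E) (extChartAt I q) (f x) (mfderivWithin 𝓘(ℝ, EM) I f s x v)
  rw [← TangentBundle.continuousLinearMapAt_trivializationAt hq]
  exact (Trivialization.continuousLinearMapAt_apply_of_mem ℝ
    (trivializationAt E (TangentSpace I) q) (b := f x) hq _).symm

/-- The second derivative of the transition map from the preferred chart at `q` to the one at
`x₀`. -/
def transitionHessian (I : ModelWithCorners ℝ E H) [IsManifold I 1 M] (q x₀ : M) : E →L[ℝ] E →L[ℝ] E :=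
  fderivWithin ℝ (fderivWithin ℝ (extChartAt I x₀ ∘ (extChartAt I q).symm) (range I)) (range I)
    (extChartAt I q q)

variable [IsManifold I ∞ M]

theorem contDiffWithinAt_transition {q x₀ : M} (hq : q ∈ (chartAt H x₀).source) :
    ContDiffWithinAt ℝ ∞ (extChartAt I x₀ ∘ (extChartAt I q).symm) (range I) (extChartAt I q q) := by
  refine contDiffWithinAt_ext_coord_change x₀ q ?_
  rw [PartialEquiv.trans_source'', PartialEquiv.symm_symm, PartialEquiv.symm_target]
  exact mem_image_of_mem _ ⟨mem_extChartAt_source q, by rwa [extChartAt_source]⟩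

theorem transitionHessian_symm {q x₀ : M} (hq : q ∈ (chartAt H x₀).source) (a b : E) :
    transitionHessian I q x₀ a b = transitionHessian I q x₀ b a := by
  refine (contDiffWithinAt_transition (I := I) hq).isSymmSndFDerivWithinAt ?_ I.uniqueDiffOn ?_
    (mem_range_self _) a b
  · rw [minSmoothness_of_isRCLikeNormedField]
    exact ENat.LEInfty.out
  · exact I.range_subset_closure_interior (mem_range_self _)

theorem hasMFDerivAt_trivializationAt_tangent_snd {q x₀ : M} (hq : q ∈ (chartAt H x₀).source)
    (v : TangentSpace I q) :
    HasMFDerivAt I.tangent 𝓘(ℝ, E)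
      (fun x : TangentBundle I M => (trivializationAt E (TangentSpace I) x₀ x).2) ⟨q, v⟩
      ((tangentCoordChange I q x₀ q).comp (ContinuousLinearMap.snd ℝ E E) +
        ((transitionHessian I q x₀).flip v).comp (ContinuousLinearMap.fst ℝ E E)) := by
  have hbase : (⟨q, v⟩ : TangentBundle I M) ∈ (trivializationAt E (TangentSpace I) x₀).source :=
    (trivializationAt E (TangentSpace I) x₀).mem_source.2 hq
  refine ⟨continuous_snd.continuousAt.comp
      ((trivializationAt E (TangentSpace I) x₀).continuousAt hbase), ?_⟩
  set p : TangentBundle I M := ⟨q, v⟩ with hp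
  set φ := extChartAt I x₀ ∘ (extChartAt I q).symm with hφ
  have hev : ∀ y ∈ (extChartAt I.tangent p).target,
      ((extChartAt I.tangent p).symm y).proj ∈ (chartAt H x₀).source →
      (trivializationAt E (TangentSpace I) x₀ ((extChartAt I.tangent p).symm y)).2 =
        fderivWithin ℝ φ (range I) y.1 y.2 := by
    intro y hy hx
    have h1 := extChartAt_totalSpace_symm p hy
    have h2 := ((mem_extChartAt_totalSpace_source _ _).1
      ((extChartAt I.tangent p).map_target hy)).1
    rw [trivializationAt_tangent_coordChange (q := q) _ h2 hx, tangentCoordChange_def]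
    have e1 : extChartAt I q ((extChartAt I.tangent p).symm y).proj = y.1 := h1.1
    have e2 : (trivializationAt E (TangentSpace I) q ((extChartAt I.tangent p).symm y)).2 = y.2 :=
      h1.2
    rw [e1, e2]
  have hd : HasFDerivWithinAt (fun y : E × E => fderivWithin ℝ φ (range I) y.1 y.2)
      ((tangentCoordChange I q x₀ q).comp (ContinuousLinearMap.snd ℝ E E) +
        ((transitionHessian I q x₀).flip v).comp (ContinuousLinearMap.fst ℝ E E))
      (range I.tangent) (extChartAt I.tangent p p) := by
    have hpp : extChartAt I.tangent p p = (extChartAt I q q, v) := by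
      refine (extChartAt_totalSpace_apply p p (FiberBundle.mem_baseSet_trivializationAt' _)).trans ?_
      exact Prod.ext rfl (trivializationAt_tangent_self q v)
    rw [hpp]
    have hD : HasFDerivWithinAt (fderivWithin ℝ φ (range I)) (transitionHessian I q x₀) (range I)
        (extChartAt I q q) :=
      (((contDiffWithinAt_transition (I := I) hq).fderivWithin_right (m := 1) I.uniqueDiffOn
        (by norm_cast) (mem_range_self _)).differentiableWithinAt one_ne_zero).hasFDerivWithinAt
    have hD' : HasFDerivWithinAt (fun y : E × E => fderivWithin ℝ φ (range I) y.1)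
        ((transitionHessian I q x₀).comp (ContinuousLinearMap.fst ℝ E E)) (range I.tangent)
        (extChartAt I q q, v) := by
      refine HasFDerivWithinAt.comp (t := range I) (g := fderivWithin ℝ φ (range I)) _ hD
        hasFDerivWithinAt_fst ?_
      rintro _ ⟨z, rfl⟩
      exact mem_range_self _
    have := hD'.clm_apply (hasFDerivWithinAt_snd (p := ((extChartAt I q q, v) : E × E)))
    exact this
  refine hd.congr_of_eventuallyEq ?_ ?_
  · have hcont : ContinuousAt (fun y => ((extChartAt I.tangent p).symm y).proj)
        (extChartAt I.tangent p p) :=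
      (FiberBundle.continuous_proj E (TangentSpace I : M → Type _)).continuousAt.comp
        (continuousAt_extChartAt_symm p)
    have hmem : ∀ᶠ y in 𝓝[range I.tangent] (extChartAt I.tangent p p),
        ((extChartAt I.tangent p).symm y).proj ∈ (chartAt H x₀).source := by
      refine nhdsWithin_le_nhds (hcont ((chartAt H x₀).open_source.mem_nhds ?_))
      simp only [extChartAt_to_inv]
      exact hq
    filter_upwards [extChartAt_target_mem_nhdsWithin (I := I.tangent) p, hmem] with y hy hx
    exact hev y hy hx
  · refine hev _ (mem_extChartAt_target p) ?_
    rw [extChartAt_to_inv]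
    exact hq

end Tangent

section Pairing

open Bundle

variable {n : ℕ} [NeZero n] {Q : Type*} [TopologicalSpace Q]
  [ChartedSpace (EuclideanHalfSpace n) Q] [IsManifold (𝓡∂ n) ∞ Q]

/-- The trivialization of the tangent bundle over the preferred chart at `q`. -/
abbrev tangentTriv (q : Q) : Trivialization (Coord n)
    (TotalSpace.proj : TangentBundle (𝓡∂ n) Q → Q) :=
  trivializationAt (Coord n) (TangentSpace (𝓡∂ n)) q

/-- The trivialization of the cotangent bundle over the preferred chart at `q`. -/
abbrev cotangentTriv (q : Q) : Trivialization (Coord n →L[ℝ] ℝ)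
    (TotalSpace.proj : CotangentBundle n Q → Q) :=
  trivializationAt (Coord n →L[ℝ] ℝ) (fun q : Q => TangentSpace (𝓡∂ n) q →L[ℝ] ℝ) q

theorem mem_cotangentTriv_baseSet {q x : Q} :
    x ∈ (cotangentTriv (n := n) q).baseSet ↔ x ∈ (chartAt (EuclideanHalfSpace n) q).source := by
  change x ∈ (tangentTriv (n := n) q).baseSet ∩ (trivializationAt ℝ (Bundle.Trivial Q ℝ) q).baseSet ↔ _
  simp

theorem tangentTriv_symmL_apply {q x : Q} (hx : x ∈ (chartAt (EuclideanHalfSpace n) q).source)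
    (w : TangentSpace (𝓡∂ n) x) : (tangentTriv q).symmL ℝ x (tangentTriv q ⟨x, w⟩).2 = w := by
  rw [(tangentTriv q).symmL_apply hx]
  exact (tangentTriv q).symm_apply_apply_mk hx w

theorem cotangentTriv_apply {q x : Q} (p : TangentSpace (𝓡∂ n) x →L[ℝ] ℝ) (w : Coord n) :
    (cotangentTriv q ⟨x, p⟩).2 w = p ((tangentTriv q).symmL ℝ x w) := by
  have h := hom_trivializationAt_apply (RingHom.id ℝ) (F₁ := Coord n)
    (E₁ := fun x : Q => TangentSpace (𝓡∂ n) x) (F₂ := ℝ) (E₂ := Bundle.Trivial Q ℝ) q ⟨x, p⟩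
  have h' := congrArg Prod.snd h
  refine (DFunLike.congr_fun h' w).trans ?_
  simp [ContinuousLinearMap.inCoordinates]

theorem pairing_eq {q x : Q} (hx : x ∈ (chartAt (EuclideanHalfSpace n) q).source)
    (p : TangentSpace (𝓡∂ n) x →L[ℝ] ℝ) (w : TangentSpace (𝓡∂ n) x) :
    p w = (cotangentTriv q ⟨x, p⟩).2 (tangentTriv q ⟨x, w⟩).2 := by
  rw [cotangentTriv_apply, tangentTriv_symmL_apply hx]

theorem tangentTriv_symmL_self (q : Q) (w : Coord n) : (tangentTriv q).symmL ℝ q w = w := by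
  have h := trivializationAt_tangent_self (I := 𝓡∂ n) q w
  have h2 := tangentTriv_symmL_apply (mem_chart_source (EuclideanHalfSpace n) q)
    (w : TangentSpace (𝓡∂ n) q)
  exact (congrArg ((tangentTriv q).symmL ℝ q) h).symm.trans h2

theorem cotangentTriv_self (q : Q) (p : TangentSpace (𝓡∂ n) q →L[ℝ] ℝ) :
    (cotangentTriv q ⟨q, p⟩).2 = p := by
  ext w
  exact (cotangentTriv_apply p w).trans
    (congrArg p (tangentTriv_symmL_self q w))

theorem hasDerivWithinAt_pairing {q : ℝ → Q} {p : ∀ t, TangentSpace (𝓡∂ n) (q t) →L[ℝ] ℝ}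
    {w : ∀ t, TangentSpace (𝓡∂ n) (q t)} {s : Set ℝ} {τ : ℝ}
    {p' : TangentSpace 𝓘(ℝ, ℝ) τ →L[ℝ]
      TangentSpace (cotangentModel n) (⟨q τ, p τ⟩ : CotangentBundle n Q)}
    {w' : TangentSpace 𝓘(ℝ, ℝ) τ →L[ℝ]
      TangentSpace (𝓡∂ n).tangent (⟨q τ, w τ⟩ : TangentBundle (𝓡∂ n) Q)}
    (hp : HasMFDerivWithinAt 𝓘(ℝ, ℝ) (cotangentModel n)
      (fun t => (⟨q t, p t⟩ : CotangentBundle n Q)) s τ p')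
    (hw : HasMFDerivWithinAt 𝓘(ℝ, ℝ) (𝓡∂ n).tangent
      (fun t => (⟨q t, w t⟩ : TangentBundle (𝓡∂ n) Q)) s τ w') :
    HasDerivWithinAt (fun t => p t (w t))
      ((Prod.snd (α := Coord n) (β := Coord n →L[ℝ] ℝ) (p' (1 : ℝ))) (w τ) +
        p τ (Prod.snd (α := Coord n) (β := Coord n) (w' (1 : ℝ)))) s τ := by
  have hp2 : HasFDerivWithinAt (fun t => (cotangentTriv (q τ) ⟨q t, p t⟩).2)
      ((ContinuousLinearMap.snd ℝ (Coord n) (Coord n →L[ℝ] ℝ)).comp p') s τ :=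
    hp.trivializationAt_snd.hasFDerivWithinAt
  have hw2 : HasFDerivWithinAt (fun t => (tangentTriv (q τ) ⟨q t, w t⟩).2)
      ((ContinuousLinearMap.snd ℝ (Coord n) (Coord n)).comp w') s τ :=
    hw.trivializationAt_snd.hasFDerivWithinAt
  have h := (hp2.hasDerivWithinAt).clm_apply hw2.hasDerivWithinAt
  have hq : ContinuousWithinAt q s τ := hw.totalSpace_proj.continuousWithinAt
  have hev : ∀ᶠ t in 𝓝[s] τ, p t (w t) =
      (cotangentTriv (q τ) ⟨q t, p t⟩).2 (tangentTriv (q τ) ⟨q t, w t⟩).2 := by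
    filter_upwards [hq ((chartAt (EuclideanHalfSpace n) (q τ)).open_source.mem_nhds
      (mem_chart_source _ _))] with t ht
    exact pairing_eq ht _ _
  have h' := h.congr_of_eventuallyEq hev (pairing_eq (mem_chart_source _ _) _ _)
  convert! h' using 1
  rw [cotangentTriv_self, trivializationAt_tangent_self]
  rfl

theorem contMDiffWithinAt_pairing {EM : Type*} [NormedAddCommGroup EM] [NormedSpace ℝ EM]
    {m : ℕ∞ω} (hm : m ≤ ∞) {q : EM → Q} {p : ∀ t, TangentSpace (𝓡∂ n) (q t) →L[ℝ] ℝ}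
    {w : ∀ t, TangentSpace (𝓡∂ n) (q t)} {s : Set EM} {τ : EM}
    (hp : ContMDiffWithinAt 𝓘(ℝ, EM) (cotangentModel n) m
      (fun t => (⟨q t, p t⟩ : CotangentBundle n Q)) s τ)
    (hw : ContMDiffWithinAt 𝓘(ℝ, EM) (𝓡∂ n).tangent m
      (fun t => (⟨q t, w t⟩ : TangentBundle (𝓡∂ n) Q)) s τ) :
    ContDiffWithinAt ℝ m (fun t => p t (w t)) s τ := by
  have : IsManifold (𝓡∂ n) m Q := IsManifold.of_le hm
  have h := ContMDiffWithinAt.clm_bundle_apply (E₂ := Bundle.Trivial Q ℝ) (F₂ := ℝ) (b := q)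
    (ϕ := p) (v := w) hp hw
  rw [← contMDiffWithinAt_iff_contDiffWithinAt]
  exact (contMDiffWithinAt_totalSpace.1 h).2

end Pairing

section TwoVariables

open Bundle

theorem uniqueDiffOn_Ioo_prod_Icc {ε a b : ℝ} (hab : a < b) :
    UniqueDiffOn ℝ (Ioo (-ε) ε ×ˢ Icc a b) :=
  isOpen_Ioo.uniqueDiffOn.prod (uniqueDiffOn_Icc hab)

theorem mem_closure_interior_Ioo_prod_Icc {ε a b : ℝ} (hab : a < b) {x : ℝ × ℝ}
    (hx : x ∈ Ioo (-ε) ε ×ˢ Icc a b) : x ∈ closure (interior (Ioo (-ε) ε ×ˢ Icc a b)) := by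
  rw [interior_prod_eq, interior_Ioo, interior_Icc, closure_prod_eq, closure_Ioo hab.ne]
  exact ⟨subset_closure hx.1, hx.2⟩

theorem hasDerivAt_integral_of_contDiffOn {F : ℝ × ℝ → ℝ} {ε a b : ℝ} (hε : 0 < ε) (hab : a < b)
    (hF : ContDiffOn ℝ 1 F (Ioo (-ε) ε ×ˢ Icc a b)) :
    HasDerivAt (fun s => ∫ t in a..b, F (s, t)) (∫ t in a..b, deriv (fun s => F (s, t)) 0) 0 := by
  set S := Ioo (-ε) ε ×ˢ Icc a b with hS
  have huniq : UniqueDiffOn ℝ S := uniqueDiffOn_Ioo_prod_Icc hab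
  have hD : ∀ s ∈ Ioo (-ε) ε, ∀ t ∈ Icc a b,
      HasDerivAt (fun s => F (s, t)) (fderivWithin ℝ F S (s, t) (1, 0)) s := by
    intro s hs t ht
    have h1 := ((hF (s, t) ⟨hs, ht⟩).differentiableWithinAt one_ne_zero).hasFDerivWithinAt
    have h2 : HasDerivWithinAt (fun s : ℝ => (s, t)) ((1 : ℝ), (0 : ℝ)) (Ioo (-ε) ε) s :=
      ((hasDerivAt_id s).prodMk (hasDerivAt_const s t)).hasDerivWithinAt
    exact (h1.comp_hasDerivWithinAt s h2 (fun r hr => mk_mem_prod hr ht)).hasDerivAt (Ioo_mem_nhds hs.1 hs.2)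
  have hcont : ContinuousOn (fun x => fderivWithin ℝ F S x (1, 0)) S :=
    (hF.continuousOn_fderivWithin huniq le_rfl).clm_apply continuousOn_const
  have hsub : Icc (-(ε / 2)) (ε / 2) ×ˢ Icc a b ⊆ S :=
    prod_mono (Icc_subset_Ioo (by linarith) (by linarith)) subset_rfl
  obtain ⟨K, hK⟩ := (isCompact_Icc.prod isCompact_Icc).exists_bound_of_continuousOn
    (hcont.mono hsub)
  have h0 : (0 : ℝ) ∈ Ioo (-ε) ε := ⟨by linarith, hε⟩
  have hslice : ∀ G : ℝ × ℝ → ℝ, ContinuousOn G S → ∀ s ∈ Ioo (-ε) ε,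
      ContinuousOn (fun t => G (s, t)) (Icc a b) := fun G hG s hs =>
    hG.comp (by fun_prop) (fun t ht => ⟨hs, ht⟩)
  have hmeas : ∀ G : ℝ × ℝ → ℝ, ContinuousOn G S → ∀ s ∈ Ioo (-ε) ε,
      IntervalIntegrable (fun t => G (s, t)) MeasureTheory.volume a b := fun G hG s hs =>
    ContinuousOn.intervalIntegrable (by rw [uIcc_of_le hab.le]; exact hslice G hG s hs)
  have key := (intervalIntegral.hasDerivAt_integral_of_dominated_loc_of_deriv_le
    (μ := MeasureTheory.volume) (a := a) (b := b)
    (F := fun s t => F (s, t)) (F' := fun s t => fderivWithin ℝ F S (s, t) (1, 0))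
    (x₀ := 0) (s := Ioo (-(ε / 2)) (ε / 2)) (bound := fun _ => K)
    (Ioo_mem_nhds (by linarith) (by linarith)) ?_ (hmeas F hF.continuousOn 0 h0) ?_ ?_ ?_ ?_).2
  · convert! key using 1
    refine intervalIntegral.integral_congr fun t ht => ?_
    rw [uIcc_of_le hab.le] at ht
    exact (hD 0 h0 t ht).deriv
  · filter_upwards [Ioo_mem_nhds h0.1 h0.2] with s hs
    exact (hmeas F hF.continuousOn s hs).def'.aestronglyMeasurable
  · exact (hmeas _ hcont 0 h0).def'.aestronglyMeasurable
  · refine Filter.Eventually.of_forall fun t ht s hs => hK (s, t) ⟨Ioo_subset_Icc_self hs, ?_⟩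
    rw [← uIcc_of_le hab.le]
    exact uIoc_subset_uIcc ht
  · exact intervalIntegrable_const
  · refine Filter.Eventually.of_forall fun t ht s hs =>
      hD s (Ioo_subset_Ioo (by linarith) (by linarith) hs) t ?_
    rw [← uIcc_of_le hab.le]
    exact uIoc_subset_uIcc ht

/-- The mixed partial derivatives at `s = 0` of a map of class `C²` on `(-ε, ε) × [a, b]`. -/
theorem hasDerivAt_mixed {E : Type*} [NormedAddCommGroup E] [NormedSpace ℝ E] {g : ℝ × ℝ → E}
    {ε a b t : ℝ} (hε : 0 < ε) (hab : a < b) (ht : t ∈ Icc a b)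
    (hg : ContDiffWithinAt ℝ 2 g (Ioo (-ε) ε ×ˢ Icc a b) (0, t)) :
    ∃ X : E,
      HasDerivAt (fun s => fderivWithin ℝ g (Ioo (-ε) ε ×ˢ Icc a b) (s, t) (0, 1)) X 0 ∧
      HasDerivWithinAt (fun t' => fderivWithin ℝ g (Ioo (-ε) ε ×ˢ Icc a b) (0, t') (1, 0)) X
        (Icc a b) t := by
  set S := Ioo (-ε) ε ×ˢ Icc a b with hS
  have h0 : (0 : ℝ) ∈ Ioo (-ε) ε := ⟨by linarith, hε⟩
  have huniq : UniqueDiffOn ℝ S := uniqueDiffOn_Ioo_prod_Icc hab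
  have hx : ((0 : ℝ), t) ∈ S := ⟨h0, ht⟩
  have hD := ((hg.fderivWithin_right (m := 1) huniq le_rfl hx).differentiableWithinAt
    one_ne_zero).hasFDerivWithinAt
  have hsymm := hg.isSymmSndFDerivWithinAt (by simp) huniq
    (mem_closure_interior_Ioo_prod_Icc hab hx) hx
  refine ⟨fderivWithin ℝ (fderivWithin ℝ g S) S (0, t) (1, 0) (0, 1), ?_, ?_⟩
  · have h2 : HasDerivWithinAt (fun s : ℝ => (s, t)) ((1 : ℝ), (0 : ℝ)) (Ioo (-ε) ε) 0 :=
      ((hasDerivAt_id _).prodMk (hasDerivAt_const _ t)).hasDerivWithinAt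
    have h3 := (hD.comp_hasDerivWithinAt (0 : ℝ) h2 (fun r hr => mk_mem_prod hr ht)).hasDerivAt
      (Ioo_mem_nhds h0.1 h0.2)
    simpa using h3.clm_apply (hasDerivAt_const (0 : ℝ) ((0 : ℝ), (1 : ℝ)))
  · have h2 : HasDerivWithinAt (fun r : ℝ => ((0 : ℝ), r)) ((0 : ℝ), (1 : ℝ)) (Icc a b) t :=
      ((hasDerivAt_const _ _).prodMk (hasDerivAt_id _)).hasDerivWithinAt
    have h3 := hD.comp_hasDerivWithinAt t h2 (fun r hr => mk_mem_prod h0 hr)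
    rw [hsymm]
    simpa using h3.clm_apply (hasDerivWithinAt_const t (Icc a b) ((1 : ℝ), (0 : ℝ)))

variable {E : Type*} [NormedAddCommGroup E] [NormedSpace ℝ E] {H : Type*} [TopologicalSpace H]
  {I : ModelWithCorners ℝ E H} {M : Type*} [TopologicalSpace M] [ChartedSpace H M]

theorem mfderivWithin_slice_snd {U : ℝ × ℝ → M} {S D : Set ℝ} {s t : ℝ}
    (hU : MDifferentiableWithinAt 𝓘(ℝ, ℝ × ℝ) I U (S ×ˢ D) (s, t)) (hs : s ∈ S)
    (hD : UniqueDiffWithinAt ℝ D t) :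
    mfderivWithin 𝓘(ℝ, ℝ) I (fun r => U (s, r)) D t (1 : ℝ) =
      mfderivWithin 𝓘(ℝ, ℝ × ℝ) I U (S ×ˢ D) (s, t) ((0, 1) : ℝ × ℝ) := by
  have h2 : HasFDerivWithinAt (fun r : ℝ => (s, r)) (ContinuousLinearMap.inr ℝ ℝ ℝ) D t :=
    (hasFDerivAt_prodMk_right s t).hasFDerivWithinAt
  have h3 := hU.hasMFDerivWithinAt.comp t h2.hasMFDerivWithinAt (fun r hr => mk_mem_prod hs hr)
  have h4 := h3.mfderivWithin hD.uniqueMDiffWithinAt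
  exact DFunLike.congr_fun h4 (1 : ℝ)

theorem hasMFDerivAt_slice_fst {U : ℝ × ℝ → M} {S D : Set ℝ} {s t : ℝ}
    (hU : MDifferentiableWithinAt 𝓘(ℝ, ℝ × ℝ) I U (S ×ˢ D) (s, t)) (hs : S ∈ 𝓝 s) (ht : t ∈ D) :
    HasMFDerivAt 𝓘(ℝ, ℝ) I (fun r => U (r, t)) s
      ((mfderivWithin 𝓘(ℝ, ℝ × ℝ) I U (S ×ˢ D) (s, t)).comp (ContinuousLinearMap.inl ℝ ℝ ℝ)) := by
  have h2 : HasFDerivWithinAt (fun r : ℝ => (r, t)) (ContinuousLinearMap.inl ℝ ℝ ℝ) S s :=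
    (hasFDerivAt_prodMk_left s t).hasFDerivWithinAt
  have h3 := hU.hasMFDerivWithinAt.comp s h2.hasMFDerivWithinAt (fun r hr => mk_mem_prod hr ht)
  exact h3.hasMFDerivAt hs

theorem contMDiffOn_mfderivWithin_apply [IsManifold I 1 M] {EM : Type*} [NormedAddCommGroup EM]
    [NormedSpace ℝ EM] {m k : ℕ∞ω} {U : EM → M} {S : Set EM}
    (hU : ContMDiffOn 𝓘(ℝ, EM) I k U S) (hmk : m + 1 ≤ k) (hS : UniqueDiffOn ℝ S) (e : EM) :
    ContMDiffOn 𝓘(ℝ, EM) I.tangent m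
      (fun x => (⟨U x, mfderivWithin 𝓘(ℝ, EM) I U S x e⟩ : TangentBundle I M)) S := by
  have h1 := hU.contMDiffOn_tangentMapWithin hmk hS.uniqueMDiffOn
  have h2 : ContMDiffOn 𝓘(ℝ, EM) 𝓘(ℝ, EM).tangent m
      (fun x => (⟨x, e⟩ : TangentBundle 𝓘(ℝ, EM) EM)) S := by
    intro x hx
    exact contMDiffWithinAt_vectorSpace_iff_contDiffWithinAt.2 contDiffWithinAt_const
  exact h1.comp h2 (fun x hx => hx)

end TwoVariables

section Family

open Bundle

variable {n : ℕ} [NeZero n] {Q : Type*} [TopologicalSpace Q]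
  [ChartedSpace (EuclideanHalfSpace n) Q] [IsManifold (𝓡∂ n) ∞ Q]

theorem Side.exists_dom_eq_Icc {τ₀ τc τ₁ : ℝ} (h₀ : τ₀ < τc) (h₁ : τc < τ₁) (σ : Side) :
    ∃ a b : ℝ, a < b ∧ σ.dom τ₀ τc τ₁ = Icc a b ∧ Icc a b ⊆ Icc τ₀ τ₁ := by
  cases σ
  · exact ⟨τ₀, τc, h₀, rfl, Icc_subset_Icc_right h₁.le⟩
  · exact ⟨τc, τ₁, h₁, rfl, Icc_subset_Icc_left h₀.le⟩

variable {L : TangentBundle (𝓡∂ n) Q → ℝ} {τ₀ τc τ₁ ε : ℝ} {C : ℝ → CollisionPath n Q}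

theorem derivWithin_slice_snd {T : ℝ × ℝ → ℝ} {S D : Set ℝ} {s t : ℝ}
    (hT : DifferentiableWithinAt ℝ T (S ×ˢ D) (s, t)) (hs : s ∈ S)
    (hD : UniqueDiffWithinAt ℝ D t) :
    derivWithin (fun r => T (s, r)) D t = fderivWithin ℝ T (S ×ˢ D) (s, t) (0, 1) := by
  have h2 : HasDerivWithinAt (fun r : ℝ => (s, r)) ((0 : ℝ), (1 : ℝ)) D t :=
    ((hasDerivAt_const _ _).prodMk (hasDerivAt_id _)).hasDerivWithinAt
  exact (hT.hasFDerivWithinAt.comp_hasDerivWithinAt t h2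
    (fun r hr => mk_mem_prod hs hr)).derivWithin hD

theorem IsPathFamily.timeRate_eq (h01 : τ₀ < τ₁) (hC : IsPathFamily τ₀ τc τ₁ ε C) {s t : ℝ}
    (hs : s ∈ Ioo (-ε) ε) (ht : t ∈ Icc τ₀ τ₁) :
    (C s).timeRate τ₀ τ₁ t = fderivWithin ℝ (fun x : ℝ × ℝ => (C x.1).time x.2)
      (Ioo (-ε) ε ×ˢ Icc τ₀ τ₁) (s, t) (0, 1) :=
  derivWithin_slice_snd (T := fun x : ℝ × ℝ => (C x.1).time x.2)
    ((hC.time_smooth (s, t) ⟨hs, ht⟩).differentiableWithinAt two_ne_zero) hs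
    (uniqueDiffOn_Icc h01 t ht)

theorem IsPathFamily.timeRate_contDiffOn (h01 : τ₀ < τ₁) (hC : IsPathFamily τ₀ τc τ₁ ε C) :
    ContDiffOn ℝ 1 (fun x : ℝ × ℝ => (C x.1).timeRate τ₀ τ₁ x.2) (Ioo (-ε) ε ×ˢ Icc τ₀ τ₁) := by
  have h1 := (hC.time_smooth.fderivWithin (uniqueDiffOn_Ioo_prod_Icc h01) (m := 1) le_rfl).clm_apply
    (contDiffOn_const (c := ((0 : ℝ), (1 : ℝ))))
  exact h1.congr fun x hx => hC.timeRate_eq h01 hx.1 hx.2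

theorem IsPathFamily.posRate_eq (hC : IsPathFamily τ₀ τc τ₁ ε C) {σ : Side} {a b : ℝ}
    (hab : a < b) (hD : σ.dom τ₀ τc τ₁ = Icc a b) {s t : ℝ}
    (hs : s ∈ Ioo (-ε) ε) (ht : t ∈ Icc a b) :
    (C s).posRate τ₀ τc τ₁ σ t = mfderivWithin 𝓘(ℝ, ℝ × ℝ) (𝓡∂ n)
      (fun x : ℝ × ℝ => (C x.1).pos x.2) (Ioo (-ε) ε ×ˢ Icc a b) (s, t) ((0, 1) : ℝ × ℝ) := by
  have hU := hC.pos_smooth σ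
  rw [hD] at hU
  rw [CollisionPath.posRate, hD]
  exact mfderivWithin_slice_snd (U := fun x : ℝ × ℝ => (C x.1).pos x.2)
    ((hU (s, t) ⟨hs, ht⟩).mdifferentiableWithinAt two_ne_zero) hs (uniqueDiffOn_Icc hab t ht)

theorem IsPathFamily.posRate_contMDiffOn (hC : IsPathFamily τ₀ τc τ₁ ε C) {σ : Side} {a b : ℝ}
    (hab : a < b) (hD : σ.dom τ₀ τc τ₁ = Icc a b) :
    ContMDiffOn 𝓘(ℝ, ℝ × ℝ) (𝓡∂ n).tangent 1
      (fun x : ℝ × ℝ => (⟨(C x.1).pos x.2, (C x.1).posRate τ₀ τc τ₁ σ x.2⟩ :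
        TangentBundle (𝓡∂ n) Q)) (Ioo (-ε) ε ×ˢ Icc a b) := by
  have hU := hC.pos_smooth σ
  rw [hD] at hU
  refine (contMDiffOn_mfderivWithin_apply hU (m := 1) le_rfl
    (uniqueDiffOn_Ioo_prod_Icc hab) ((0, 1) : ℝ × ℝ)).congr fun x hx => ?_
  exact congrArg (TotalSpace.mk _) (hC.posRate_eq hab hD hx.1 hx.2)

theorem actionDensity_eq {c : CollisionPath n Q} {σ : Side} {t : ℝ}
    (h : c.timeRate τ₀ τ₁ t ≠ 0) :
    actionDensity L τ₀ τc τ₁ c σ t = c.timeRate τ₀ τ₁ t * L (c.velCurve σ t) +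
      c.mom σ t (c.posRate τ₀ τc τ₁ σ t) - c.timeRate τ₀ τ₁ t * c.mom σ t (c.vel σ t) := by
  rw [actionDensity, map_sub, map_smul, smul_eq_mul]
  field_simp
  ring

theorem IsPathFamily.actionDensity_contDiffOn (hL : ContMDiff (𝓡∂ n).tangent 𝓘(ℝ, ℝ) ∞ L)
    (h01 : τ₀ < τ₁) (hC : IsPathFamily τ₀ τc τ₁ ε C) {σ : Side} {a b : ℝ}
    (hab : a < b) (hD : σ.dom τ₀ τc τ₁ = Icc a b) (hsub : Icc a b ⊆ Icc τ₀ τ₁) :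
    ContDiffOn ℝ 1 (fun x : ℝ × ℝ => actionDensity L τ₀ τc τ₁ (C x.1) σ x.2)
      (Ioo (-ε) ε ×ˢ Icc a b) := by
  have hT := (hC.timeRate_contDiffOn h01).mono (prod_mono (subset_refl (Ioo (-ε) ε)) hsub)
  have hv := hC.vel_smooth σ
  have hp := hC.mom_smooth σ
  rw [hD] at hv hp
  have hv1 := hv.of_le one_le_two
  have hp1 := hp.of_le one_le_two
  have hLv : ContDiffOn ℝ 1 (fun x : ℝ × ℝ => L ((C x.1).velCurve σ x.2))
      (Ioo (-ε) ε ×ˢ Icc a b) := by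
    rw [← contMDiffOn_iff_contDiffOn]
    exact (hL.of_le (by norm_cast)).comp_contMDiffOn hv1
  have hpv : ContDiffOn ℝ 1 (fun x : ℝ × ℝ => (C x.1).mom σ x.2 ((C x.1).vel σ x.2))
      (Ioo (-ε) ε ×ˢ Icc a b) := fun x hx =>
    contMDiffWithinAt_pairing (by norm_cast) (hp1 x hx) (hv1 x hx)
  have hpq : ContDiffOn ℝ 1
      (fun x : ℝ × ℝ => (C x.1).mom σ x.2 ((C x.1).posRate τ₀ τc τ₁ σ x.2))
      (Ioo (-ε) ε ×ˢ Icc a b) := fun x hx =>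
    contMDiffWithinAt_pairing (by norm_cast) (hp1 x hx) (hC.posRate_contMDiffOn hab hD x hx)
  refine (((hT.mul hLv).add hpq).sub (hT.mul hpv)).congr fun x hx => ?_
  exact actionDensity_eq ((hC.isPath x.1 hx.1).time_pos x.2 (hsub hx.2)).ne'

variable {δ : Variation (C 0)}

theorem IsPathFamily.hasDerivAt_timeRate (hε : 0 < ε) (h01 : τ₀ < τ₁)
    (hC : IsPathFamily τ₀ τc τ₁ ε C) (hδ : IsVelocityAtZero τ₀ τc τ₁ C δ) {t : ℝ}
    (ht : t ∈ Icc τ₀ τ₁) :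
    HasDerivAt (fun s => (C s).timeRate τ₀ τ₁ t) (δ.timeRate τ₀ τ₁ t) 0 := by
  have h0 : (0 : ℝ) ∈ Ioo (-ε) ε := ⟨by linarith, hε⟩
  obtain ⟨X, hX1, hX2⟩ := hasDerivAt_mixed hε h01 ht (hC.time_smooth (0, t) ⟨h0, ht⟩)
  have e1 : δ.timeRate τ₀ τ₁ t = X := by
    refine (hX2.congr (fun r hr => ?_) ?_).derivWithin (uniqueDiffOn_Icc h01 t ht)
    all_goals
      rw [← hδ.time _ (by assumption)]
      refine HasDerivAt.deriv ?_
      have h1 := ((hC.time_smooth (0, _) ⟨h0, by assumption⟩).differentiableWithinAt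
        two_ne_zero).hasFDerivWithinAt
      have h2 := (h1.comp_hasDerivWithinAt (0 : ℝ)
        ((hasDerivAt_id _).prodMk (hasDerivAt_const _ _)).hasDerivWithinAt
        (fun r hr => mk_mem_prod hr (by assumption))).hasDerivAt (Ioo_mem_nhds h0.1 h0.2)
      exact h2
  rw [e1]
  refine hX1.congr_of_eventuallyEq ?_
  filter_upwards [Ioo_mem_nhds h0.1 h0.2] with s hs
  exact hC.timeRate_eq h01 hs ht

theorem IsPathFamily.pos_contDiffWithinAt (hε : 0 < ε) (hC : IsPathFamily τ₀ τc τ₁ ε C)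
    {σ : Side} {a b : ℝ} (hD : σ.dom τ₀ τc τ₁ = Icc a b) {t : ℝ} (ht : t ∈ Icc a b) :
    ContDiffWithinAt ℝ 2
      (extChartAt (𝓡∂ n) ((C 0).pos t) ∘ fun x : ℝ × ℝ => (C x.1).pos x.2)
      (Ioo (-ε) ε ×ˢ Icc a b) (0, t) := by
  have hU := hC.pos_smooth σ
  rw [hD] at hU
  rw [← contMDiffWithinAt_iff_contDiffWithinAt]
  exact (contMDiffAt_extChartAt (I := 𝓡∂ n) (n := 2)).comp_contMDiffWithinAt
    (f := fun x : ℝ × ℝ => (C x.1).pos x.2) ((0 : ℝ), t) (hU (0, t) ⟨⟨by linarith, hε⟩, ht⟩)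

theorem IsPathFamily.hasMFDerivAt_posRate (hε : 0 < ε)
    (hC : IsPathFamily τ₀ τc τ₁ ε C) (hδ : IsVelocityAtZero τ₀ τc τ₁ C δ) {σ : Side} {a b : ℝ}
    (hab : a < b) (hD : σ.dom τ₀ τc τ₁ = Icc a b) (hsub : Icc a b ⊆ Icc τ₀ τ₁)
    {t : ℝ} (ht : t ∈ Icc a b) :
    ∃ w' : TangentSpace 𝓘(ℝ, ℝ) (0 : ℝ) →L[ℝ] TangentSpace (𝓡∂ n).tangent
        (⟨(C 0).pos t, (C 0).posRate τ₀ τc τ₁ σ t⟩ : TangentBundle (𝓡∂ n) Q),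
      HasMFDerivAt 𝓘(ℝ, ℝ) (𝓡∂ n).tangent
        (fun s : ℝ => (⟨(C s).pos t, (C s).posRate τ₀ τc τ₁ σ t⟩ : TangentBundle (𝓡∂ n) Q)) 0 w' ∧
      Prod.snd (α := Coord n) (β := Coord n) (w' (1 : ℝ)) = δ.posRateFibre τ₀ τc τ₁ σ t := by
  have h0 : (0 : ℝ) ∈ Ioo (-ε) ε := ⟨by linarith, hε⟩
  have huniq := uniqueDiffOn_Ioo_prod_Icc (ε := ε) hab
  set q := (C 0).pos t with hq
  set U : ℝ × ℝ → Q := fun x => (C x.1).pos x.2 with hUdef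
  set S := Ioo (-ε) ε ×ˢ Icc a b with hS
  have hU : ContMDiffOn 𝓘(ℝ, ℝ × ℝ) (𝓡∂ n) 2 U S := by
    have := hC.pos_smooth σ
    rwa [hD] at this
  have hUd : ∀ x ∈ S, MDifferentiableWithinAt 𝓘(ℝ, ℝ × ℝ) (𝓡∂ n) U S x := fun x hx =>
    (hU x hx).mdifferentiableWithinAt two_ne_zero
  have htriv : ∀ x ∈ S, U x ∈ (chartAt (EuclideanHalfSpace n) q).source → ∀ e : ℝ × ℝ,
      (tangentTriv q ⟨U x, mfderivWithin 𝓘(ℝ, ℝ × ℝ) (𝓡∂ n) U S x e⟩).2 =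
        fderivWithin ℝ (extChartAt (𝓡∂ n) q ∘ U) S x e := fun x hx hxq e =>
    trivializationAt_mfderivWithin (hUd x hx) (huniq x hx) hxq e
  obtain ⟨X, hX1, hX2⟩ := hasDerivAt_mixed hε hab ht (hC.pos_contDiffWithinAt hε hD ht)
  have hnhds : ∀ᶠ x in 𝓝[S] ((0 : ℝ), t), U x ∈ (chartAt (EuclideanHalfSpace n) q).source :=
    (hU (0, t) ⟨h0, ht⟩).continuousWithinAt
      ((chartAt (EuclideanHalfSpace n) q).open_source.mem_nhds (mem_chart_source _ q))
  have h1 := hasMFDerivAt_slice_fst (((hC.posRate_contMDiffOn hab hD) (0, t)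
    ⟨h0, ht⟩).mdifferentiableWithinAt one_ne_zero) (Ioo_mem_nhds h0.1 h0.2) ht
  refine ⟨_, h1, ?_⟩
  have e1 : Prod.snd (α := Coord n) (β := Coord n) (((mfderivWithin 𝓘(ℝ, ℝ × ℝ) (𝓡∂ n).tangent
      (fun x : ℝ × ℝ => (⟨(C x.1).pos x.2, (C x.1).posRate τ₀ τc τ₁ σ x.2⟩ :
        TangentBundle (𝓡∂ n) Q)) S (0, t)).comp (ContinuousLinearMap.inl ℝ ℝ ℝ)) (1 : ℝ)) = X := by
    have h2 := (h1.hasMFDerivWithinAt (s := univ)).trivializationAt_snd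
    have h3 := h2.hasDerivWithinAt_apply_one.hasDerivAt Filter.univ_mem
    refine h3.unique (hX1.congr_of_eventuallyEq ?_)
    have hmap : Filter.Tendsto (fun s : ℝ => (s, t)) (𝓝 0) (𝓝[S] ((0 : ℝ), t)) := by
      refine tendsto_nhdsWithin_iff.2 ⟨Continuous.tendsto (by fun_prop) _, ?_⟩
      filter_upwards [Ioo_mem_nhds h0.1 h0.2] with s hs using ⟨hs, ht⟩
    filter_upwards [Ioo_mem_nhds h0.1 h0.2, hmap.eventually hnhds] with s hs hsq
    rw [← htriv (s, t) ⟨hs, ht⟩ hsq]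
    exact congrArg (fun w => (tangentTriv q ⟨(C s).pos t, w⟩).2) (hC.posRate_eq hab hD hs ht)
  refine e1.trans ?_
  have hpos : ∀ r ∈ Icc a b, δ.posCurve r =
      ⟨U (0, r), mfderivWithin 𝓘(ℝ, ℝ × ℝ) (𝓡∂ n) U S (0, r) ((1, 0) : ℝ × ℝ)⟩ := by
    intro r hr
    refine congrArg (TotalSpace.mk _) ?_
    rw [← hδ.pos r (hsub hr)]
    have h4 := hasMFDerivAt_slice_fst (hUd (0, r) ⟨h0, hr⟩) (Ioo_mem_nhds h0.1 h0.2) hr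
    exact DFunLike.congr_fun h4.mfderiv (1 : ℝ)
  have hposd : MDifferentiableWithinAt 𝓘(ℝ, ℝ) (𝓡∂ n).tangent δ.posCurve (Icc a b) t := by
    have h5 : ContMDiffOn 𝓘(ℝ, ℝ) 𝓘(ℝ, ℝ × ℝ) 1 (fun r : ℝ => ((0 : ℝ), r)) (Icc a b) :=
      contMDiffOn_iff_contDiffOn.2 (by fun_prop)
    have h6 := ((contMDiffOn_mfderivWithin_apply hU (m := 1) le_rfl huniq
      ((1, 0) : ℝ × ℝ)).comp h5 (fun r hr => ⟨h0, hr⟩)).congr hpos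
    exact (h6 t ht).mdifferentiableWithinAt one_ne_zero
  have h7 := hposd.hasMFDerivWithinAt.trivializationAt_snd.hasDerivWithinAt_apply_one
  have hmap : Filter.Tendsto (fun r : ℝ => ((0 : ℝ), r)) (𝓝[Icc a b] t) (𝓝[S] ((0 : ℝ), t)) := by
    refine tendsto_nhdsWithin_iff.2 ⟨(Continuous.tendsto (by fun_prop) _).mono_left
      nhdsWithin_le_nhds, ?_⟩
    filter_upwards [self_mem_nhdsWithin] with s hs using ⟨h0, hs⟩
  have h8 := hX2.congr_of_eventuallyEq_of_mem
    (f₁ := fun r => (tangentTriv q (δ.posCurve r)).2) (by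
      filter_upwards [hmap.eventually hnhds, self_mem_nhdsWithin] with r hrq hr
      rw [hpos r hr, htriv (0, r) ⟨h0, hr⟩ hrq]) ht
  have h9 := (uniqueDiffOn_Icc hab t ht).eq_deriv _ h8 h7
  rw [Variation.posRateFibre, hD]
  exact h9

theorem IsPathFamily.hasDerivAt_actionDensity (hL : ContMDiff (𝓡∂ n).tangent 𝓘(ℝ, ℝ) ∞ L)
    (hε : 0 < ε) (h01 : τ₀ < τ₁)
    (hC : IsPathFamily τ₀ τc τ₁ ε C) (hδ : IsVelocityAtZero τ₀ τc τ₁ C δ) {σ : Side} {a b : ℝ}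
    (hab : a < b) (hD : σ.dom τ₀ τc τ₁ = Icc a b) (hsub : Icc a b ⊆ Icc τ₀ τ₁)
    {t : ℝ} (ht : t ∈ Icc a b) :
    HasDerivAt (fun s => actionDensity L τ₀ τc τ₁ (C s) σ t)
      (actionDensityVariation L τ₀ τc τ₁ δ σ t) 0 := by
  have h0 : (0 : ℝ) ∈ Ioo (-ε) ε := ⟨by linarith, hε⟩
  have hT := hC.hasDerivAt_timeRate hε h01 hδ (hsub ht)
  have hv : HasMFDerivAt 𝓘(ℝ, ℝ) (𝓡∂ n).tangent (fun s => (C s).velCurve σ t) 0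
      (mfderiv 𝓘(ℝ, ℝ) (𝓡∂ n).tangent (fun s => (C s).velCurve σ t) 0) := by
    have := hC.vel_smooth σ
    rw [hD] at this
    have h1 := hasMFDerivAt_slice_fst ((this (0, t) ⟨h0, ht⟩).mdifferentiableWithinAt two_ne_zero)
      (Ioo_mem_nhds h0.1 h0.2) ht
    exact h1.mdifferentiableAt.hasMFDerivAt
  have hp : HasMFDerivAt 𝓘(ℝ, ℝ) (cotangentModel n) (fun s => (C s).momCurve σ t) 0
      (mfderiv 𝓘(ℝ, ℝ) (cotangentModel n) (fun s => (C s).momCurve σ t) 0) := by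
    have := hC.mom_smooth σ
    rw [hD] at this
    have h1 := hasMFDerivAt_slice_fst ((this (0, t) ⟨h0, ht⟩).mdifferentiableWithinAt two_ne_zero)
      (Ioo_mem_nhds h0.1 h0.2) ht
    exact h1.mdifferentiableAt.hasMFDerivAt
  obtain ⟨w', hw, hw2⟩ := hC.hasMFDerivAt_posRate hε hδ hab hD hsub ht
  have htD : t ∈ σ.dom τ₀ τc τ₁ := by rwa [hD]
  have ev : mfderiv 𝓘(ℝ, ℝ) (𝓡∂ n).tangent (fun s => (C s).velCurve σ t) 0 (1 : ℝ) = δ.vel σ t :=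
    hδ.vel σ t htD
  have ep : mfderiv 𝓘(ℝ, ℝ) (cotangentModel n) (fun s => (C s).momCurve σ t) 0 (1 : ℝ) =
      δ.mom σ t := hδ.mom σ t htD
  have hLd : HasDerivAt (fun s => L ((C s).velCurve σ t))
      (lagrangianDifferential L ((C 0).velCurve σ t) (δ.vel σ t)) 0 := by
    have h1 := (hL.mdifferentiableAt (by simp)).hasMFDerivAt.comp (0 : ℝ) hv
    have h2 := (h1.hasMFDerivWithinAt (s := univ)).hasDerivWithinAt_apply_one.hasDerivAt
      Filter.univ_mem
    rw [← ev]
    exact h2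
  have hpv := (hasDerivWithinAt_pairing (hp.hasMFDerivWithinAt (s := univ))
    hv.hasMFDerivWithinAt).hasDerivAt Filter.univ_mem
  have hpq := (hasDerivWithinAt_pairing (hp.hasMFDerivWithinAt (s := univ))
    hw.hasMFDerivWithinAt).hasDerivAt Filter.univ_mem
  have hpv' : HasDerivAt (fun s => (C s).mom σ t ((C s).vel σ t))
      (δ.momFibre σ t ((C 0).vel σ t) + (C 0).mom σ t (δ.velFibre σ t)) 0 := by
    rw [Variation.momFibre, Variation.velFibre, ← ev, ← ep]
    exact hpv
  have hpq' : HasDerivAt (fun s => (C s).mom σ t ((C s).posRate τ₀ τc τ₁ σ t))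
      (δ.momFibre σ t ((C 0).posRate τ₀ τc τ₁ σ t) +
        (C 0).mom σ t (δ.posRateFibre τ₀ τc τ₁ σ t)) 0 := by
    rw [Variation.momFibre, ← hw2, ← ep]
    exact hpq
  have key := ((hT.mul hLd).add hpq').sub (hT.mul hpv')
  refine (key.congr_of_eventuallyEq ?_).congr_deriv ?_
  · filter_upwards [Ioo_mem_nhds h0.1 h0.2] with s hs
    exact actionDensity_eq ((hC.isPath s hs).time_pos t (hsub ht)).ne'
  · rw [actionDensityVariation]
    ring

theorem IsPathFamily.hasDerivAt_action (hL : ContMDiff (𝓡∂ n).tangent 𝓘(ℝ, ℝ) ∞ L)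
    (h₀ : τ₀ < τc) (h₁ : τc < τ₁) (hε : 0 < ε)
    (hC : IsPathFamily τ₀ τc τ₁ ε C) (hδ : IsVelocityAtZero τ₀ τc τ₁ C δ) :
    HasDerivAt (fun s : ℝ => action L τ₀ τc τ₁ (C s)) (actionVariation L τ₀ τc τ₁ δ) 0 := by
  have key : ∀ (σ : Side) (a b : ℝ), a < b → σ.dom τ₀ τc τ₁ = Icc a b → Icc a b ⊆ Icc τ₀ τ₁ →
      HasDerivAt (fun s : ℝ => ∫ t in a..b, actionDensity L τ₀ τc τ₁ (C s) σ t)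
        (∫ t in a..b, actionDensityVariation L τ₀ τc τ₁ δ σ t) 0 := by
    intro σ a b hab hD hsub
    convert! hasDerivAt_integral_of_contDiffOn hε hab
      (hC.actionDensity_contDiffOn hL (h₀.trans h₁) hab hD hsub) using 1
    refine intervalIntegral.integral_congr fun t ht => ?_
    rw [uIcc_of_le hab.le] at ht
    exact (hC.hasDerivAt_actionDensity hL hε (h₀.trans h₁) hδ hab hD hsub ht).deriv.symm
  exact (key .before τ₀ τc h₀ rfl (Icc_subset_Icc_right h₁.le)).add
    (key .after τc τ₁ h₁ rfl (Icc_subset_Icc_left h₀.le))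

end Family

section Coordinates

open Bundle

variable {n : ℕ} [NeZero n] {Q : Type*} [TopologicalSpace Q]
  [ChartedSpace (EuclideanHalfSpace n) Q] [IsManifold (𝓡∂ n) ∞ Q]

/-- The tangent vector of `TQ` at `(q, v)` with given coordinates in the preferred chart. -/
def ofCoords (q : Q) (v : TangentSpace (𝓡∂ n) q) (x : Coord n × Coord n) :
    TangentSpace (𝓡∂ n).tangent (⟨q, v⟩ : TangentBundle (𝓡∂ n) Q) := x

theorem tangentTriv_extendVector {q x : Q} (hx : x ∈ (chartAt (EuclideanHalfSpace n) q).source)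
    (w : TangentSpace (𝓡∂ n) q) : (tangentTriv q ⟨x, extendVector w x⟩).2 = w :=
  (congrArg Prod.snd ((tangentTriv q).apply_mk_symm hx _)).trans (trivializationAt_tangent_self q w)

theorem extendVector_eq_symmL {q x : Q} (hx : x ∈ (chartAt (EuclideanHalfSpace n) q).source)
    (w : TangentSpace (𝓡∂ n) q) : extendVector w x = (tangentTriv q).symmL ℝ x w := by
  rw [← tangentTriv_symmL_apply hx (extendVector w x), tangentTriv_extendVector hx]

theorem extendVector_self {q : Q} (w : TangentSpace (𝓡∂ n) q) : extendVector w q = w :=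
  FiberBundle.extend_apply_self (Coord n) w

theorem mdifferentiableAt_extendVector {q : Q} (w : TangentSpace (𝓡∂ n) q) :
    MDifferentiableAt (𝓡∂ n) (𝓡∂ n).tangent
      (fun x => (⟨x, extendVector w x⟩ : TangentBundle (𝓡∂ n) Q)) q :=
  FiberBundle.mdifferentiableAt_extend (𝓡∂ n) (Coord n) w

theorem verticalLift_eq (q : Q) (v w : TangentSpace (𝓡∂ n) q) :
    HasMFDerivAt 𝓘(ℝ, ℝ) (𝓡∂ n).tangent
      (fun s : ℝ => (⟨q, v + s • w⟩ : TangentBundle (𝓡∂ n) Q)) 0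
      (mfderiv 𝓘(ℝ, ℝ) (𝓡∂ n).tangent
        (fun s : ℝ => (⟨q, v + s • w⟩ : TangentBundle (𝓡∂ n) Q)) 0) ∧
    verticalLift q v w = ofCoords q v (0, w) := by
  have hT : ∀ s : ℝ, (tangentTriv q ⟨q, v + s • w⟩).2 = coords v + s • coords w := fun s =>
    trivializationAt_tangent_self q _
  have hd : HasDerivAt (fun s : ℝ => coords v + s • coords w) (coords w) 0 := by
    simpa using ((hasDerivAt_id (0 : ℝ)).smul_const (coords w)).const_add (coords v)
  have h1 : MDifferentiableAt 𝓘(ℝ, ℝ) (𝓡∂ n).tangent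
      (fun s : ℝ => (⟨q, v + s • w⟩ : TangentBundle (𝓡∂ n) Q)) 0 := by
    refine (mdifferentiableAt_totalSpace (IB := 𝓡∂ n) _).2 ⟨mdifferentiableAt_const, ?_⟩
    refine (mdifferentiableAt_iff_differentiableAt.2 hd.differentiableAt).congr_of_eventuallyEq ?_
    exact Filter.Eventually.of_forall hT
  refine ⟨h1.hasMFDerivAt, ?_⟩
  have h2 := h1.hasMFDerivAt.hasMFDerivWithinAt (s := univ)
  refine Prod.ext (α := Coord n) (β := Coord n) ?_ ?_
  · have h3 := h2.totalSpace_proj.mfderivWithin (uniqueMDiffWithinAt_univ 𝓘(ℝ, ℝ))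
    have h4 := (hasMFDerivWithinAt_const (I := 𝓘(ℝ, ℝ)) (I' := 𝓡∂ n) q univ (0 : ℝ)).mfderivWithin
      (uniqueMDiffWithinAt_univ 𝓘(ℝ, ℝ))
    exact DFunLike.congr_fun (h3.symm.trans h4) (1 : ℝ)
  · have h3 := h2.trivializationAt_snd.hasDerivWithinAt_apply_one.hasDerivAt Filter.univ_mem
    exact h3.unique (hd.congr_of_eventuallyEq (Filter.Eventually.of_forall hT))

theorem extensionDifferential_eq (q : Q) (v w : TangentSpace (𝓡∂ n) q) :
    extensionDifferential q v w = ofCoords q v (w, 0) := by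
  have h1 := (mdifferentiableAt_extendVector v).hasMFDerivAt.hasMFDerivWithinAt (s := univ)
  rw [extensionDifferential]
  have key : ∀ ξ : TangentSpace (𝓡∂ n).tangent
      (⟨q, extendVector v q⟩ : TangentBundle (𝓡∂ n) Q),
      ξ = mfderiv (𝓡∂ n) (𝓡∂ n).tangent
        (fun x : Q => (⟨x, extendVector v x⟩ : TangentBundle (𝓡∂ n) Q)) q w →
      Prod.fst (α := Coord n) (β := Coord n) ξ = w ∧
        Prod.snd (α := Coord n) (β := Coord n) ξ = 0 := by
    rintro ξ rfl
    constructor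
    · have h3 := h1.totalSpace_proj.mfderivWithin (uniqueMDiffWithinAt_univ (𝓡∂ n))
      have h4 := (hasMFDerivWithinAt_id (I := 𝓡∂ n) univ q).mfderivWithin
        (uniqueMDiffWithinAt_univ (𝓡∂ n))
      exact DFunLike.congr_fun (h3.symm.trans h4) w
    · have h3 := h1.trivializationAt_snd.mfderivWithin (uniqueMDiffWithinAt_univ (𝓡∂ n))
      have h5 : HasMFDerivWithinAt (𝓡∂ n) 𝓘(ℝ, Coord n)
          (fun x : Q => (tangentTriv q ⟨x, extendVector v x⟩).2) univ q 0 := by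
        refine (hasMFDerivWithinAt_const (I := 𝓡∂ n) (I' := 𝓘(ℝ, Coord n))
          (coords v) univ q).congr_of_eventuallyEq ?_ ?_
        · rw [nhdsWithin_univ]
          filter_upwards [(chartAt (EuclideanHalfSpace n) q).open_source.mem_nhds
            (mem_chart_source _ q)] with x hx
          exact tangentTriv_extendVector hx v
        · exact tangentTriv_extendVector (mem_chart_source _ q) v
      have h4 := h5.mfderivWithin (uniqueMDiffWithinAt_univ (𝓡∂ n))
      exact DFunLike.congr_fun (h3.symm.trans h4) w
  obtain ⟨k1, k2⟩ := key _ rfl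
  exact Prod.ext (α := Coord n) (β := Coord n) k1 k2

theorem lagrangianDifferential_add (L : TangentBundle (𝓡∂ n) Q → ℝ)
    (x : TangentBundle (𝓡∂ n) Q) (ξ η : TangentSpace (𝓡∂ n).tangent x) :
    lagrangianDifferential L x (ξ + η) =
      lagrangianDifferential L x ξ + lagrangianDifferential L x η :=
  (mfderiv (𝓡∂ n).tangent 𝓘(ℝ, ℝ) L x).map_add ξ η

theorem lagrangianDifferential_smul (L : TangentBundle (𝓡∂ n) Q → ℝ)
    (x : TangentBundle (𝓡∂ n) Q) (r : ℝ) (ξ : TangentSpace (𝓡∂ n).tangent x) :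
    lagrangianDifferential L x (r • ξ) = r * lagrangianDifferential L x ξ :=
  (mfderiv (𝓡∂ n).tangent 𝓘(ℝ, ℝ) L x).map_smul r ξ

/-- The differential of the Lagrangian at `v` in the direction with base component `w` and
vanishing fibre component in the preferred chart at the base point. -/
def baseDerivative (L : TangentBundle (𝓡∂ n) Q → ℝ) (q : Q) (v w : TangentSpace (𝓡∂ n) q) : ℝ :=
  lagrangianDifferential L ⟨q, v⟩ (ofCoords q v (w, 0))

variable {L : TangentBundle (𝓡∂ n) Q → ℝ}

theorem fibreDerivative_eq (hL : ContMDiff (𝓡∂ n).tangent 𝓘(ℝ, ℝ) ∞ L)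
    (q : Q) (v w : TangentSpace (𝓡∂ n) q) :
    fibreDerivative L q v w = lagrangianDifferential L ⟨q, v⟩ (ofCoords q v (0, w)) := by
  obtain ⟨h1, h2⟩ := verticalLift_eq q v w
  have h0 : (⟨q, v + (0 : ℝ) • w⟩ : TangentBundle (𝓡∂ n) Q) = ⟨q, v⟩ := by
    rw [zero_smul, add_zero]
  have hLd : HasMFDerivAt (𝓡∂ n).tangent 𝓘(ℝ, ℝ) L
      (⟨q, v + (0 : ℝ) • w⟩ : TangentBundle (𝓡∂ n) Q)
      (mfderiv (𝓡∂ n).tangent 𝓘(ℝ, ℝ) L (⟨q, v⟩ : TangentBundle (𝓡∂ n) Q)) := by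
    rw [h0]
    exact (hL.mdifferentiableAt (by simp)).hasMFDerivAt
  have h3 := (hLd.comp (0 : ℝ) h1).hasMFDerivWithinAt (s := univ)
  have h4 := (h3.hasDerivWithinAt_apply_one.hasDerivAt Filter.univ_mem).deriv
  rw [← h2]
  exact h4

theorem lagrangianDifferential_eq (hL : ContMDiff (𝓡∂ n).tangent 𝓘(ℝ, ℝ) ∞ L)
    (q : Q) (v w u : TangentSpace (𝓡∂ n) q) :
    lagrangianDifferential L ⟨q, v⟩ (ofCoords q v (w, u)) =
      baseDerivative L q v w + fibreDerivative L q v u := by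
  rw [fibreDerivative_eq hL, baseDerivative, ← lagrangianDifferential_add]
  congr 1
  exact Prod.ext (α := Coord n) (β := Coord n) (add_zero (coords w)).symm (zero_add (coords u)).symm

theorem horizontalDerivative_eq (hL : ContMDiff (𝓡∂ n).tangent 𝓘(ℝ, ℝ) ∞ L)
    (cov : LinearConnection n Q) (q : Q) (v w : TangentSpace (𝓡∂ n) q) :
    horizontalDerivative L cov q v w =
      baseDerivative L q v w - fibreDerivative L q v (cov (extendVector v) q w) := by
  rw [eq_sub_iff_add_eq, fibreDerivative_eq hL, horizontalDerivative, horizontalLift,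
    ← (verticalLift_eq q v _).2, extensionDifferential_eq, ← lagrangianDifferential_add,
    sub_add_cancel, baseDerivative]

theorem mlieBracket_extendVector (q : Q) (v w : TangentSpace (𝓡∂ n) q) :
    VectorField.mlieBracket (𝓡∂ n) (extendVector v) (extendVector w) q = 0 := by
  have key : ∀ u : TangentSpace (𝓡∂ n) q,
      ∀ y ∈ (extChartAt (𝓡∂ n) q).target,
      VectorField.mpullbackWithin 𝓘(ℝ, Coord n) (𝓡∂ n) (extChartAt (𝓡∂ n) q).symm
        (extendVector u) (range (𝓡∂ n)) y = coords u := by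
    intro u y hy
    have hs : (extChartAt (𝓡∂ n) q).symm y ∈ (chartAt (EuclideanHalfSpace n) q).source := by
      rw [← extChartAt_source (𝓡∂ n)]
      exact (extChartAt (𝓡∂ n) q).map_target hy
    have h1 := TangentBundle.symmL_trivializationAt (𝕜 := ℝ) (I := 𝓡∂ n) hs
    rw [(extChartAt (𝓡∂ n) q).right_inv hy] at h1
    rw [VectorField.mpullbackWithin_apply, extendVector_eq_symmL hs]
    have hinv := isInvertible_mfderivWithin_extChartAt_symm (I := 𝓡∂ n) hy
    have h2 := DFunLike.congr_fun h1 (coords u)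
    refine (congrArg _ h2).trans ?_
    exact hinv.inverse_apply_eq.2 rfl
  have hmem : (extChartAt (𝓡∂ n) q).symm ⁻¹' univ ∩ range (𝓡∂ n) = range (𝓡∂ n) := by
    rw [preimage_univ, univ_inter]
  rw [← VectorField.mlieBracketWithin_univ, VectorField.mlieBracketWithin_apply, hmem]
  have hev : ∀ u : TangentSpace (𝓡∂ n) q,
      VectorField.mpullbackWithin 𝓘(ℝ, Coord n) (𝓡∂ n) (extChartAt (𝓡∂ n) q).symm
        (extendVector u) (range (𝓡∂ n))
        =ᶠ[𝓝[range (𝓡∂ n)] (extChartAt (𝓡∂ n) q q)] fun _ => coords u := fun u => by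
    filter_upwards [extChartAt_target_mem_nhdsWithin (I := 𝓡∂ n) q] with y hy
    exact key u y hy
  have hd : ∀ u : TangentSpace (𝓡∂ n) q,
      fderivWithin ℝ (VectorField.mpullbackWithin 𝓘(ℝ, Coord n) (𝓡∂ n)
        (extChartAt (𝓡∂ n) q).symm (extendVector u) (range (𝓡∂ n)) : Coord n → Coord n)
        (range (𝓡∂ n)) (extChartAt (𝓡∂ n) q q) = 0 := fun u => by
    have := Filter.EventuallyEq.fderivWithin_eq (𝕜 := ℝ) (hev u)
      (key u _ (mem_extChartAt_target q))
    refine this.trans ?_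
    exact fderivWithin_const_apply (coords u)
  have hz : VectorField.lieBracketWithin ℝ
      (VectorField.mpullbackWithin 𝓘(ℝ, Coord n) (𝓡∂ n) (extChartAt (𝓡∂ n) q).symm
        (extendVector v) (range (𝓡∂ n)) : Coord n → Coord n)
      (VectorField.mpullbackWithin 𝓘(ℝ, Coord n) (𝓡∂ n) (extChartAt (𝓡∂ n) q).symm
        (extendVector w) (range (𝓡∂ n))) (range (𝓡∂ n)) (extChartAt (𝓡∂ n) q q) = 0 := by
    change fderivWithin ℝ _ _ _ _ - fderivWithin ℝ _ _ _ _ = 0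
    rw [hd, hd]
    exact sub_zero (0 : Coord n)
  exact (congrArg _ hz).trans (map_zero _)

theorem cov_extendVector_comm {cov : LinearConnection n Q} (h : cov.torsion = 0) (q : Q)
    (v w : TangentSpace (𝓡∂ n) q) : cov (extendVector v) q w = cov (extendVector w) q v := by
  have h1 := CovariantDerivative.torsion_apply_eq_extend cov w v
  have h2 := mlieBracket_extendVector q w v
  have h3 : cov.torsion q w v = 0 := by rw [h]; rfl
  rw [h3] at h1
  have h4 : (0 : TangentSpace (𝓡∂ n) q) =
      cov (extendVector v) q (extendVector w q) - cov (extendVector w) q (extendVector v q) -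
        VectorField.mlieBracket (𝓡∂ n) (extendVector w) (extendVector v) q := h1
  rw [h2, extendVector_self, extendVector_self, sub_zero] at h4
  exact (sub_eq_zero.1 h4.symm)

end Coordinates

section Residual

open Bundle

variable {n : ℕ} [NeZero n] {Q : Type*} [TopologicalSpace Q]
  [ChartedSpace (EuclideanHalfSpace n) Q] [IsManifold (𝓡∂ n) ∞ Q]

/-- The derivative of the momentum path, in the coordinates of the preferred chart. -/
def CollisionPath.momRate (c : CollisionPath n Q) (τ₀ τc τ₁ : ℝ) (σ : Side) (τ : ℝ) :
    TangentSpace (𝓡∂ n) (c.pos τ) →L[ℝ] ℝ :=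
  Prod.snd (α := Coord n) (β := Coord n →L[ℝ] ℝ)
    (mfderivWithin 𝓘(ℝ, ℝ) (cotangentModel n) (c.momCurve σ) (σ.dom τ₀ τc τ₁) τ (1 : ℝ))

/-- The Euler–Lagrange expression in the coordinates of the preferred chart. -/
def eulerLagrange (L : TangentBundle (𝓡∂ n) Q → ℝ) (τ₀ τc τ₁ : ℝ) (c : CollisionPath n Q)
    (σ : Side) (τ : ℝ) (w : TangentSpace (𝓡∂ n) (c.pos τ)) : ℝ :=
  c.momRate τ₀ τc τ₁ σ τ w - c.timeRate τ₀ τ₁ τ * baseDerivative L (c.pos τ) (c.vel σ τ) w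

variable {L : TangentBundle (𝓡∂ n) Q → ℝ} {τ₀ τc τ₁ : ℝ} {c : CollisionPath n Q}

theorem IsPath.hasMFDerivWithinAt_mom (hc : IsPath τ₀ τc τ₁ c) (σ : Side) {τ : ℝ}
    (hτ : τ ∈ σ.dom τ₀ τc τ₁) :
    HasMFDerivWithinAt 𝓘(ℝ, ℝ) (cotangentModel n) (c.momCurve σ) (σ.dom τ₀ τc τ₁) τ
      (mfderivWithin 𝓘(ℝ, ℝ) (cotangentModel n) (c.momCurve σ) (σ.dom τ₀ τc τ₁) τ) :=
  ((hc.mom_smooth σ τ hτ).mdifferentiableWithinAt two_ne_zero).hasMFDerivWithinAt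

theorem Side.uniqueDiffOn_dom (h₀ : τ₀ < τc) (h₁ : τc < τ₁) (σ : Side) :
    UniqueDiffOn ℝ (σ.dom τ₀ τc τ₁) := by
  obtain ⟨a, b, hab, hD, -⟩ := σ.exists_dom_eq_Icc h₀ h₁
  rw [hD]
  exact uniqueDiffOn_Icc hab

theorem momentumCovDerivative_eq (h₀ : τ₀ < τc) (h₁ : τc < τ₁) (cov : LinearConnection n Q)
    (hc : IsPath τ₀ τc τ₁ c) (σ : Side) {τ : ℝ} (hτ : τ ∈ σ.dom τ₀ τc τ₁)
    (w : TangentSpace (𝓡∂ n) (c.pos τ)) :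
    momentumCovDerivative cov τ₀ τc τ₁ c σ τ w = c.momRate τ₀ τc τ₁ σ τ w -
      c.mom σ τ (cov (extendVector w) (c.pos τ) (c.posRate τ₀ τc τ₁ σ τ)) := by
  have hu := σ.uniqueDiffOn_dom h₀ h₁ τ hτ
  have hq : HasMFDerivWithinAt 𝓘(ℝ, ℝ) (𝓡∂ n) c.pos (σ.dom τ₀ τc τ₁) τ
      (mfderivWithin 𝓘(ℝ, ℝ) (𝓡∂ n) c.pos (σ.dom τ₀ τc τ₁) τ) :=
    ((hc.pos_smooth σ τ hτ).mdifferentiableWithinAt two_ne_zero).hasMFDerivWithinAt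
  have hW := (mdifferentiableAt_extendVector w).hasMFDerivAt.comp_hasMFDerivWithinAt τ hq
  have h := hasDerivWithinAt_pairing (hc.hasMFDerivWithinAt_mom σ hτ) hW
  have hz := hW.trivializationAt_snd.hasDerivWithinAt_apply_one
  have hconst : HasDerivWithinAt (fun t => (tangentTriv (c.pos τ)
      ⟨c.pos t, extendVector w (c.pos t)⟩).2) 0 (σ.dom τ₀ τc τ₁) τ := by
    refine (hasDerivWithinAt_const τ (σ.dom τ₀ τc τ₁) (coords w)).congr_of_eventuallyEq_of_mem
      ?_ hτ
    filter_upwards [hq.continuousWithinAt ((chartAt (EuclideanHalfSpace n)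
      (c.pos τ)).open_source.mem_nhds (mem_chart_source _ _))] with t ht
    exact tangentTriv_extendVector ht w
  have hsnd := hu.eq_deriv _ hz hconst
  rw [momentumCovDerivative]
  congr 1
  refine (h.derivWithin hu).trans ?_
  refine (congrArg₂ (· + ·) (congrArg _ (extendVector_self w))
    ((congrArg (c.mom σ τ) hsnd).trans (map_zero (c.mom σ τ)))).trans ?_
  exact add_zero (c.momRate τ₀ τc τ₁ σ τ w)

theorem momentumCovDerivative_sub_eq (h₀ : τ₀ < τc) (h₁ : τc < τ₁)
    (hL : ContMDiff (𝓡∂ n).tangent 𝓘(ℝ, ℝ) ∞ L) {cov : LinearConnection n Q}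
    (htorsion : cov.torsion = 0) (hc : IsPath τ₀ τc τ₁ c) (σ : Side) {τ : ℝ}
    (hτ : τ ∈ σ.dom τ₀ τc τ₁)
    (hleg : ∀ w, c.mom σ τ w = fibreDerivative L (c.pos τ) (c.vel σ τ) w)
    (hvel : c.posRate τ₀ τc τ₁ σ τ = c.timeRate τ₀ τ₁ τ • c.vel σ τ)
    (w : TangentSpace (𝓡∂ n) (c.pos τ)) :
    momentumCovDerivative cov τ₀ τc τ₁ c σ τ w
      - c.timeRate τ₀ τ₁ τ * horizontalDerivative L cov (c.pos τ) (c.vel σ τ) w =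
    eulerLagrange L τ₀ τc τ₁ c σ τ w := by
  rw [momentumCovDerivative_eq h₀ h₁ cov hc σ hτ, horizontalDerivative_eq hL, eulerLagrange,
    ← hleg, hvel, map_smul, map_smul, cov_extendVector_comm htorsion (c.pos τ) (c.vel σ τ) w,
    smul_eq_mul]
  ring

variable {δ : Variation c}

theorem Variation.velProj_eq (δ : Variation c) (σ : Side) (τ : ℝ) :
    δ.velProj σ τ = Prod.fst (α := Coord n) (β := Coord n) (δ.vel σ τ) :=
  DFunLike.congr_fun (hasMFDerivAt_totalSpace_proj (IB := 𝓡∂ n) (c.velCurve σ τ)).mfderiv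
    (δ.vel σ τ)

theorem Variation.momProj_eq (δ : Variation c) (σ : Side) (τ : ℝ) :
    δ.momProj σ τ = Prod.fst (α := Coord n) (β := Coord n →L[ℝ] ℝ) (δ.mom σ τ) :=
  DFunLike.congr_fun (hasMFDerivAt_totalSpace_proj (IB := 𝓡∂ n) (c.momCurve σ τ)).mfderiv
    (δ.mom σ τ)

theorem hasDerivWithinAt_mom_pos (hc : IsPath τ₀ τc τ₁ c) (σ : Side) {τ : ℝ}
    (hτ : τ ∈ σ.dom τ₀ τc τ₁)
    (hδ : MDifferentiableWithinAt 𝓘(ℝ, ℝ) (𝓡∂ n).tangent δ.posCurve (σ.dom τ₀ τc τ₁) τ) :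
    HasDerivWithinAt (fun t => c.mom σ t (δ.pos t))
      (c.momRate τ₀ τc τ₁ σ τ (δ.pos τ) + c.mom σ τ (δ.posRateFibre τ₀ τc τ₁ σ τ))
      (σ.dom τ₀ τc τ₁) τ :=
  hasDerivWithinAt_pairing (hc.hasMFDerivWithinAt_mom σ hτ) hδ.hasMFDerivWithinAt

theorem actionDensityVariation_eq (hL : ContMDiff (𝓡∂ n).tangent 𝓘(ℝ, ℝ) ∞ L)
    {σ : Side} {τ : ℝ} (hproj : δ.velProj σ τ = δ.pos τ)
    (hleg : ∀ w, c.mom σ τ w = fibreDerivative L (c.pos τ) (c.vel σ τ) w)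
    (hvel : c.posRate τ₀ τc τ₁ σ τ = c.timeRate τ₀ τ₁ τ • c.vel σ τ) :
    actionDensityVariation L τ₀ τc τ₁ δ σ τ =
      (c.momRate τ₀ τc τ₁ σ τ (δ.pos τ) + c.mom σ τ (δ.posRateFibre τ₀ τc τ₁ σ τ))
        - δ.timeRate τ₀ τ₁ τ * c.energyAt L σ τ - eulerLagrange L τ₀ τc τ₁ c σ τ (δ.pos τ) := by
  have h1 : lagrangianDifferential L (c.velCurve σ τ) (δ.vel σ τ) =
      baseDerivative L (c.pos τ) (c.vel σ τ) (δ.pos τ) + c.mom σ τ (δ.velFibre σ τ) := by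
    rw [hleg, ← lagrangianDifferential_eq hL, ← hproj, Variation.velProj_eq]
    rfl
  rw [actionDensityVariation, h1, hvel, map_smul, smul_eq_mul, eulerLagrange,
    CollisionPath.energyAt, energy, CollisionPath.velCurve]
  ring

theorem IsPath.mom_pos_contDiffOn (hc : IsPath τ₀ τc τ₁ c) (σ : Side)
    (hδ : ContMDiffOn 𝓘(ℝ, ℝ) (𝓡∂ n).tangent 2 δ.posCurve (σ.dom τ₀ τc τ₁)) :
    ContDiffOn ℝ 2 (fun t => c.mom σ t (δ.pos t)) (σ.dom τ₀ τc τ₁) := fun t ht =>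
  contMDiffWithinAt_pairing (by norm_cast) (hc.mom_smooth σ t ht) (hδ t ht)

theorem IsPath.energyAt_contDiffOn (hL : ContMDiff (𝓡∂ n).tangent 𝓘(ℝ, ℝ) ∞ L)
    (hc : IsPath τ₀ τc τ₁ c) (σ : Side) :
    ContDiffOn ℝ 2 (c.energyAt L σ) (σ.dom τ₀ τc τ₁) := by
  have h1 : ContDiffOn ℝ 2 (fun t => c.mom σ t (c.vel σ t)) (σ.dom τ₀ τc τ₁) := fun t ht =>
    contMDiffWithinAt_pairing (by norm_cast) (hc.mom_smooth σ t ht) (hc.vel_smooth σ t ht)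
  have h2 : ContDiffOn ℝ 2 (fun t => L (c.velCurve σ t)) (σ.dom τ₀ τc τ₁) := by
    rw [← contMDiffOn_iff_contDiffOn]
    exact (hL.of_le (by norm_cast)).comp_contMDiffOn (hc.vel_smooth σ)
  exact h1.sub h2

/-- On a piece where the equations of motion hold, the variation of the action is a boundary
term. -/
theorem integral_actionDensityVariation (hL : ContMDiff (𝓡∂ n).tangent 𝓘(ℝ, ℝ) ∞ L)
    {Δ : (q : Q) → Submodule ℝ (TangentSpace (𝓡∂ n) q)} (hc : IsPath τ₀ τc τ₁ c)
    (hδ : IsAdmissible Δ τ₀ τc τ₁ δ) {σ : Side} {a b : ℝ} (hab : a < b)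
    (hD : σ.dom τ₀ τc τ₁ = Icc a b) (hsub : Icc a b ⊆ Icc τ₀ τ₁)
    (hleg : ∀ τ ∈ Ioo a b, ∀ w, c.mom σ τ w = fibreDerivative L (c.pos τ) (c.vel σ τ) w)
    (hvel : ∀ τ ∈ Ioo a b, c.posRate τ₀ τc τ₁ σ τ = c.timeRate τ₀ τ₁ τ • c.vel σ τ)
    (hEL : ∀ τ ∈ Ioo a b, ∀ w ∈ Δ (c.pos τ), eulerLagrange L τ₀ τc τ₁ c σ τ w = 0)
    {e : ℝ} (he : ∀ τ ∈ Ioo a b, c.energyAt L σ τ = e) :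
    ∫ τ in a..b, actionDensityVariation L τ₀ τc τ₁ δ σ τ =
      (c.mom σ b (δ.pos b) - e * δ.time b) - (c.mom σ a (δ.pos a) - e * δ.time a) := by
  have h01 : τ₀ < τ₁ := (hsub (left_mem_Icc.2 hab.le)).1.trans_lt
    (hab.trans_le (hsub (right_mem_Icc.2 hab.le)).2)
  have hf : ContDiffOn ℝ 1 (fun t => c.mom σ t (δ.pos t) - e * δ.time t) (Icc a b) := by
    have h1 := (hc.mom_pos_contDiffOn σ (hδ.pos_smooth σ)).of_le one_le_two
    rw [hD] at h1
    exact h1.sub (contDiffOn_const.mul ((hδ.time_smooth.of_le (by norm_cast)).mono hsub))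
  rw [← intervalIntegral.integral_derivWithin_Icc_of_contDiffOn_Icc hf hab.le]
  refine intervalIntegral.integral_congr_uIoo ?_
  intro τ hτ
  rw [uIoo_of_le hab.le] at hτ
  have hτ' := Ioo_subset_Icc_self hτ
  have hτD : τ ∈ σ.dom τ₀ τc τ₁ := by rwa [hD]
  have hu := uniqueDiffOn_Icc hab τ hτ'
  have h1 := hasDerivWithinAt_mom_pos hc σ hτD
    ((hδ.pos_smooth σ τ hτD).mdifferentiableWithinAt two_ne_zero)
  rw [hD] at h1
  have h2 : HasDerivWithinAt δ.time (δ.timeRate τ₀ τ₁ τ) (Icc a b) τ :=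
    ((hδ.time_smooth.differentiableOn (by simp)) τ (hsub hτ')).hasDerivWithinAt.mono hsub
  have hmem : δ.pos τ ∈ Δ (c.pos τ) := by
    rw [← hδ.vel_proj σ τ hτD]
    exact hδ.vel_constraint σ τ hτD
  have h3 : HasDerivWithinAt (fun t => c.mom σ t (δ.pos t) - e * δ.time t) _ (Icc a b) τ :=
    h1.sub (h2.const_mul e)
  rw [actionDensityVariation_eq hL (hδ.vel_proj σ τ hτD) (hleg τ hτ) (hvel τ hτ),
    hEL τ hτ _ hmem, he τ hτ, h3.derivWithin hu]
  ring

theorem IsPath.energyAt_eq (hL : ContMDiff (𝓡∂ n).tangent 𝓘(ℝ, ℝ) ∞ L)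
    (hc : IsPath τ₀ τc τ₁ c) {σ : Side} {a b : ℝ} (hD : σ.dom τ₀ τc τ₁ = Icc a b)
    (h : ∀ τ ∈ Ioo a b, HasDerivWithinAt (c.energyAt L σ) 0 (Icc a b) τ) {s t : ℝ}
    (hs : s ∈ Icc a b) (ht : t ∈ Icc a b) : c.energyAt L σ s = c.energyAt L σ t := by
  have hcont : ContinuousOn (c.energyAt L σ) (Icc a b) := by
    have := (hc.energyAt_contDiffOn hL σ).continuousOn
    rwa [hD] at this
  have hd : ∀ τ ∈ interior (Icc a b), HasDerivAt (c.energyAt L σ) 0 τ := by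
    intro τ hτ
    rw [interior_Icc] at hτ
    exact (h τ hτ).hasDerivAt (Icc_mem_nhds hτ.1 hτ.2)
  have hdiff : DifferentiableOn ℝ (c.energyAt L σ) (interior (Icc a b)) := fun τ hτ =>
    (hd τ hτ).differentiableAt.differentiableWithinAt
  have hmono := monotoneOn_of_deriv_nonneg (convex_Icc a b) hcont hdiff
    (fun τ hτ => (hd τ hτ).deriv.ge)
  have hanti := antitoneOn_of_deriv_nonpos (convex_Icc a b) hcont hdiff
    (fun τ hτ => (hd τ hτ).deriv.le)
  rcases le_total s t with hst | hst
  · exact le_antisymm (hmono hs ht hst) (hanti hs ht hst)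
  · exact le_antisymm (hanti ht hs hst) (hmono ht hs hst)

/-- The parameter interval of a piece without its end points. -/
def Side.inner (τ₀ τc τ₁ : ℝ) : Side → Set ℝ
  | .before => Ioo τ₀ τc
  | .after => Ioo τc τ₁

theorem actionVariation_eq (h₀ : τ₀ < τc) (h₁ : τc < τ₁)
    (hL : ContMDiff (𝓡∂ n).tangent 𝓘(ℝ, ℝ) ∞ L)
    {Δ : (q : Q) → Submodule ℝ (TangentSpace (𝓡∂ n) q)} (hc : IsPath τ₀ τc τ₁ c)
    (hδ : IsAdmissible Δ τ₀ τc τ₁ δ)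
    (hleg : ∀ σ : Side, ∀ τ ∈ σ.inner τ₀ τc τ₁, ∀ w,
      c.mom σ τ w = fibreDerivative L (c.pos τ) (c.vel σ τ) w)
    (hvel : ∀ σ : Side, ∀ τ ∈ σ.inner τ₀ τc τ₁,
      c.posRate τ₀ τc τ₁ σ τ = c.timeRate τ₀ τ₁ τ • c.vel σ τ)
    (hEL : ∀ σ : Side, ∀ τ ∈ σ.inner τ₀ τc τ₁, ∀ w ∈ Δ (c.pos τ),
      eulerLagrange L τ₀ τc τ₁ c σ τ w = 0)
    (hE : ∀ σ : Side, ∀ τ ∈ σ.inner τ₀ τc τ₁,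
      HasDerivWithinAt (c.energyAt L σ) 0 (σ.dom τ₀ τc τ₁) τ) :
    actionVariation L τ₀ τc τ₁ δ =
      (c.energyAt L .after τc - c.energyAt L .before τc) * δ.time τc -
        (c.mom .after τc - c.mom .before τc) (δ.pos τc) := by
  rw [actionVariation,
    integral_actionDensityVariation hL hc hδ (σ := .before) h₀ rfl (Icc_subset_Icc_right h₁.le)
      (hleg .before) (hvel .before) (hEL .before) (e := c.energyAt L .before τc)
      (fun τ hτ => hc.energyAt_eq hL rfl (hE .before) (Ioo_subset_Icc_self hτ)
        (right_mem_Icc.2 h₀.le)),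
    integral_actionDensityVariation hL hc hδ (σ := .after) h₁ rfl (Icc_subset_Icc_left h₀.le)
      (hleg .after) (hvel .after) (hEL .after) (e := c.energyAt L .after τc)
      (fun τ hτ => hc.energyAt_eq hL rfl (hE .after) (Ioo_subset_Icc_self hτ)
        (left_mem_Icc.2 h₁.le)),
    hδ.pos_start, hδ.pos_end, hδ.time_start, hδ.time_end, map_zero, map_zero]
  change _ = _ - (c.mom .after τc (δ.pos τc) - c.mom .before τc (δ.pos τc))
  ring

theorem Side.inner_subset_away (σ : Side) : σ.inner τ₀ τc τ₁ ⊆ σ.away τ₀ τc τ₁ := by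
  cases σ
  · exact Ioo_subset_Ico_self
  · exact Ioo_subset_Ioc_self

theorem Side.away_subset_dom (σ : Side) : σ.away τ₀ τc τ₁ ⊆ σ.dom τ₀ τc τ₁ := by
  cases σ
  · exact Ico_subset_Icc_self
  · exact Ioc_subset_Icc_self

theorem Side.dom_subset (h₀ : τ₀ < τc) (h₁ : τc < τ₁) (σ : Side) :
    σ.dom τ₀ τc τ₁ ⊆ Icc τ₀ τ₁ := by
  obtain ⟨a, b, -, hD, hsub⟩ := σ.exists_dom_eq_Icc h₀ h₁
  rwa [hD]

theorem IsCritical.of_implicitEulerLagrange (h₀ : τ₀ < τc) (h₁ : τc < τ₁)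
    (hL : ContMDiff (𝓡∂ n).tangent 𝓘(ℝ, ℝ) ∞ L)
    {Δ : (q : Q) → Submodule ℝ (TangentSpace (𝓡∂ n) q)} {cov : LinearConnection n Q}
    (htorsion : cov.torsion = 0) (hc : IsPath τ₀ τc τ₁ c)
    (hEL : ImplicitEulerLagrange L cov Δ τ₀ τc τ₁ c) (hI : ElasticImpact L Δ τc c) :
    IsCritical L Δ τ₀ τc τ₁ c := by
  intro δ hδ
  have hvel : ∀ σ : Side, ∀ τ ∈ σ.inner τ₀ τc τ₁,
      c.posRate τ₀ τc τ₁ σ τ = c.timeRate τ₀ τ₁ τ • c.vel σ τ := by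
    intro σ τ hτ
    have hτ' := σ.inner_subset_away hτ
    have hpos := hc.time_pos τ (σ.dom_subset h₀ h₁ (σ.away_subset_dom hτ'))
    rw [(hEL.velocity σ τ hτ').1, smul_smul, mul_inv_cancel₀ hpos.ne', one_smul]
  rw [actionVariation_eq h₀ h₁ hL hc hδ
    (fun σ τ hτ => hEL.legendre σ τ (σ.inner_subset_away hτ)) hvel ?_
    (fun σ τ hτ => hEL.energy σ τ (σ.inner_subset_away hτ)), hI.energy, sub_self, zero_mul,
    hI.momentum (δ.pos τc) ?_, sub_self]
  · refine ⟨hδ.pos_collision, ?_⟩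
    have hmem : τc ∈ Side.before.dom τ₀ τc τ₁ := right_mem_Icc.2 h₀.le
    rw [← hδ.vel_proj .before τc hmem]
    exact hδ.vel_constraint .before τc hmem
  · intro σ τ hτ w hw
    have hτ' := σ.inner_subset_away hτ
    rw [← momentumCovDerivative_sub_eq h₀ h₁ hL htorsion hc σ (σ.away_subset_dom hτ')
      (hEL.legendre σ τ hτ') (hvel σ τ hτ)]
    exact hEL.momentum σ τ hτ' w hw

end Residual

section SecondTangent

open Bundle

variable {EB : Type*} [NormedAddCommGroup EB] [NormedSpace ℝ EB] {HB : Type*} [TopologicalSpace HB]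
  {IB : ModelWithCorners ℝ EB HB} {B : Type*} [TopologicalSpace B] [ChartedSpace HB B]
  {F : Type*} [NormedAddCommGroup F] [NormedSpace ℝ F] {V : B → Type*}
  [TopologicalSpace (TotalSpace F V)] [∀ b, TopologicalSpace (V b)] [FiberBundle F V]
  [∀ b, AddCommGroup (V b)] [∀ b, Module ℝ (V b)] [VectorBundle ℝ F V]
  [ContMDiffVectorBundle ∞ F V IB]

theorem mdifferentiableAt_trivializationAt_snd {q : B} (x : TotalSpace F V)
    (hx : x.proj ∈ (trivializationAt F V q).baseSet) :
    MDifferentiableAt (IB.prod 𝓘(ℝ, F)) 𝓘(ℝ, F)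
      (fun y : TotalSpace F V => (trivializationAt F V q y).2) x := by
  have h := (trivializationAt F V q).contMDiffOn (n := ∞) (IB := IB)
  have h1 : ContMDiffAt (IB.prod 𝓘(ℝ, F)) (IB.prod 𝓘(ℝ, F)) ∞ (trivializationAt F V q) x :=
    h.contMDiffAt ((trivializationAt F V q).open_source.mem_nhds
      ((trivializationAt F V q).mem_source.2 hx))
  exact (contMDiffAt_snd.comp x h1).mdifferentiableAt (by simp)

theorem trivializationAt_tangent_totalSpace [IsManifold IB ∞ B]
    [IsManifold (IB.prod 𝓘(ℝ, F)) ∞ (TotalSpace F V)]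
    (X₀ x : TotalSpace F V)
    (hx : x.proj ∈ (trivializationAt F V X₀.proj).baseSet)
    (hx' : x.proj ∈ (chartAt HB X₀.proj).source) (ξ : TangentSpace (IB.prod 𝓘(ℝ, F)) x) :
    (trivializationAt (EB × F) (TangentSpace (IB.prod 𝓘(ℝ, F))) X₀ ⟨x, ξ⟩).2 =
      ((trivializationAt EB (TangentSpace IB) X₀.proj
          ⟨x.proj, Prod.fst (α := EB) (β := F) ξ⟩).2,
        mfderiv (IB.prod 𝓘(ℝ, F)) 𝓘(ℝ, F)
          (fun y : TotalSpace F V => (trivializationAt F V X₀.proj y).2) x ξ) := by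
  have hs : x ∈ (extChartAt (IB.prod 𝓘(ℝ, F)) X₀).source :=
    (mem_extChartAt_totalSpace_source _ _).2 ⟨hx, by rwa [extChartAt_source]⟩
  have hs' : x ∈ (chartAt (ModelProd HB F) X₀).source := by rwa [← extChartAt_source (IB.prod 𝓘(ℝ, F))]
  have h1 : (trivializationAt (EB × F) (TangentSpace (IB.prod 𝓘(ℝ, F))) X₀ ⟨x, ξ⟩).2 =
      mfderiv (IB.prod 𝓘(ℝ, F)) 𝓘(ℝ, EB × F) (extChartAt (IB.prod 𝓘(ℝ, F)) X₀) x ξ := by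
    rw [← TangentBundle.continuousLinearMapAt_trivializationAt hs']
    exact (Trivialization.continuousLinearMapAt_apply_of_mem ℝ
      (trivializationAt (EB × F) (TangentSpace (IB.prod 𝓘(ℝ, F))) X₀) (b := x) hs' ξ).symm
  have h2 : (trivializationAt EB (TangentSpace IB) X₀.proj
          ⟨x.proj, Prod.fst (α := EB) (β := F) ξ⟩).2 =
      mfderiv IB 𝓘(ℝ, EB) (extChartAt IB X₀.proj) x.proj (Prod.fst (α := EB) (β := F) ξ) := by
    rw [← TangentBundle.continuousLinearMapAt_trivializationAt hx']
    exact (Trivialization.continuousLinearMapAt_apply_of_mem ℝ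
      (trivializationAt EB (TangentSpace IB) X₀.proj) (b := x.proj) hx' _).symm
  have hc : MDifferentiableAt IB 𝓘(ℝ, EB) (extChartAt IB X₀.proj) x.proj :=
    mdifferentiableAt_extChartAt hx'
  have h3 := hc.hasMFDerivAt.comp x (hasMFDerivAt_totalSpace_proj (IB := IB) x)
  have h4 := (mdifferentiableAt_trivializationAt_snd (IB := IB) x hx).hasMFDerivAt
  have h6 : HasMFDerivAt (IB.prod 𝓘(ℝ, F)) 𝓘(ℝ, EB × F) (extChartAt (IB.prod 𝓘(ℝ, F)) X₀) x
      (mfderiv (IB.prod 𝓘(ℝ, F)) 𝓘(ℝ, EB × F) (extChartAt (IB.prod 𝓘(ℝ, F)) X₀) x) :=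
    (mdifferentiableAt_extChartAt hs').hasMFDerivAt
  have hev : ∀ᶠ y in 𝓝 x, extChartAt (IB.prod 𝓘(ℝ, F)) X₀ y =
      (extChartAt IB X₀.proj y.proj, (trivializationAt F V X₀.proj y).2) := by
    filter_upwards [(isOpen_extChartAt_source (I := IB.prod 𝓘(ℝ, F)) X₀).mem_nhds hs] with y hy
    exact extChartAt_totalSpace_apply X₀ y ((mem_extChartAt_totalSpace_source _ _).1 hy).1
  have h7 := ((ContinuousLinearMap.fst ℝ EB F).hasMFDerivAt
    (x := extChartAt (IB.prod 𝓘(ℝ, F)) X₀ x)).comp x h6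
  have h8 := ((ContinuousLinearMap.snd ℝ EB F).hasMFDerivAt
    (x := extChartAt (IB.prod 𝓘(ℝ, F)) X₀ x)).comp x h6
  rw [h1, h2]
  refine Prod.ext ?_ ?_
  · exact DFunLike.congr_fun (hasMFDerivAt_unique h7 (h3.congr_of_eventuallyEq
      (hev.mono fun y hy => congrArg Prod.fst hy))) ξ
  · exact DFunLike.congr_fun (hasMFDerivAt_unique h8 (h4.congr_of_eventuallyEq
      (hev.mono fun y hy => congrArg Prod.snd hy))) ξ

theorem mfderiv_trivializationAt_snd_vertical {q : B} (x : TotalSpace F V)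
    (hx : x.proj ∈ (trivializationAt F V q).baseSet) (ξ : TangentSpace (IB.prod 𝓘(ℝ, F)) x)
    (hξ : Prod.fst (α := EB) (β := F) ξ = 0) :
    mfderiv (IB.prod 𝓘(ℝ, F)) 𝓘(ℝ, F)
        (fun y : TotalSpace F V => (trivializationAt F V q y).2) x ξ =
      (trivializationAt F V q ⟨x.proj, (trivializationAt F V x.proj).symmL ℝ x.proj
        (Prod.snd (α := EB) (β := F) ξ)⟩).2 := by
  set u : V x.proj := (trivializationAt F V x.proj).symmL ℝ x.proj
    (Prod.snd (α := EB) (β := F) ξ) with hu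
  have hself : x.proj ∈ (trivializationAt F V x.proj).baseSet :=
    FiberBundle.mem_baseSet_trivializationAt' _
  have hlin : ∀ p : B, x.proj ∈ (trivializationAt F V p).baseSet → ∀ s : ℝ,
      (trivializationAt F V p ⟨x.proj, x.2 + s • u⟩).2 =
        (trivializationAt F V p x).2 + s • (trivializationAt F V p ⟨x.proj, u⟩).2 := by
    intro p hp s
    have h := (trivializationAt F V p).linear ℝ hp
    rw [h.map_add, h.map_smul]
  have hd : ∀ p : B, HasDerivAt (fun s : ℝ => (trivializationAt F V p x).2 +
      s • (trivializationAt F V p ⟨x.proj, u⟩).2) (trivializationAt F V p ⟨x.proj, u⟩).2 0 := by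
    intro p
    simpa using ((hasDerivAt_id (0 : ℝ)).smul_const
      (trivializationAt F V p ⟨x.proj, u⟩).2).const_add (trivializationAt F V p x).2
  set γ : ℝ → TotalSpace F V := fun s => ⟨x.proj, x.2 + s • u⟩ with hγ
  have h0 : γ 0 = x := by
    rw [hγ]
    simp only [zero_smul, add_zero]
  have h1 : MDifferentiableAt 𝓘(ℝ, ℝ) (IB.prod 𝓘(ℝ, F)) γ 0 := by
    refine (mdifferentiableAt_totalSpace (IB := IB) _).2 ⟨mdifferentiableAt_const, ?_⟩
    refine (mdifferentiableAt_iff_differentiableAt.2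
      (hd x.proj).differentiableAt).congr_of_eventuallyEq ?_
    exact Filter.Eventually.of_forall (hlin x.proj hself)
  have h2 := h1.hasMFDerivAt.hasMFDerivWithinAt (s := univ)
  have hval : mfderiv 𝓘(ℝ, ℝ) (IB.prod 𝓘(ℝ, F)) γ 0 (1 : ℝ) = ξ := by
    refine Prod.ext (α := EB) (β := F) ?_ ?_
    · have h3 := h2.totalSpace_proj.mfderivWithin (uniqueMDiffWithinAt_univ 𝓘(ℝ, ℝ))
      have h4 := (hasMFDerivWithinAt_const (I := 𝓘(ℝ, ℝ)) (I' := IB) x.proj univ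
        (0 : ℝ)).mfderivWithin (uniqueMDiffWithinAt_univ 𝓘(ℝ, ℝ))
      exact (DFunLike.congr_fun (h3.symm.trans h4) (1 : ℝ)).trans hξ.symm
    · have h3 := h2.trivializationAt_snd.hasDerivWithinAt_apply_one.hasDerivAt Filter.univ_mem
      refine (h3.unique ((hd x.proj).congr_of_eventuallyEq
        (Filter.Eventually.of_forall (hlin x.proj hself)))).trans ?_
      rw [hu, (trivializationAt F V x.proj).symmL_apply hself]
      exact congrArg Prod.snd ((trivializationAt F V x.proj).apply_mk_symm hself _)
  have h5 : HasMFDerivAt (IB.prod 𝓘(ℝ, F)) 𝓘(ℝ, F)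
      (fun y : TotalSpace F V => (trivializationAt F V q y).2) (γ 0)
      (mfderiv (IB.prod 𝓘(ℝ, F)) 𝓘(ℝ, F)
        (fun y : TotalSpace F V => (trivializationAt F V q y).2) x) := by
    rw [h0]
    exact (mdifferentiableAt_trivializationAt_snd (IB := IB) x hx).hasMFDerivAt
  have h6 := (h5.comp (0 : ℝ) h1.hasMFDerivAt).hasMFDerivWithinAt (s := univ)
  have h7 := h6.hasDerivWithinAt_apply_one.hasDerivAt Filter.univ_mem
  have h8 := h7.unique ((hd q).congr_of_eventuallyEq (Filter.Eventually.of_forall (hlin q hx)))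
  rw [← h8]
  exact congrArg _ hval.symm

end SecondTangent

section Lifts

open Bundle

variable {n : ℕ} [NeZero n] {Q : Type*} [TopologicalSpace Q]
  [ChartedSpace (EuclideanHalfSpace n) Q] [IsManifold (𝓡∂ n) ∞ Q]

/-- The trivialization of `T(TQ)` over the preferred chart at the zero vector over `x₀`. -/
abbrev velTriv (x₀ : Q) : Trivialization (Coord n × Coord n)
    (TotalSpace.proj : TangentBundle (𝓡∂ n).tangent (TangentBundle (𝓡∂ n) Q) →
      TangentBundle (𝓡∂ n) Q) :=
  trivializationAt (Coord n × Coord n) (TangentSpace (𝓡∂ n).tangent)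
    (⟨x₀, 0⟩ : TangentBundle (𝓡∂ n) Q)

/-- The trivialization of `T(T*Q)` over the preferred chart at the zero covector over `x₀`. -/
abbrev momTriv (x₀ : Q) : Trivialization (Coord n × (Coord n →L[ℝ] ℝ))
    (TotalSpace.proj : TangentBundle (cotangentModel n) (CotangentBundle n Q) →
      CotangentBundle n Q) :=
  trivializationAt (Coord n × (Coord n →L[ℝ] ℝ)) (TangentSpace (cotangentModel n))
    (⟨x₀, 0⟩ : CotangentBundle n Q)

theorem mem_velTriv_baseSet {x₀ : Q} {x : TangentBundle (𝓡∂ n) Q} :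
    x ∈ (velTriv x₀).baseSet ↔ x.proj ∈ (chartAt (EuclideanHalfSpace n) x₀).source := by
  have h := mem_extChartAt_totalSpace_source (IB := 𝓡∂ n) (⟨x₀, 0⟩ : TangentBundle (𝓡∂ n) Q) x
  rw [extChartAt_source, extChartAt_source] at h
  refine Iff.trans (h : x ∈ (velTriv x₀).baseSet ↔ _) ?_
  exact ⟨fun h => h.2, fun h => ⟨h, h⟩⟩

theorem mem_momTriv_baseSet {x₀ : Q} {x : CotangentBundle n Q} :
    x ∈ (momTriv x₀).baseSet ↔ x.proj ∈ (chartAt (EuclideanHalfSpace n) x₀).source := by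
  have h := mem_extChartAt_totalSpace_source (IB := 𝓡∂ n) (⟨x₀, 0⟩ : CotangentBundle n Q) x
  rw [extChartAt_source, extChartAt_source] at h
  refine Iff.trans (h : x ∈ (momTriv x₀).baseSet ↔ _) ?_
  exact ⟨fun h => h.2, fun h => ⟨mem_cotangentTriv_baseSet.2 h, h⟩⟩

theorem velTriv_apply {x₀ : Q} {x : TangentBundle (𝓡∂ n) Q}
    (hx : x.proj ∈ (chartAt (EuclideanHalfSpace n) x₀).source)
    (ξ : TangentSpace (𝓡∂ n).tangent x) :
    (velTriv x₀ ⟨x, ξ⟩).2 =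
      ((tangentTriv x₀ ⟨x.proj, Prod.fst (α := Coord n) (β := Coord n) ξ⟩).2,
        tangentCoordChange (𝓡∂ n) x.proj x₀ x.proj (Prod.snd (α := Coord n) (β := Coord n) ξ) +
          transitionHessian (𝓡∂ n) x.proj x₀ (Prod.fst (α := Coord n) (β := Coord n) ξ) x.2) := by
  have h := trivializationAt_tangent_totalSpace (IB := 𝓡∂ n)
    (⟨x₀, 0⟩ : TangentBundle (𝓡∂ n) Q) x hx hx ξ
  refine h.trans (Prod.ext rfl ?_)
  exact DFunLike.congr_fun (hasMFDerivAt_trivializationAt_tangent_snd hx x.2).mfderiv ξ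

theorem velTriv_symmL_mem {x₀ : Q} {x : TangentBundle (𝓡∂ n) Q}
    (hx : x.proj ∈ (chartAt (EuclideanHalfSpace n) x₀).source) (a b : Coord n) :
    (velTriv x₀ ⟨x, (velTriv x₀).symmL ℝ x (a, b)⟩).2 = (a, b) := by
  rw [(velTriv x₀).symmL_apply (mem_velTriv_baseSet.2 hx)]
  exact congrArg Prod.snd ((velTriv x₀).apply_mk_symm (mem_velTriv_baseSet.2 hx) (a, b))

theorem momTriv_symmL_mem {x₀ : Q} {x : CotangentBundle n Q}
    (hx : x.proj ∈ (chartAt (EuclideanHalfSpace n) x₀).source) (a : Coord n)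
    (β : Coord n →L[ℝ] ℝ) :
    (momTriv x₀ ⟨x, (momTriv x₀).symmL ℝ x (a, β)⟩).2 = (a, β) := by
  rw [(momTriv x₀).symmL_apply (mem_momTriv_baseSet.2 hx)]
  exact congrArg Prod.snd ((momTriv x₀).apply_mk_symm (mem_momTriv_baseSet.2 hx) (a, β))

theorem fst_velTriv_symmL (x₀ : Q) (x : TangentBundle (𝓡∂ n) Q) (a b : Coord n) :
    Prod.fst (α := Coord n) (β := Coord n) ((velTriv x₀).symmL ℝ x (a, b)) =
      (tangentTriv x₀).symmL ℝ x.proj a := by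
  by_cases hx : x.proj ∈ (chartAt (EuclideanHalfSpace n) x₀).source
  · have h1 := congrArg Prod.fst
      ((velTriv_apply hx ((velTriv x₀).symmL ℝ x (a, b))).symm.trans (velTriv_symmL_mem hx a b))
    exact (tangentTriv_symmL_apply hx _).symm.trans
      (congrArg ((tangentTriv x₀).symmL ℝ x.proj) h1)
  · rw [(velTriv x₀).symmL_apply_of_notMem (fun h => hx (mem_velTriv_baseSet.1 h)),
      (tangentTriv x₀).symmL_apply_of_notMem hx]
    rfl

theorem fst_momTriv_symmL (x₀ : Q) (x : CotangentBundle n Q) (a : Coord n)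
    (β : Coord n →L[ℝ] ℝ) :
    Prod.fst (α := Coord n) (β := Coord n →L[ℝ] ℝ) ((momTriv x₀).symmL ℝ x (a, β)) =
      (tangentTriv x₀).symmL ℝ x.proj a := by
  by_cases hx : x.proj ∈ (chartAt (EuclideanHalfSpace n) x₀).source
  · have h0 := trivializationAt_tangent_totalSpace (IB := 𝓡∂ n)
      (⟨x₀, 0⟩ : CotangentBundle n Q) x (mem_cotangentTriv_baseSet.2 hx) hx
      ((momTriv x₀).symmL ℝ x (a, β))
    have h1 := congrArg Prod.fst (h0.symm.trans (momTriv_symmL_mem hx a β))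
    exact (tangentTriv_symmL_apply hx _).symm.trans
      (congrArg ((tangentTriv x₀).symmL ℝ x.proj) h1)
  · rw [(momTriv x₀).symmL_apply_of_notMem (fun h => hx (mem_momTriv_baseSet.1 h)),
      (tangentTriv x₀).symmL_apply_of_notMem hx]
    rfl

theorem snd_velTriv_symmL {x₀ : Q} {x : TangentBundle (𝓡∂ n) Q}
    (hx : x.proj ∈ (chartAt (EuclideanHalfSpace n) x₀).source) (b : Coord n) :
    Prod.snd (α := Coord n) (β := Coord n) ((velTriv x₀).symmL ℝ x (0, b)) =
      (tangentTriv x₀).symmL ℝ x.proj b := by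
  have hf : Prod.fst (α := Coord n) (β := Coord n) ((velTriv x₀).symmL ℝ x (0, b)) = 0 :=
    (fst_velTriv_symmL x₀ x 0 b).trans ((tangentTriv x₀).symmL ℝ x.proj).map_zero
  have h0 := trivializationAt_tangent_totalSpace (IB := 𝓡∂ n)
      (⟨x₀, 0⟩ : TangentBundle (𝓡∂ n) Q) x hx hx ((velTriv x₀).symmL ℝ x (0, b))
  have h1 := congrArg Prod.snd (h0.symm.trans (velTriv_symmL_mem hx 0 b))
  have h2 := (mfderiv_trivializationAt_snd_vertical (IB := 𝓡∂ n) x hx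
    ((velTriv x₀).symmL ℝ x (0, b)) hf).symm.trans h1
  refine (tangentTriv_symmL_self x.proj _).symm.trans
    ((tangentTriv_symmL_apply hx _).symm.trans (congrArg ((tangentTriv x₀).symmL ℝ x.proj) h2))

theorem snd_momTriv_symmL {x₀ : Q} {x : CotangentBundle n Q}
    (hx : x.proj ∈ (chartAt (EuclideanHalfSpace n) x₀).source) (β : Coord n →L[ℝ] ℝ)
    (w : TangentSpace (𝓡∂ n) x.proj) :
    (Prod.snd (α := Coord n) (β := Coord n →L[ℝ] ℝ) ((momTriv x₀).symmL ℝ x (0, β))) w =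
      β (tangentTriv x₀ ⟨x.proj, w⟩).2 := by
  have hx' := mem_cotangentTriv_baseSet.2 hx
  have hf : Prod.fst (α := Coord n) (β := Coord n →L[ℝ] ℝ) ((momTriv x₀).symmL ℝ x (0, β)) = 0 :=
    (fst_momTriv_symmL x₀ x 0 β).trans ((tangentTriv x₀).symmL ℝ x.proj).map_zero
  have h0 := trivializationAt_tangent_totalSpace (IB := 𝓡∂ n)
      (⟨x₀, 0⟩ : CotangentBundle n Q) x hx' hx ((momTriv x₀).symmL ℝ x (0, β))
  have h1 := congrArg Prod.snd (h0.symm.trans (momTriv_symmL_mem hx 0 β))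
  have h2 := (mfderiv_trivializationAt_snd_vertical (IB := 𝓡∂ n) x hx'
    ((momTriv x₀).symmL ℝ x (0, β)) hf).symm.trans h1
  have hself := FiberBundle.mem_baseSet_trivializationAt' (F := Coord n →L[ℝ] ℝ)
    (E := fun q : Q => TangentSpace (𝓡∂ n) q →L[ℝ] ℝ) x.proj
  set p : TangentSpace (𝓡∂ n) x.proj →L[ℝ] ℝ :=
    (Prod.snd (α := Coord n) (β := Coord n →L[ℝ] ℝ) ((momTriv x₀).symmL ℝ x (0, β))) with hp
  have h3 : (cotangentTriv x.proj).symmL ℝ x.proj p = p := by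
    rw [← cotangentTriv_self x.proj ((cotangentTriv x.proj).symmL ℝ x.proj p),
      (cotangentTriv x.proj).symmL_apply hself]
    exact congrArg Prod.snd ((cotangentTriv x.proj).apply_mk_symm hself _)
  have h4 : (cotangentTriv x₀ ⟨x.proj, p⟩).2 = β :=
    (congrArg (fun r => (cotangentTriv x₀ ⟨x.proj, r⟩).2) h3.symm).trans h2
  exact (pairing_eq hx p w).trans (DFunLike.congr_fun h4 _)

/-- The differential of a smooth function is continuous along continuous curves of tangent
vectors. -/
theorem continuousOn_lagrangianDifferential {L : TangentBundle (𝓡∂ n) Q → ℝ}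
    (hL : ContMDiff (𝓡∂ n).tangent 𝓘(ℝ, ℝ) ∞ L) {s : Set ℝ} {x : ℝ → TangentBundle (𝓡∂ n) Q}
    {ξ : ∀ t, TangentSpace (𝓡∂ n).tangent (x t)}
    (h : ContinuousOn (fun t => (⟨x t, ξ t⟩ :
      TangentBundle (𝓡∂ n).tangent (TangentBundle (𝓡∂ n) Q))) s) :
    ContinuousOn (fun t => lagrangianDifferential L (x t) (ξ t)) s := by
  have h1 : Continuous (tangentMap (𝓡∂ n).tangent 𝓘(ℝ, ℝ) L) := hL.continuous_tangentMap (by simp)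
  have h2 : Continuous fun y : TangentBundle 𝓘(ℝ, ℝ) ℝ => y.2 :=
    (contMDiff_snd_tangentBundle_modelSpace ℝ 𝓘(ℝ, ℝ) (n := 1)).continuous
  exact (h2.comp h1).comp_continuousOn h

end Lifts

section LiftVariation

open Bundle

variable {n : ℕ} [NeZero n] {Q : Type*} [TopologicalSpace Q]
  [ChartedSpace (EuclideanHalfSpace n) Q] [IsManifold (𝓡∂ n) ∞ Q]

/-- The variation of a path given by its components in the preferred charts at `x₀`; it vanishes
where the path leaves the chart. -/
def liftVariation (c : CollisionPath n Q) (x₀ : Q) (T : ℝ → ℝ) (a b : ℝ → Coord n)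
    (β : ℝ → Coord n →L[ℝ] ℝ) : Variation c where
  time := T
  pos τ := (tangentTriv x₀).symmL ℝ (c.pos τ) (a τ)
  vel σ τ := (velTriv x₀).symmL ℝ (c.velCurve σ τ) (a τ, b τ)
  mom σ τ := (momTriv x₀).symmL ℝ (c.momCurve σ τ) (a τ, β τ)

variable {c : CollisionPath n Q} {x₀ : Q} {T : ℝ → ℝ} {a b : ℝ → Coord n}
  {β : ℝ → Coord n →L[ℝ] ℝ} {τ₀ τc τ₁ : ℝ}

theorem liftVariation_velProj (σ : Side) (τ : ℝ) :
    (liftVariation c x₀ T a b β).velProj σ τ = (liftVariation c x₀ T a b β).pos τ :=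
  (Variation.velProj_eq _ σ τ).trans (fst_velTriv_symmL x₀ (c.velCurve σ τ) (a τ) (b τ))

theorem liftVariation_momProj (σ : Side) (τ : ℝ) :
    (liftVariation c x₀ T a b β).momProj σ τ = (liftVariation c x₀ T a b β).pos τ :=
  (Variation.momProj_eq _ σ τ).trans (fst_momTriv_symmL x₀ (c.momCurve σ τ) (a τ) (β τ))

theorem Icc_union_Icc_eq_dom (h₀ : τ₀ < τc) (h₁ : τc < τ₁) :
    Icc τ₀ τ₁ = Side.before.dom τ₀ τc τ₁ ∪ Side.after.dom τ₀ τc τ₁ :=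
  (Icc_union_Icc_eq_Icc h₀.le h₁.le).symm

theorem Side.isClosed_dom (σ : Side) : IsClosed (σ.dom τ₀ τc τ₁) := by
  cases σ <;> exact isClosed_Icc

theorem isAdmissible_liftVariation (h₀ : τ₀ < τc) (h₁ : τc < τ₁) (hc : IsPath τ₀ τc τ₁ c)
    {Δ : (q : Q) → Submodule ℝ (TangentSpace (𝓡∂ n) q)}
    (hT : ContDiffOn ℝ ∞ T (Icc τ₀ τ₁)) (hT₀ : T τ₀ = 0) (hT₁ : T τ₁ = 0)
    (ha : ∀ σ : Side, ContDiffOn ℝ 2 a (σ.dom τ₀ τc τ₁))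
    (hb : ∀ σ : Side, ContDiffOn ℝ 2 b (σ.dom τ₀ τc τ₁))
    (hβ : ∀ σ : Side, ContDiffOn ℝ 2 β (σ.dom τ₀ τc τ₁))
    (hsupp : ∀ τ ∈ Icc τ₀ τ₁, c.pos τ ∈ (chartAt (EuclideanHalfSpace n) x₀).source ∨
      ∀ᶠ t in 𝓝 τ, a t = 0 ∧ b t = 0 ∧ β t = 0)
    (ha₀ : a τ₀ = 0) (ha₁ : a τ₁ = 0)
    (hΔ : ∀ τ ∈ Icc τ₀ τ₁, (tangentTriv x₀).symmL ℝ (c.pos τ) (a τ) ∈ Δ (c.pos τ))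
    (hcoll : (tangentTriv x₀).symmL ℝ (c.pos τc) (a τc) ∈ boundaryTangent (c.pos τc)) :
    IsAdmissible Δ τ₀ τc τ₁ (liftVariation c x₀ T a b β) := by
  have i1 : IsManifold (𝓡∂ n) (2 + 1) Q := IsManifold.of_le (n := ∞) (by norm_cast)
  have i2 : IsManifold (𝓡∂ n).tangent (2 + 1) (TangentBundle (𝓡∂ n) Q) :=
    IsManifold.of_le (n := ∞) (by norm_cast)
  have i3 : IsManifold (cotangentModel n) (2 + 1) (CotangentBundle n Q) :=
    IsManifold.of_le (n := ∞) (by norm_cast)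
  have hsub := fun σ : Side => σ.dom_subset h₀ h₁
  have hsupp' : ∀ σ : Side, ∀ τ ∈ σ.dom τ₀ τc τ₁,
      c.pos τ ∈ (chartAt (EuclideanHalfSpace n) x₀).source ∨
        ∀ᶠ t in 𝓝[σ.dom τ₀ τc τ₁] τ, a t = 0 ∧ b t = 0 ∧ β t = 0 := fun σ τ hτ =>
    (hsupp τ (hsub σ hτ)).imp_right fun h => h.filter_mono nhdsWithin_le_nhds
  have hpos : ∀ σ : Side, ContMDiffOn 𝓘(ℝ, ℝ) (𝓡∂ n).tangent 2
      (liftVariation c x₀ T a b β).posCurve (σ.dom τ₀ τc τ₁) := fun σ =>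
    contMDiffOn_trivialization_symmL (tangentTriv x₀) (hc.pos_smooth σ) (ha σ).contMDiffOn
      fun τ hτ => (hsupp' σ τ hτ).imp_right fun h => h.mono fun t ht => ht.1
  exact
    { time_smooth := hT
      pos_continuous := by
        rw [Icc_union_Icc_eq_dom h₀ h₁]
        exact (hpos _).continuousOn.union_of_isClosed (hpos _).continuousOn
          (Side.isClosed_dom _) (Side.isClosed_dom _)
      pos_smooth := hpos
      pos_collision := hcoll
      vel_smooth := fun σ =>
        contMDiffOn_trivialization_symmL (velTriv x₀) (hc.vel_smooth σ)
          ((ha σ).prodMk (hb σ)).contMDiffOn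
          fun τ hτ => (hsupp' σ τ hτ).imp mem_velTriv_baseSet.2 fun h =>
            h.mono fun t ht => Prod.ext ht.1 ht.2.1
      mom_smooth := fun σ =>
        contMDiffOn_trivialization_symmL (momTriv x₀) (hc.mom_smooth σ)
          ((ha σ).prodMk (hβ σ)).contMDiffOn
          fun τ hτ => (hsupp' σ τ hτ).imp mem_momTriv_baseSet.2 fun h =>
            h.mono fun t ht => Prod.ext ht.1 ht.2.2
      vel_constraint := fun σ τ hτ => by
        rw [liftVariation_velProj]
        exact hΔ τ (hsub σ hτ)
      vel_proj := fun σ τ _ => liftVariation_velProj σ τ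
      mom_proj := fun σ τ _ => liftVariation_momProj σ τ
      time_start := hT₀
      time_end := hT₁
      pos_start := (congrArg ((tangentTriv x₀).symmL ℝ (c.pos τ₀)) ha₀).trans (map_zero _)
      pos_end := (congrArg ((tangentTriv x₀).symmL ℝ (c.pos τ₁)) ha₁).trans (map_zero _) }

end LiftVariation

section Bump

/-- The product of a function with a function supported in the domain of regularity. -/
theorem contDiffOn_smul_of_tsupport_subset {E : Type*} [NormedAddCommGroup E] [NormedSpace ℝ E]
    {m : ℕ∞ω} {f : ℝ → ℝ} {g : ℝ → E} {s N : Set ℝ} (hf : ContDiff ℝ m f) (hN : IsOpen N)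
    (hg : ContDiffOn ℝ m g (N ∩ s)) (h : tsupport f ⊆ N) :
    ContDiffOn ℝ m (fun t => f t • g t) s := by
  intro t ht
  by_cases hts : t ∈ tsupport f
  · refine hf.contDiffAt.contDiffWithinAt.smul ((hg t ⟨h hts, ht⟩).mono_of_mem_nhdsWithin ?_)
    exact Filter.inter_mem (mem_nhdsWithin_of_mem_nhds (hN.mem_nhds (h hts))) self_mem_nhdsWithin
  · refine (contDiffWithinAt_const (c := (0 : E))).congr_of_eventuallyEq_of_mem ?_ ht
    filter_upwards [mem_nhdsWithin_of_mem_nhds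
      ((isClosed_tsupport f).isOpen_compl.mem_nhds hts)] with r hr
    rw [image_eq_zero_of_notMem_tsupport hr, zero_smul]

/-- The fundamental lemma of the calculus of variations, in a local form. -/
theorem eq_zero_of_integral_mul_eq_zero {G : ℝ → ℝ} {a b τ : ℝ} {N : Set ℝ} (hab : a < b)
    (hτ : τ ∈ Icc a b) (hN : IsOpen N) (hτN : τ ∈ N) (hG : ContinuousOn G (N ∩ Icc a b))
    (h : ∀ f : ℝ → ℝ, ContDiff ℝ ∞ f → tsupport f ⊆ N ∩ Ioo a b →
      ∫ t in a..b, f t * G t = 0) : G τ = 0 := by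
  by_contra hne
  have hG1 : ContinuousWithinAt (fun t => G t * G τ) (N ∩ Icc a b) τ :=
    (hG τ ⟨hτN, hτ⟩).mul continuousWithinAt_const
  have hpos : {r : ℝ | 0 < r} ∈ 𝓝 (G τ * G τ) :=
    (isOpen_lt continuous_const continuous_id).mem_nhds (mul_self_pos.2 hne)
  obtain ⟨W, hW, hτW, hWs⟩ := mem_nhdsWithin.1 (hG1 hpos)
  have hcl : τ ∈ closure (Ioo a b) := by rwa [closure_Ioo hab.ne]
  obtain ⟨t₀, ⟨ht₀W, ht₀N⟩, ht₀⟩ := mem_closure_iff.1 hcl (W ∩ N) (hW.inter hN) ⟨hτW, hτN⟩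
  obtain ⟨f, hfs, -, hf, hf01, hf1⟩ := exists_contDiff_tsupport_subset (n := ⊤)
    (((hW.inter hN).inter isOpen_Ioo).mem_nhds ⟨⟨ht₀W, ht₀N⟩, ht₀⟩)
  have h0 := h f hf fun t ht => ⟨(hfs ht).1.2, (hfs ht).2⟩
  have h1 : ContinuousOn (fun t => f t * G t) (Icc a b) := by
    rw [← contDiffOn_zero (𝕜 := ℝ)] at hG ⊢
    exact contDiffOn_smul_of_tsupport_subset (hf.of_le (by simp)) hN hG fun t ht => (hfs ht).1.2
  have h2 : ∀ t ∈ Icc a b, f t ≠ 0 → 0 < G t * G τ := by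
    intro t ht hft
    have hts : t ∈ W ∩ N ∩ Ioo a b := hfs (subset_tsupport f hft)
    exact hWs ⟨hts.1.1, hts.1.2, ht⟩
  have h3 : 0 < ∫ t in a..b, f t * G t * G τ := by
    refine intervalIntegral.integral_pos hab (h1.mul continuousOn_const) ?_
      ⟨t₀, Ioo_subset_Icc_self ht₀, ?_⟩
    · intro t ht
      rcases eq_or_ne (f t) 0 with hft | hft
      · simp [hft]
      · rw [mul_assoc]
        exact mul_nonneg (hf01 (mem_range_self t)).1 (h2 t (Ioc_subset_Icc_self ht) hft).le
    · rw [hf1, one_mul]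
      exact h2 t₀ (Ioo_subset_Icc_self ht₀) (by rw [hf1]; exact one_ne_zero)
  rw [intervalIntegral.integral_mul_const, h0, zero_mul] at h3
  exact lt_irrefl _ h3

end Bump

section Vertical

open Bundle

variable {n : ℕ} [NeZero n] {Q : Type*} [TopologicalSpace Q]
  [ChartedSpace (EuclideanHalfSpace n) Q] [IsManifold (𝓡∂ n) ∞ Q]
  {L : TangentBundle (𝓡∂ n) Q → ℝ} {Δ : (q : Q) → Submodule ℝ (TangentSpace (𝓡∂ n) q)}
  {τ₀ τc τ₁ : ℝ} {c : CollisionPath n Q}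

theorem IsPath.exists_isOpen_mapsTo (hc : IsPath τ₀ τc τ₁ c) {τ : ℝ} (hτ : τ ∈ Icc τ₀ τ₁)
    {U : Set Q} (hU : IsOpen U) (hτU : c.pos τ ∈ U) :
    ∃ N : Set ℝ, IsOpen N ∧ τ ∈ N ∧ ∀ t ∈ N ∩ Icc τ₀ τ₁, c.pos t ∈ U := by
  obtain ⟨N, hN, h⟩ := continuousOn_iff'.1 hc.pos_continuous U hU
  have hmem : τ ∈ N ∩ Icc τ₀ τ₁ := by
    rw [← h]
    exact ⟨hτU, hτ⟩
  refine ⟨N, hN, hmem.1, fun t ht => ?_⟩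
  rw [← h] at ht
  exact ht.1

/-- A critical path satisfies the variational equation on one piece for variations which are
supported there. -/
theorem IsCritical.integral_eq_zero (h₀ : τ₀ < τc) (h₁ : τc < τ₁) (hcrit : IsCritical L Δ τ₀ τc τ₁ c)
    {δ : Variation c} (hδ : IsAdmissible Δ τ₀ τc τ₁ δ) {σ : Side} {a b : ℝ} (hab : a < b)
    (hD : σ.dom τ₀ τc τ₁ = Icc a b)
    (hz : ∀ σ' : Side, ∀ τ ∈ σ'.dom τ₀ τc τ₁, τ ∉ Ioo a b →
      actionDensityVariation L τ₀ τc τ₁ δ σ' τ = 0) :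
    ∫ τ in a..b, actionDensityVariation L τ₀ τc τ₁ δ σ τ = 0 := by
  have h := hcrit δ hδ
  rw [actionVariation] at h
  cases σ
  · obtain ⟨rfl, rfl⟩ := (Icc_eq_Icc_iff h₀.le).1 hD
    rwa [intervalIntegral.integral_congr (g := fun _ => (0 : ℝ)) (a := τc) (b := τ₁),
      intervalIntegral.integral_zero, add_zero] at h
    intro τ hτ
    rw [uIcc_of_le h₁.le] at hτ
    exact hz .after τ hτ fun hτ' => absurd hτ.1 (not_le.2 hτ'.2)
  · obtain ⟨rfl, rfl⟩ := (Icc_eq_Icc_iff h₁.le).1 hD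
    rwa [intervalIntegral.integral_congr (g := fun _ => (0 : ℝ)) (a := τ₀) (b := τc),
      intervalIntegral.integral_zero, zero_add] at h
    intro τ hτ
    rw [uIcc_of_le h₀.le] at hτ
    exact hz .before τ hτ fun hτ' => absurd hτ.2 (not_le.2 hτ'.1)

theorem mom_posRateFibre_eq_zero (h₀ : τ₀ < τc) (h₁ : τc < τ₁) (hc : IsPath τ₀ τc τ₁ c)
    {δ : Variation c} (hδ : IsAdmissible Δ τ₀ τc τ₁ δ) (σ : Side) {τ : ℝ}
    (hτ : τ ∈ σ.dom τ₀ τc τ₁) (h : ∀ᶠ t in 𝓝 τ, δ.pos t = 0) :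
    c.mom σ τ (δ.posRateFibre τ₀ τc τ₁ σ τ) = 0 := by
  have h1 := hasDerivWithinAt_mom_pos hc σ hτ
    ((hδ.pos_smooth σ τ hτ).mdifferentiableWithinAt two_ne_zero)
  have h2 : HasDerivWithinAt (fun t => c.mom σ t (δ.pos t)) 0 (σ.dom τ₀ τc τ₁) τ := by
    refine (hasDerivWithinAt_const τ (σ.dom τ₀ τc τ₁) (0 : ℝ)).congr_of_eventuallyEq_of_mem ?_ hτ
    filter_upwards [mem_nhdsWithin_of_mem_nhds h] with t ht
    rw [ht, map_zero]
  have h3 := (σ.uniqueDiffOn_dom h₀ h₁ τ hτ).eq_deriv _ h1 h2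
  rwa [h.self_of_nhds, map_zero, zero_add] at h3

theorem liftVariation_pos_eq_zero {x₀ : Q} {T : ℝ → ℝ} {a b : ℝ → Coord n}
    {β : ℝ → Coord n →L[ℝ] ℝ} {τ : ℝ} (h : a τ = 0) :
    (liftVariation c x₀ T a b β).pos τ = 0 :=
  (congrArg ((tangentTriv x₀).symmL ℝ (c.pos τ)) h).trans (map_zero _)

theorem actionDensityVariation_liftVariation_eq_zero (h₀ : τ₀ < τc) (h₁ : τc < τ₁)
    (hc : IsPath τ₀ τc τ₁ c) {x₀ : Q} {T : ℝ → ℝ} {a b : ℝ → Coord n} {β : ℝ → Coord n →L[ℝ] ℝ}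
    (hδ : IsAdmissible Δ τ₀ τc τ₁ (liftVariation c x₀ T a b β)) (σ : Side) {τ : ℝ}
    (hτ : τ ∈ σ.dom τ₀ τc τ₁) (h : ∀ᶠ t in 𝓝 τ, T t = 0 ∧ a t = 0 ∧ b t = 0 ∧ β t = 0) :
    actionDensityVariation L τ₀ τc τ₁ (liftVariation c x₀ T a b β) σ τ = 0 := by
  obtain ⟨-, ha, hb, hβ⟩ := h.self_of_nhds
  have h1 := mom_posRateFibre_eq_zero h₀ h₁ hc hδ σ hτ
    (h.mono fun t ht => liftVariation_pos_eq_zero ht.2.1)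
  have h2 : (liftVariation c x₀ T a b β).timeRate τ₀ τ₁ τ = 0 := by
    have h3 : T =ᶠ[𝓝[Icc τ₀ τ₁] τ] fun _ => 0 :=
      mem_nhdsWithin_of_mem_nhds (h.mono fun t ht => ht.1)
    exact (h3.derivWithin_eq h.self_of_nhds.1).trans (derivWithin_fun_const (Icc τ₀ τ₁) (0 : ℝ) ▸ rfl)
  have h3 : (liftVariation c x₀ T a b β).vel σ τ = 0 :=
    (congrArg ((velTriv x₀).symmL ℝ (c.velCurve σ τ))
      (Prod.ext ha hb : (a τ, b τ) = 0)).trans ((velTriv x₀).symmL ℝ (c.velCurve σ τ)).map_zero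
  have h4 : (liftVariation c x₀ T a b β).mom σ τ = 0 :=
    (congrArg ((momTriv x₀).symmL ℝ (c.momCurve σ τ))
      (Prod.ext ha hβ : (a τ, β τ) = 0)).trans ((momTriv x₀).symmL ℝ (c.momCurve σ τ)).map_zero
  have h5 : (liftVariation c x₀ T a b β).velFibre σ τ = 0 := congrArg
    (fun x => Prod.snd (α := Coord n) (β := Coord n) x) h3
  have h6 : (liftVariation c x₀ T a b β).momFibre σ τ = 0 := congrArg
    (fun x => Prod.snd (α := Coord n) (β := Coord n →L[ℝ] ℝ) x) h4
  have h7 : lagrangianDifferential L (c.velCurve σ τ) ((liftVariation c x₀ T a b β).vel σ τ) = 0 := by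
    rw [h3]
    exact map_zero (mfderiv (𝓡∂ n).tangent 𝓘(ℝ, ℝ) L (c.velCurve σ τ))
  rw [actionDensityVariation, h1, h2, h5, h6, h7]
  simp

theorem actionDensityVariation_of_posRateFibre_eq_zero {δ : Variation c} {σ : Side} {τ : ℝ}
    (h : c.mom σ τ (δ.posRateFibre τ₀ τc τ₁ σ τ) = 0) :
    actionDensityVariation L τ₀ τc τ₁ δ σ τ =
      c.timeRate τ₀ τ₁ τ * (lagrangianDifferential L (c.velCurve σ τ) (δ.vel σ τ) -
        c.mom σ τ (δ.velFibre σ τ)) +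
      δ.momFibre σ τ (c.posRate τ₀ τc τ₁ σ τ - c.timeRate τ₀ τ₁ τ • c.vel σ τ) -
      δ.timeRate τ₀ τ₁ τ * c.energyAt L σ τ := by
  rw [map_sub, map_smul, actionDensityVariation, h, CollisionPath.energyAt, energy, smul_eq_mul,
    CollisionPath.velCurve]
  ring

end Vertical

section Necessity

open Bundle

variable {n : ℕ} [NeZero n] {Q : Type*} [TopologicalSpace Q]
  [ChartedSpace (EuclideanHalfSpace n) Q] [IsManifold (𝓡∂ n) ∞ Q]
  {L : TangentBundle (𝓡∂ n) Q → ℝ} {Δ : (q : Q) → Submodule ℝ (TangentSpace (𝓡∂ n) q)}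
  {τ₀ τc τ₁ : ℝ} {c : CollisionPath n Q}

theorem eventually_eq_zero_of_notMem_tsupport {f : ℝ → ℝ} {t : ℝ} (h : t ∉ tsupport f) :
    ∀ᶠ r in 𝓝 t, f r = 0 := by
  filter_upwards [(isClosed_tsupport f).isOpen_compl.mem_nhds h] with r hr
  exact image_eq_zero_of_notMem_tsupport hr

theorem IsPath.timeRate_continuousOn (h₀ : τ₀ < τc) (h₁ : τc < τ₁) (hc : IsPath τ₀ τc τ₁ c) :
    ContinuousOn (c.timeRate τ₀ τ₁) (Icc τ₀ τ₁) :=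
  hc.time_smooth.continuousOn_derivWithin (uniqueDiffOn_Icc (h₀.trans h₁)) (by simp)

theorem IsPath.chart_pos_contDiffOn (hc : IsPath τ₀ τc τ₁ c) {x₀ : Q} {σ : Side} {S : Set ℝ}
    (hS : S ⊆ σ.dom τ₀ τc τ₁)
    (hsource : ∀ t ∈ S, c.pos t ∈ (chartAt (EuclideanHalfSpace n) x₀).source) :
    ContDiffOn ℝ 2 (extChartAt (𝓡∂ n) x₀ ∘ c.pos) S := by
  have i : IsManifold (𝓡∂ n) 2 Q := IsManifold.of_le (n := ∞) (by norm_cast)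
  rw [← contMDiffOn_iff_contDiffOn]
  exact (contMDiffOn_extChartAt (I := 𝓡∂ n) (x := x₀) (n := 2)).comp
    ((hc.pos_smooth σ).mono hS) hsource

theorem contDiffOn_tangentTriv {x₀ : Q} {q : ℝ → Q} {w : ∀ t, TangentSpace (𝓡∂ n) (q t)}
    {m : ℕ∞ω} (hm : m ≤ ∞) {S : Set ℝ}
    (h : ContMDiffOn 𝓘(ℝ, ℝ) (𝓡∂ n).tangent m
      (fun t => (⟨q t, w t⟩ : TangentBundle (𝓡∂ n) Q)) S)
    (hsource : ∀ t ∈ S, q t ∈ (chartAt (EuclideanHalfSpace n) x₀).source) :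
    ContDiffOn ℝ m (fun t => (tangentTriv x₀ ⟨q t, w t⟩).2) S := by
  have i : ContMDiffVectorBundle m (Coord n) (TangentSpace (𝓡∂ n) : Q → Type _) (𝓡∂ n) :=
    ContMDiffVectorBundle.of_le (n := ∞) hm
  intro t ht
  rw [← contMDiffWithinAt_iff_contDiffWithinAt]
  have ht' : (⟨q t, w t⟩ : TangentBundle (𝓡∂ n) Q) ∈ (tangentTriv x₀).source :=
    (tangentTriv x₀).mem_source.2 (hsource t ht)
  exact (((tangentTriv x₀).contMDiffWithinAt_iff (IB := 𝓡∂ n)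
    (f := fun t => (⟨q t, w t⟩ : TangentBundle (𝓡∂ n) Q)) ht').1 (h t ht)).2

theorem IsPath.tangentTriv_posRate (h₀ : τ₀ < τc) (h₁ : τc < τ₁) (hc : IsPath τ₀ τc τ₁ c)
    {x₀ : Q} {σ : Side} {N : Set ℝ} (hN : IsOpen N) {t : ℝ} (ht : t ∈ σ.dom τ₀ τc τ₁ ∩ N)
    (hsource : c.pos t ∈ (chartAt (EuclideanHalfSpace n) x₀).source) :
    (tangentTriv x₀ ⟨c.pos t, c.posRate τ₀ τc τ₁ σ t⟩).2 =
      derivWithin (extChartAt (𝓡∂ n) x₀ ∘ c.pos) (σ.dom τ₀ τc τ₁ ∩ N) t := by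
  rw [derivWithin, fderivWithin_inter (hN.mem_nhds ht.2)]
  exact trivializationAt_mfderivWithin
    ((hc.pos_smooth σ t ht.1).mdifferentiableWithinAt two_ne_zero)
    (σ.uniqueDiffOn_dom h₀ h₁ t ht.1) hsource 1

/-- The variation of the density in the vertical direction with constant components `w`, `φ` in
the preferred chart at `x₀`. -/
def verticalDensity (L : TangentBundle (𝓡∂ n) Q → ℝ) (τ₀ τc τ₁ : ℝ) (c : CollisionPath n Q)
    (x₀ : Q) (σ : Side) (w : Coord n) (φ : Coord n →L[ℝ] ℝ) (τ : ℝ) : ℝ :=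
  c.timeRate τ₀ τ₁ τ * (lagrangianDifferential L (c.velCurve σ τ)
      ((velTriv x₀).symmL ℝ (c.velCurve σ τ) (0, w)) -
    c.mom σ τ (Prod.snd (α := Coord n) (β := Coord n)
      ((velTriv x₀).symmL ℝ (c.velCurve σ τ) (0, w)))) +
  (show TangentSpace (𝓡∂ n) (c.pos τ) →L[ℝ] ℝ from
    Prod.snd (α := Coord n) (β := Coord n →L[ℝ] ℝ) ((momTriv x₀).symmL ℝ (c.momCurve σ τ) (0, φ)))
    (c.posRate τ₀ τc τ₁ σ τ - c.timeRate τ₀ τ₁ τ • c.vel σ τ)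

theorem continuousOn_verticalDensity (h₀ : τ₀ < τc) (h₁ : τc < τ₁)
    (hL : ContMDiff (𝓡∂ n).tangent 𝓘(ℝ, ℝ) ∞ L) (hc : IsPath τ₀ τc τ₁ c) {x₀ : Q} {σ : Side}
    {N : Set ℝ} (hN : IsOpen N)
    (hsource : ∀ t ∈ N ∩ Icc τ₀ τ₁, c.pos t ∈ (chartAt (EuclideanHalfSpace n) x₀).source)
    (w : Coord n) (φ : Coord n →L[ℝ] ℝ) :
    ContinuousOn (verticalDensity L τ₀ τc τ₁ c x₀ σ w φ) (σ.dom τ₀ τc τ₁ ∩ N) := by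
  have i1 : IsManifold (𝓡∂ n) (2 + 1) Q := IsManifold.of_le (n := ∞) (by norm_cast)
  have i2 : IsManifold (𝓡∂ n).tangent (2 + 1) (TangentBundle (𝓡∂ n) Q) :=
    IsManifold.of_le (n := ∞) (by norm_cast)
  set S := σ.dom τ₀ τc τ₁ ∩ N with hS
  have hSd : S ⊆ σ.dom τ₀ τc τ₁ := inter_subset_left
  have hSI : S ⊆ Icc τ₀ τ₁ := hSd.trans (σ.dom_subset h₀ h₁)
  have hs : ∀ t ∈ S, c.pos t ∈ (chartAt (EuclideanHalfSpace n) x₀).source := fun t ht =>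
    hsource t ⟨ht.2, hSI ht⟩
  have hT : ContinuousOn (c.timeRate τ₀ τ₁) S := (hc.timeRate_continuousOn h₀ h₁).mono hSI
  have hξ : ContMDiffOn 𝓘(ℝ, ℝ) (𝓡∂ n).tangent.tangent 2
      (fun t => (⟨c.velCurve σ t, (velTriv x₀).symmL ℝ (c.velCurve σ t) (0, w)⟩ :
        TangentBundle (𝓡∂ n).tangent (TangentBundle (𝓡∂ n) Q))) S :=
    contMDiffOn_trivialization_symmL (velTriv x₀) ((hc.vel_smooth σ).mono hSd)
      contMDiffOn_const fun t ht => Or.inl (mem_velTriv_baseSet.2 (hs t ht))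
  have hw : ContMDiffOn 𝓘(ℝ, ℝ) (𝓡∂ n).tangent 2
      (fun t => (⟨c.pos t, (tangentTriv x₀).symmL ℝ (c.pos t) w⟩ : TangentBundle (𝓡∂ n) Q)) S :=
    contMDiffOn_trivialization_symmL (tangentTriv x₀) ((hc.pos_smooth σ).mono hSd)
      contMDiffOn_const fun t ht => Or.inl (hs t ht)
  have hp : ContDiffOn ℝ 2 (fun t => c.mom σ t ((tangentTriv x₀).symmL ℝ (c.pos t) w)) S :=
    fun t ht => contMDiffWithinAt_pairing (by norm_cast) ((hc.mom_smooth σ).mono hSd t ht) (hw t ht)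
  have hq : ContinuousOn (fun t => (tangentTriv x₀ ⟨c.pos t, c.posRate τ₀ τc τ₁ σ t⟩).2) S := by
    have hu : UniqueDiffOn ℝ S := (σ.uniqueDiffOn_dom h₀ h₁).inter hN
    refine ((hc.chart_pos_contDiffOn hSd hs).continuousOn_derivWithin hu one_le_two).congr ?_
    exact fun t ht => hc.tangentTriv_posRate h₀ h₁ hN ht (hs t ht)
  have hv : ContinuousOn (fun t => (tangentTriv x₀ ⟨c.pos t, c.vel σ t⟩).2) S :=
    (contDiffOn_tangentTriv (by norm_cast) ((hc.vel_smooth σ).mono hSd) hs).continuousOn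
  have hcont : ContinuousOn (fun t => c.timeRate τ₀ τ₁ t *
      (lagrangianDifferential L (c.velCurve σ t) ((velTriv x₀).symmL ℝ (c.velCurve σ t) (0, w)) -
        c.mom σ t ((tangentTriv x₀).symmL ℝ (c.pos t) w)) +
      (φ (tangentTriv x₀ ⟨c.pos t, c.posRate τ₀ τc τ₁ σ t⟩).2 -
        c.timeRate τ₀ τ₁ t * φ (tangentTriv x₀ ⟨c.pos t, c.vel σ t⟩).2)) S :=
    (hT.mul ((continuousOn_lagrangianDifferential hL hξ.continuousOn).sub hp.continuousOn)).add
      ((φ.continuous.comp_continuousOn hq).sub (hT.mul (φ.continuous.comp_continuousOn hv)))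
  refine hcont.congr fun t ht => ?_
  have e1 := snd_velTriv_symmL (x := c.velCurve σ t) (hs t ht) w
  have e2 := snd_momTriv_symmL (x := c.momCurve σ t) (hs t ht) φ
  refine congrArg₂ (· + ·) (congrArg (fun u => _ * (_ - c.mom σ t u)) e1) ?_
  refine (e2 _).trans ?_
  have hlin := (tangentTriv x₀).linear ℝ (hs t ht)
  have e3 : (tangentTriv x₀ ⟨c.pos t, c.posRate τ₀ τc τ₁ σ t - c.timeRate τ₀ τ₁ t • c.vel σ t⟩).2 =
      (tangentTriv x₀ ⟨c.pos t, c.posRate τ₀ τc τ₁ σ t⟩).2 -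
        c.timeRate τ₀ τ₁ t • (tangentTriv x₀ ⟨c.pos t, c.vel σ t⟩).2 := by
    rw [hlin.map_sub, hlin.map_smul]
  refine (congrArg φ e3).trans ?_
  rw [map_sub, map_smul, smul_eq_mul]

theorem IsCritical.verticalDensity_eq_zero (h₀ : τ₀ < τc) (h₁ : τc < τ₁)
    (hL : ContMDiff (𝓡∂ n).tangent 𝓘(ℝ, ℝ) ∞ L) (hc : IsPath τ₀ τc τ₁ c)
    (hcrit : IsCritical L Δ τ₀ τc τ₁ c) {σ : Side} {τ : ℝ} (hτ : τ ∈ σ.dom τ₀ τc τ₁)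
    (w : Coord n) (φ : Coord n →L[ℝ] ℝ) :
    verticalDensity L τ₀ τc τ₁ c (c.pos τ) σ w φ τ = 0 := by
  obtain ⟨a, b, hab, hD, hsub⟩ := σ.exists_dom_eq_Icc h₀ h₁
  obtain ⟨N, hN, hτN, hsource⟩ := hc.exists_isOpen_mapsTo (σ.dom_subset h₀ h₁ hτ)
    (chartAt (EuclideanHalfSpace n) (c.pos τ)).open_source (mem_chart_source _ _)
  have hG := continuousOn_verticalDensity h₀ h₁ hL hc (σ := σ) hN hsource w φ
  rw [hD, inter_comm] at hG
  refine eq_zero_of_integral_mul_eq_zero hab (hD ▸ hτ) hN hτN hG fun f hf hfs => ?_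
  have hz : ∀ t, t ∉ Ioo a b → ∀ᶠ r in 𝓝 t, f r = 0 := fun t ht =>
    eventually_eq_zero_of_notMem_tsupport fun h => ht (hfs h).2
  have hf2 : ContDiff ℝ 2 f := hf.of_le (by norm_cast)
  have hδ : IsAdmissible Δ τ₀ τc τ₁
      (liftVariation c (c.pos τ) 0 0 (fun t => f t • w) (fun t => f t • φ)) := by
    refine isAdmissible_liftVariation h₀ h₁ hc contDiffOn_const rfl rfl
      (fun _ => contDiffOn_const) (fun _ => (hf2.smul contDiff_const).contDiffOn)
      (fun _ => (hf2.smul contDiff_const).contDiffOn) ?_ rfl rfl ?_ ?_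
    · intro t ht
      by_cases hts : t ∈ tsupport f
      · exact Or.inl (hsource t ⟨(hfs hts).1, ht⟩)
      · right
        filter_upwards [eventually_eq_zero_of_notMem_tsupport hts] with r hr
        simp [hr]
    · intro t ht
      rw [Pi.zero_apply, map_zero]
      exact zero_mem _
    · rw [Pi.zero_apply, map_zero]
      exact zero_mem _
  rw [← hcrit.integral_eq_zero h₀ h₁ hδ hab hD fun σ' t ht htn =>
    actionDensityVariation_liftVariation_eq_zero h₀ h₁ hc hδ σ' ht ?_]
  · refine intervalIntegral.integral_congr fun t ht => ?_
    rw [uIcc_of_le hab.le, ← hD] at ht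
    have h1 := mom_posRateFibre_eq_zero h₀ h₁ hc hδ σ ht
      (Filter.Eventually.of_forall fun t => liftVariation_pos_eq_zero rfl)
    have h2 : (liftVariation c (c.pos τ) 0 0 (fun t => f t • w) (fun t => f t • φ)).vel σ t =
        f t • (velTriv (c.pos τ)).symmL ℝ (c.velCurve σ t) (0, w) := by
      refine Eq.trans (congrArg ((velTriv (c.pos τ)).symmL ℝ (c.velCurve σ t)) ?_)
        (((velTriv (c.pos τ)).symmL ℝ (c.velCurve σ t)).map_smul (f t) (0, w))
      exact Prod.ext (smul_zero (f t)).symm rfl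
    have h3 : (liftVariation c (c.pos τ) 0 0 (fun t => f t • w) (fun t => f t • φ)).mom σ t =
        f t • (momTriv (c.pos τ)).symmL ℝ (c.momCurve σ t) (0, φ) := by
      refine Eq.trans (congrArg ((momTriv (c.pos τ)).symmL ℝ (c.momCurve σ t)) ?_)
        (((momTriv (c.pos τ)).symmL ℝ (c.momCurve σ t)).map_smul (f t) (0, φ))
      exact Prod.ext (smul_zero (f t)).symm rfl
    have h4 : (liftVariation c (c.pos τ) 0 0 (fun t => f t • w) (fun t => f t • φ)).timeRate
        τ₀ τ₁ t = 0 := congrFun (derivWithin_fun_const (Icc τ₀ τ₁) (0 : ℝ)) t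
    have h5 : ∀ u, (liftVariation c (c.pos τ) 0 0 (fun t => f t • w)
        (fun t => f t • φ)).momFibre σ t u =
        f t * (show TangentSpace (𝓡∂ n) (c.pos t) →L[ℝ] ℝ from
          Prod.snd (α := Coord n) (β := Coord n →L[ℝ] ℝ)
            ((momTriv (c.pos τ)).symmL ℝ (c.momCurve σ t) (0, φ))) u := fun u =>
      congrArg (fun ζ => (show TangentSpace (𝓡∂ n) (c.pos t) →L[ℝ] ℝ from
          Prod.snd (α := Coord n) (β := Coord n →L[ℝ] ℝ) ζ) u) h3
    have h6 : c.mom σ t ((liftVariation c (c.pos τ) 0 0 (fun t => f t • w)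
        (fun t => f t • φ)).velFibre σ t) = f t * c.mom σ t (Prod.snd (α := Coord n) (β := Coord n)
          ((velTriv (c.pos τ)).symmL ℝ (c.velCurve σ t) (0, w))) :=
      (congrArg (fun ζ => c.mom σ t (Prod.snd (α := Coord n) (β := Coord n) ζ)) h2).trans
        ((c.mom σ t).map_smul (f t) _)
    rw [actionDensityVariation_of_posRateFibre_eq_zero h1, h2, h4, h5, h6,
      lagrangianDifferential_smul, verticalDensity]
    ring
  · filter_upwards [hz t htn] with r hr
    simp [hr]

theorem IsCritical.legendre (h₀ : τ₀ < τc) (h₁ : τc < τ₁)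
    (hL : ContMDiff (𝓡∂ n).tangent 𝓘(ℝ, ℝ) ∞ L) (hc : IsPath τ₀ τc τ₁ c)
    (hcrit : IsCritical L Δ τ₀ τc τ₁ c) {σ : Side} {τ : ℝ} (hτ : τ ∈ σ.dom τ₀ τc τ₁)
    (w : TangentSpace (𝓡∂ n) (c.pos τ)) :
    c.mom σ τ w = fibreDerivative L (c.pos τ) (c.vel σ τ) w := by
  have h := hcrit.verticalDensity_eq_zero h₀ h₁ hL hc hτ w 0
  have hs := mem_chart_source (EuclideanHalfSpace n) (c.pos τ)
  have h1 := snd_momTriv_symmL (x := c.momCurve σ τ) hs 0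
    (c.posRate τ₀ τc τ₁ σ τ - c.timeRate τ₀ τ₁ τ • c.vel σ τ)
  have h2 : (velTriv (c.pos τ)).symmL ℝ (c.velCurve σ τ) (0, w) =
      ofCoords (c.pos τ) (c.vel σ τ) (0, w) := by
    refine Prod.ext (α := Coord n) (β := Coord n) ?_ ?_
    · exact (fst_velTriv_symmL (c.pos τ) (c.velCurve σ τ) 0 w).trans (map_zero _)
    · exact (snd_velTriv_symmL (x := c.velCurve σ τ) hs w).trans (tangentTriv_symmL_self _ w)
  have h3 : c.timeRate τ₀ τ₁ τ * (lagrangianDifferential L (c.velCurve σ τ)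
      (ofCoords (c.pos τ) (c.vel σ τ) (0, w)) - c.mom σ τ w) + 0 = 0 := by
    refine Eq.trans (congrArg₂ (· + ·) ?_ h1.symm) h
    exact congrArg (fun ζ => c.timeRate τ₀ τ₁ τ * (lagrangianDifferential L (c.velCurve σ τ) ζ -
      c.mom σ τ (Prod.snd (α := Coord n) (β := Coord n) ζ))) h2.symm
  have hpos := hc.time_pos τ (σ.dom_subset h₀ h₁ hτ)
  rw [add_zero, mul_eq_zero, or_iff_right hpos.ne', sub_eq_zero] at h3
  rw [fibreDerivative_eq hL]
  exact h3.symm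

theorem IsCritical.posRate_eq (h₀ : τ₀ < τc) (h₁ : τc < τ₁)
    (hL : ContMDiff (𝓡∂ n).tangent 𝓘(ℝ, ℝ) ∞ L) (hc : IsPath τ₀ τc τ₁ c)
    (hcrit : IsCritical L Δ τ₀ τc τ₁ c) {σ : Side} {τ : ℝ} (hτ : τ ∈ σ.dom τ₀ τc τ₁) :
    c.posRate τ₀ τc τ₁ σ τ = c.timeRate τ₀ τ₁ τ • c.vel σ τ := by
  set u := c.posRate τ₀ τc τ₁ σ τ - c.timeRate τ₀ τ₁ τ • c.vel σ τ with hu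
  have hs := mem_chart_source (EuclideanHalfSpace n) (c.pos τ)
  have key : ∀ φ : Coord n →L[ℝ] ℝ, φ (coords u) = 0 := by
    intro φ
    have h := hcrit.verticalDensity_eq_zero h₀ h₁ hL hc hτ 0 φ
    have h1 := snd_momTriv_symmL (x := c.momCurve σ τ) hs φ u
    have h2 : (velTriv (c.pos τ)).symmL ℝ (c.velCurve σ τ) (0, 0) = 0 :=
      ((velTriv (c.pos τ)).symmL ℝ (c.velCurve σ τ)).map_zero
    have h3 : c.timeRate τ₀ τ₁ τ * (lagrangianDifferential L (c.velCurve σ τ) 0 -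
        c.mom σ τ 0) + φ (tangentTriv (c.pos τ) ⟨c.pos τ, u⟩).2 = 0 := by
      refine Eq.trans (congrArg₂ (· + ·) ?_ h1.symm) h
      exact congrArg (fun ζ => c.timeRate τ₀ τ₁ τ * (lagrangianDifferential L (c.velCurve σ τ) ζ -
        c.mom σ τ (Prod.snd (α := Coord n) (β := Coord n) ζ))) h2.symm
    have h4 : lagrangianDifferential L (c.velCurve σ τ) 0 = 0 :=
      (mfderiv (𝓡∂ n).tangent 𝓘(ℝ, ℝ) L (c.velCurve σ τ)).map_zero
    rw [h4, map_zero, sub_zero, mul_zero, zero_add] at h3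
    exact (congrArg φ (trivializationAt_tangent_self (I := 𝓡∂ n) (c.pos τ) u)).symm.trans h3
  have h0 : coords u = 0 := SeparatingDual.eq_zero_of_forall_dual_eq_zero (R := ℝ) key
  exact sub_eq_zero.1 h0

theorem IsCritical.energy (h₀ : τ₀ < τc) (h₁ : τc < τ₁)
    (hL : ContMDiff (𝓡∂ n).tangent 𝓘(ℝ, ℝ) ∞ L) (hc : IsPath τ₀ τc τ₁ c)
    (hcrit : IsCritical L Δ τ₀ τc τ₁ c) {σ : Side} {τ : ℝ} (hτ : τ ∈ σ.dom τ₀ τc τ₁) :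
    HasDerivWithinAt (c.energyAt L σ) 0 (σ.dom τ₀ τc τ₁) τ := by
  obtain ⟨a, b, hab, hD, hsub⟩ := σ.exists_dom_eq_Icc h₀ h₁
  have hE := hc.energyAt_contDiffOn hL σ
  have hdiff := (hE.differentiableOn two_ne_zero τ hτ).hasDerivWithinAt
  suffices h : derivWithin (c.energyAt L σ) (σ.dom τ₀ τc τ₁) τ = 0 by rwa [h] at hdiff
  rw [hD] at hE hτ ⊢
  have hu := uniqueDiffOn_Icc hab
  refine eq_zero_of_integral_mul_eq_zero (N := univ) hab hτ isOpen_univ (mem_univ _) ?_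
    fun f hf hfs => ?_
  · rw [univ_inter]
    exact hE.continuousOn_derivWithin hu one_le_two
  rw [univ_inter] at hfs
  have hz : ∀ t, t ∉ Ioo a b → ∀ᶠ r in 𝓝 t, f r = 0 := fun t ht =>
    eventually_eq_zero_of_notMem_tsupport fun h => ht (hfs h)
  have hz₀ : f τ₀ = 0 := (hz τ₀ fun h => absurd (hsub (left_mem_Icc.2 hab.le)).1
    (not_le.2 h.1)).self_of_nhds
  have hz₁ : f τ₁ = 0 := (hz τ₁ fun h => absurd (hsub (right_mem_Icc.2 hab.le)).2
    (not_le.2 h.2)).self_of_nhds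
  have hδ : IsAdmissible Δ τ₀ τc τ₁ (liftVariation c (c.pos τ) f 0 0 0) := by
    refine isAdmissible_liftVariation h₀ h₁ hc hf.contDiffOn hz₀ hz₁
      (fun _ => contDiffOn_const) (fun _ => contDiffOn_const) (fun _ => contDiffOn_const)
      (fun t ht => Or.inr (Filter.Eventually.of_forall fun _ => ⟨rfl, rfl, rfl⟩)) rfl rfl ?_ ?_
    · intro t ht
      rw [Pi.zero_apply, map_zero]
      exact zero_mem _
    · rw [Pi.zero_apply, map_zero]
      exact zero_mem _
  have h1 := hcrit.integral_eq_zero h₀ h₁ hδ hab hD fun σ' t ht htn =>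
    actionDensityVariation_liftVariation_eq_zero h₀ h₁ hc hδ σ' ht
      ((hz t htn).mono fun r hr => ⟨hr, rfl, rfl, rfl⟩)
  have hfE : ContDiffOn ℝ 1 (fun t => f t * c.energyAt L σ t) (Icc a b) :=
    (hf.of_le (by norm_cast)).contDiffOn.mul (hE.of_le one_le_two)
  have h2 := intervalIntegral.integral_derivWithin_Icc_of_contDiffOn_Icc hfE hab.le
  rw [(hz a fun h => lt_irrefl _ h.1).self_of_nhds, (hz b fun h => lt_irrefl _ h.2).self_of_nhds,
    zero_mul, zero_mul, sub_zero] at h2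
  have hcE := ContinuousOn.intervalIntegrable (μ := MeasureTheory.volume) (a := a) (b := b)
    (u := fun t => f t * derivWithin (c.energyAt L σ) (Icc a b) t) (by
      rw [uIcc_of_le hab.le]
      exact hf.continuous.continuousOn.mul (hE.continuousOn_derivWithin hu one_le_two))
  have hcfE := ContinuousOn.intervalIntegrable (μ := MeasureTheory.volume) (a := a) (b := b)
    (u := derivWithin (fun t => f t * c.energyAt L σ t) (Icc a b)) (by
      rw [uIcc_of_le hab.le]
      exact hfE.continuousOn_derivWithin hu le_rfl)
  have h3 := intervalIntegral.integral_sub hcE hcfE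
  rw [h2, sub_zero] at h3
  rw [← h3, ← h1]
  refine intervalIntegral.integral_congr fun t ht => ?_
  rw [uIcc_of_le hab.le] at ht
  have ht' : t ∈ σ.dom τ₀ τc τ₁ := by rwa [hD]
  have hfd : HasDerivAt f (deriv f t) t := (hf.differentiable (by simp) t).hasDerivAt
  have e1 : derivWithin (fun t => f t * c.energyAt L σ t) (Icc a b) t =
      deriv f t * c.energyAt L σ t + f t * derivWithin (c.energyAt L σ) (Icc a b) t :=
    (hfd.hasDerivWithinAt.mul
      (hE.differentiableOn two_ne_zero t ht).hasDerivWithinAt).derivWithin (hu t ht)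
  have e2 : (liftVariation c (c.pos τ) f 0 0 0).timeRate τ₀ τ₁ t = deriv f t :=
    hfd.hasDerivWithinAt.derivWithin (uniqueDiffOn_Icc (h₀.trans h₁) t (hsub ht))
  have e3 : (liftVariation c (c.pos τ) f 0 0 0).vel σ t = 0 :=
    ((velTriv (c.pos τ)).symmL ℝ (c.velCurve σ t)).map_zero
  have e4 : (liftVariation c (c.pos τ) f 0 0 0).mom σ t = 0 :=
    ((momTriv (c.pos τ)).symmL ℝ (c.momCurve σ t)).map_zero
  have e5 : (liftVariation c (c.pos τ) f 0 0 0).velFibre σ t = 0 := congrArg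
    (fun x => Prod.snd (α := Coord n) (β := Coord n) x) e3
  have e6 : (liftVariation c (c.pos τ) f 0 0 0).momFibre σ t = 0 := congrArg
    (fun x => Prod.snd (α := Coord n) (β := Coord n →L[ℝ] ℝ) x) e4
  have e7 : lagrangianDifferential L (c.velCurve σ t) 0 = 0 :=
    (mfderiv (𝓡∂ n).tangent 𝓘(ℝ, ℝ) L (c.velCurve σ t)).map_zero
  have e8 := mom_posRateFibre_eq_zero h₀ h₁ hc hδ σ ht'
    (Filter.Eventually.of_forall fun t => liftVariation_pos_eq_zero rfl)
  rw [actionDensityVariation_of_posRateFibre_eq_zero e8, e1, e2, e3, e5, e6, e7]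
  simp

end Necessity

section FieldVariation

open Bundle

variable {n : ℕ} [NeZero n] {Q : Type*} [TopologicalSpace Q]
  [ChartedSpace (EuclideanHalfSpace n) Q] [IsManifold (𝓡∂ n) ∞ Q]
  {L : TangentBundle (𝓡∂ n) Q → ℝ} {Δ : (q : Q) → Submodule ℝ (TangentSpace (𝓡∂ n) q)}
  {τ₀ τc τ₁ : ℝ} {c : CollisionPath n Q}

theorem eulerLagrange_smul (σ : Side) (τ r : ℝ) (w : TangentSpace (𝓡∂ n) (c.pos τ)) :
    eulerLagrange L τ₀ τc τ₁ c σ τ (r • w) = r * eulerLagrange L τ₀ τc τ₁ c σ τ w := by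
  have h : baseDerivative L (c.pos τ) (c.vel σ τ) (r • w) =
      r * baseDerivative L (c.pos τ) (c.vel σ τ) w := by
    rw [baseDerivative, baseDerivative, ← lagrangianDifferential_smul]
    congr 1
    exact Prod.ext (α := Coord n) (β := Coord n) rfl (smul_zero r).symm
  rw [eulerLagrange, eulerLagrange, map_smul, h, smul_eq_mul]
  ring

/-- Along a smooth field, the Euler–Lagrange expression is continuous. -/
theorem continuousOn_eulerLagrange (h₀ : τ₀ < τc) (h₁ : τc < τ₁)
    (hL : ContMDiff (𝓡∂ n).tangent 𝓘(ℝ, ℝ) ∞ L) (hc : IsPath τ₀ τc τ₁ c) {x₀ : Q} {σ : Side}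
    {S : Set ℝ} (hS : UniqueDiffOn ℝ S) (hSd : S ⊆ σ.dom τ₀ τc τ₁)
    (hs : ∀ t ∈ S, c.pos t ∈ (chartAt (EuclideanHalfSpace n) x₀).source)
    (hleg : ∀ t ∈ S, ∀ w, c.mom σ t w = fibreDerivative L (c.pos t) (c.vel σ t) w)
    (hvel : ∀ t ∈ S, c.posRate τ₀ τc τ₁ σ t = c.timeRate τ₀ τ₁ t • c.vel σ t)
    {Z : ∀ t, TangentSpace (𝓡∂ n) (c.pos t)}
    (hZ : ContMDiffOn 𝓘(ℝ, ℝ) (𝓡∂ n).tangent 2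
      (fun t => (⟨c.pos t, Z t⟩ : TangentBundle (𝓡∂ n) Q)) S) :
    ContinuousOn (fun t => eulerLagrange L τ₀ τc τ₁ c σ t (Z t)) S := by
  have i1 : IsManifold (𝓡∂ n) (2 + 1) Q := IsManifold.of_le (n := ∞) (by norm_cast)
  have i2 : IsManifold (𝓡∂ n).tangent (0 + 1) (TangentBundle (𝓡∂ n) Q) :=
    IsManifold.of_le (n := ∞) (by norm_cast)
  have hSI : S ⊆ Icc τ₀ τ₁ := hSd.trans (σ.dom_subset h₀ h₁)
  have hT : ContinuousOn (c.timeRate τ₀ τ₁) S := (hc.timeRate_continuousOn h₀ h₁).mono hSI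
  have hT0 : ∀ t ∈ S, c.timeRate τ₀ τ₁ t ≠ 0 := fun t ht => (hc.time_pos t (hSI ht)).ne'
  have hy : ContDiffOn ℝ 2 (fun t => (tangentTriv x₀ ⟨c.pos t, Z t⟩).2) S :=
    contDiffOn_tangentTriv (by norm_cast) hZ hs
  have hp : ContDiffOn ℝ 2 (fun t => c.mom σ t (Z t)) S := fun t ht =>
    contMDiffWithinAt_pairing (by norm_cast) ((hc.mom_smooth σ).mono hSd t ht) (hZ t ht)
  set Z' : ∀ t, Coord n × Coord n := fun t => mfderivWithin 𝓘(ℝ, ℝ) (𝓡∂ n).tangent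
    (fun t => (⟨c.pos t, Z t⟩ : TangentBundle (𝓡∂ n) Q)) S t (1 : ℝ) with hZ'
  have hZd : ∀ t ∈ S, HasMFDerivWithinAt 𝓘(ℝ, ℝ) (𝓡∂ n).tangent
      (fun t => (⟨c.pos t, Z t⟩ : TangentBundle (𝓡∂ n) Q)) S t
      (mfderivWithin 𝓘(ℝ, ℝ) (𝓡∂ n).tangent
        (fun t => (⟨c.pos t, Z t⟩ : TangentBundle (𝓡∂ n) Q)) S t) := fun t ht =>
    ((hZ t ht).mdifferentiableWithinAt two_ne_zero).hasMFDerivWithinAt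
  -- the base component of the derivative of the field
  have hfst : ∀ t ∈ S, (Z' t).1 = c.timeRate τ₀ τ₁ t • coords (c.vel σ t) := by
    intro t ht
    have hq : HasMFDerivWithinAt 𝓘(ℝ, ℝ) (𝓡∂ n) c.pos (σ.dom τ₀ τc τ₁) t
        (mfderivWithin 𝓘(ℝ, ℝ) (𝓡∂ n) c.pos (σ.dom τ₀ τc τ₁) t) :=
      ((hc.pos_smooth σ t (hSd ht)).mdifferentiableWithinAt two_ne_zero).hasMFDerivWithinAt
    have hu : UniqueMDiffWithinAt 𝓘(ℝ, ℝ) S t := (hS t ht).uniqueMDiffWithinAt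
    have h1 := (hZd t ht).totalSpace_proj.mfderivWithin hu
    have h2 := (hq.mono hSd).mfderivWithin hu
    exact (DFunLike.congr_fun (h1.symm.trans h2) (1 : ℝ)).trans (hvel t ht)
  have hsnd : ∀ t ∈ S, derivWithin (fun t => (tangentTriv x₀ ⟨c.pos t, Z t⟩).2) S t =
      tangentCoordChange (𝓡∂ n) (c.pos t) x₀ (c.pos t) (Z' t).2 +
        transitionHessian (𝓡∂ n) (c.pos t) x₀ (Z' t).1 (coords (Z t)) := by
    intro t ht
    have h1 := ((hasMFDerivAt_trivializationAt_tangent_snd (hs t ht) (Z t)).comp_hasMFDerivWithinAt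
      t (hZd t ht)).hasDerivWithinAt_apply_one
    exact h1.derivWithin (hS t ht)
  set ξ : ∀ t, TangentSpace (𝓡∂ n).tangent (c.velCurve σ t) := fun t =>
    ofCoords (c.pos t) (c.vel σ t) (Z t, (c.timeRate τ₀ τ₁ t)⁻¹ • (Z' t).2) with hξ
  have hξcoord : ∀ t ∈ S, (velTriv x₀ ⟨c.velCurve σ t, ξ t⟩).2 =
      ((tangentTriv x₀ ⟨c.pos t, Z t⟩).2,
        (c.timeRate τ₀ τ₁ t)⁻¹ • derivWithin (fun t => (tangentTriv x₀ ⟨c.pos t, Z t⟩).2) S t) := by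
    intro t ht
    refine (velTriv_apply (x := c.velCurve σ t) (hs t ht) (ξ t)).trans (Prod.ext rfl ?_)
    change tangentCoordChange (𝓡∂ n) (c.pos t) x₀ (c.pos t) ((c.timeRate τ₀ τ₁ t)⁻¹ • (Z' t).2) +
      transitionHessian (𝓡∂ n) (c.pos t) x₀ (coords (Z t)) (coords (c.vel σ t)) =
      (c.timeRate τ₀ τ₁ t)⁻¹ • derivWithin (fun t => (tangentTriv x₀ ⟨c.pos t, Z t⟩).2) S t
    rw [hsnd t ht, hfst t ht, transitionHessian_symm (hs t ht), smul_add, map_smul, map_smul,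
      smul_apply, smul_smul, inv_mul_cancel₀ (hT0 t ht), one_smul]
  have hξcont : ContinuousOn (fun t => (⟨c.velCurve σ t, ξ t⟩ :
      TangentBundle (𝓡∂ n).tangent (TangentBundle (𝓡∂ n) Q))) S := by
    have h1 : ContMDiffOn 𝓘(ℝ, ℝ) (𝓡∂ n).tangent.tangent 0
        (fun t => (⟨c.velCurve σ t, (velTriv x₀).symmL ℝ (c.velCurve σ t)
          ((tangentTriv x₀ ⟨c.pos t, Z t⟩).2, (c.timeRate τ₀ τ₁ t)⁻¹ •
            derivWithin (fun t => (tangentTriv x₀ ⟨c.pos t, Z t⟩).2) S t)⟩ :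
        TangentBundle (𝓡∂ n).tangent (TangentBundle (𝓡∂ n) Q))) S := by
      refine contMDiffOn_trivialization_symmL (velTriv x₀)
        (((hc.vel_smooth σ).mono hSd).of_le (by simp)) ?_
        fun t ht => Or.inl (mem_velTriv_baseSet.2 (hs t ht))
      rw [contMDiffOn_zero_iff]
      exact hy.continuousOn.prodMk ((hT.inv₀ hT0).smul (hy.continuousOn_derivWithin hS one_le_two))
    refine h1.continuousOn.congr fun t ht => ?_
    have hb : c.velCurve σ t ∈ (velTriv x₀).baseSet := mem_velTriv_baseSet.2 (hs t ht)
    have h2 : (velTriv x₀).symmL ℝ (c.velCurve σ t) (velTriv x₀ ⟨c.velCurve σ t, ξ t⟩).2 = ξ t := by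
      rw [(velTriv x₀).symmL_apply hb]
      exact (velTriv x₀).symm_apply_apply_mk hb (ξ t)
    rw [hξcoord t ht] at h2
    exact congrArg (fun ζ => (⟨c.velCurve σ t, ζ⟩ :
      TangentBundle (𝓡∂ n).tangent (TangentBundle (𝓡∂ n) Q))) h2.symm
  refine ((hp.continuousOn_derivWithin hS one_le_two).sub
    (hT.mul (continuousOn_lagrangianDifferential hL hξcont))).congr fun t ht => ?_
  have h1 := hasDerivWithinAt_pairing ((hc.hasMFDerivWithinAt_mom σ (hSd ht)).mono hSd) (hZd t ht)
  have h2 : derivWithin (fun t => c.mom σ t (Z t)) S t =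
      c.momRate τ₀ τc τ₁ σ t (Z t) + c.mom σ t (Z' t).2 := h1.derivWithin (hS t ht)
  have h3 : lagrangianDifferential L (c.velCurve σ t) (ξ t) =
      baseDerivative L (c.pos t) (c.vel σ t) (Z t) +
        c.mom σ t ((c.timeRate τ₀ τ₁ t)⁻¹ • (Z' t).2) :=
    (lagrangianDifferential_eq hL _ _ _ _).trans (congrArg₂ (· + ·) rfl (hleg t ht _).symm)
  have h4 : c.mom σ t ((c.timeRate τ₀ τ₁ t)⁻¹ • (Z' t).2) =
      (c.timeRate τ₀ τ₁ t)⁻¹ * c.mom σ t (Z' t).2 := (c.mom σ t).map_smul _ _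
  change _ = derivWithin (fun t => c.mom σ t (Z t)) S t -
    c.timeRate τ₀ τ₁ t * lagrangianDifferential L (c.velCurve σ t) (ξ t)
  rw [eulerLagrange, h2, h3, h4, mul_add, mul_inv_cancel_left₀ (hT0 t ht)]
  ring

end FieldVariation

section Momentum

open Bundle

variable {n : ℕ} [NeZero n] {Q : Type*} [TopologicalSpace Q]
  [ChartedSpace (EuclideanHalfSpace n) Q] [IsManifold (𝓡∂ n) ∞ Q]
  {L : TangentBundle (𝓡∂ n) Q → ℝ} {Δ : (q : Q) → Submodule ℝ (TangentSpace (𝓡∂ n) q)}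
  {τ₀ τc τ₁ : ℝ} {c : CollisionPath n Q}

theorem IsSmoothDistribution.exists_section {k : ℕ} (hΔ : IsSmoothDistribution k Δ) {q : Q}
    {w : TangentSpace (𝓡∂ n) q} (hw : w ∈ Δ q) :
    ∃ (U : Set Q) (Y : (x : Q) → TangentSpace (𝓡∂ n) x), IsOpen U ∧ q ∈ U ∧
      ContMDiffOn (𝓡∂ n) (𝓡∂ n).tangent ∞
        (fun x => (⟨x, Y x⟩ : TangentBundle (𝓡∂ n) Q)) U ∧
      (∀ x ∈ U, Y x ∈ Δ x) ∧ Y q = w := by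
  obtain ⟨U, hU, hq, X, hX, hspan⟩ := hΔ q
  rw [(hspan q hq).2, Submodule.mem_span_range_iff_exists_fun] at hw
  obtain ⟨r, hr⟩ := hw
  refine ⟨U, fun x => ∑ i, r i • X i x, hU, hq, ?_, fun x hx => ?_, hr⟩
  · exact ContMDiffOn.sum_section fun i _ => (hX i).const_smul_section
  · rw [(hspan x hx).2]
    exact Submodule.sum_mem _ fun i _ => Submodule.smul_mem _ _
      (Submodule.subset_span (mem_range_self i))

/-- The variation `f Y` of the configuration path, where `Y` is a vector field. -/
def fieldVariation (c : CollisionPath n Q) (x₀ : Q) (Y : (x : Q) → TangentSpace (𝓡∂ n) x)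
    (f : ℝ → ℝ) : Variation c :=
  liftVariation c x₀ 0 (fun t => f t • (tangentTriv x₀ ⟨c.pos t, Y (c.pos t)⟩).2) 0 0

theorem fieldVariation_pos {x₀ : Q} {Y : (x : Q) → TangentSpace (𝓡∂ n) x} {f : ℝ → ℝ} {t : ℝ}
    (h : c.pos t ∈ (chartAt (EuclideanHalfSpace n) x₀).source ∨ f t = 0) :
    (fieldVariation c x₀ Y f).pos t = f t • Y (c.pos t) := by
  refine (((tangentTriv x₀).symmL ℝ (c.pos t)).map_smul (f t) _).trans ?_
  rcases h with h | h
  · rw [tangentTriv_symmL_apply h]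
  · rw [h, zero_smul, zero_smul]

theorem isAdmissible_fieldVariation (h₀ : τ₀ < τc) (h₁ : τc < τ₁) (hc : IsPath τ₀ τc τ₁ c)
    {x₀ : Q} {U : Set Q} {Y : (x : Q) → TangentSpace (𝓡∂ n) x}
    (hY : ContMDiffOn (𝓡∂ n) (𝓡∂ n).tangent ∞
      (fun x => (⟨x, Y x⟩ : TangentBundle (𝓡∂ n) Q)) U) (hYΔ : ∀ x ∈ U, Y x ∈ Δ x)
    {N : Set ℝ} (hN : IsOpen N)
    (hsource : ∀ t ∈ N ∩ Icc τ₀ τ₁,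
      c.pos t ∈ (chartAt (EuclideanHalfSpace n) x₀).source ∩ U)
    {f : ℝ → ℝ} (hf : ContDiff ℝ ∞ f) (hfN : tsupport f ⊆ N) (hf₀ : f τ₀ = 0) (hf₁ : f τ₁ = 0)
    (hcoll : f τc = 0 ∨ Y (c.pos τc) ∈ boundaryTangent (c.pos τc)) :
    IsAdmissible Δ τ₀ τc τ₁ (fieldVariation c x₀ Y f) := by
  have hor : ∀ t ∈ Icc τ₀ τ₁,
      c.pos t ∈ (chartAt (EuclideanHalfSpace n) x₀).source ∩ U ∨ f t = 0 := fun t ht => by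
    by_cases hts : t ∈ tsupport f
    · exact Or.inl (hsource t ⟨hfN hts, ht⟩)
    · exact Or.inr (image_eq_zero_of_notMem_tsupport hts)
  have hmem : ∀ t ∈ Icc τ₀ τ₁, (fieldVariation c x₀ Y f).pos t ∈ Δ (c.pos t) := fun t ht => by
    rw [fieldVariation_pos ((hor t ht).imp_left And.left)]
    rcases hor t ht with h | h
    · exact Submodule.smul_mem _ _ (hYΔ _ h.2)
    · rw [h, zero_smul]
      exact zero_mem _
  refine isAdmissible_liftVariation h₀ h₁ hc contDiffOn_const rfl rfl (fun σ => ?_)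
    (fun _ => contDiffOn_const) (fun _ => contDiffOn_const) (fun t ht => ?_) ?_ ?_ hmem ?_
  · refine contDiffOn_smul_of_tsupport_subset (hf.of_le (by norm_cast)) hN ?_ hfN
    have hs : ∀ t ∈ N ∩ σ.dom τ₀ τc τ₁,
        c.pos t ∈ (chartAt (EuclideanHalfSpace n) x₀).source ∩ U := fun t ht =>
      hsource t ⟨ht.1, σ.dom_subset h₀ h₁ ht.2⟩
    exact contDiffOn_tangentTriv (by norm_cast)
      ((hY.of_le (by norm_cast)).comp ((hc.pos_smooth σ).mono inter_subset_right)
        fun t ht => (hs t ht).2) fun t ht => (hs t ht).1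
  · by_cases hts : t ∈ tsupport f
    · exact Or.inl (hsource t ⟨hfN hts, ht⟩).1
    · right
      filter_upwards [eventually_eq_zero_of_notMem_tsupport hts] with r hr
      simp [hr]
  · rw [hf₀, zero_smul]
  · rw [hf₁, zero_smul]
  · have hτc : τc ∈ Icc τ₀ τ₁ := ⟨h₀.le, h₁.le⟩
    change (fieldVariation c x₀ Y f).pos τc ∈ _
    rw [fieldVariation_pos ((hor τc hτc).imp_left And.left)]
    rcases hcoll with h | h
    · rw [h, zero_smul]
      exact zero_mem _
    · exact Submodule.smul_mem _ _ h

theorem IsCritical.eulerLagrange_eq_zero (h₀ : τ₀ < τc) (h₁ : τc < τ₁)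
    (hL : ContMDiff (𝓡∂ n).tangent 𝓘(ℝ, ℝ) ∞ L) {k : ℕ} (hΔ : IsSmoothDistribution k Δ)
    (hc : IsPath τ₀ τc τ₁ c) (hcrit : IsCritical L Δ τ₀ τc τ₁ c) {σ : Side} {τ : ℝ}
    (hτ : τ ∈ σ.dom τ₀ τc τ₁) {w : TangentSpace (𝓡∂ n) (c.pos τ)} (hw : w ∈ Δ (c.pos τ)) :
    eulerLagrange L τ₀ τc τ₁ c σ τ w = 0 := by
  obtain ⟨a, b, hab, hD, hsub⟩ := σ.exists_dom_eq_Icc h₀ h₁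
  obtain ⟨U, Y, hU, hqU, hY, hYΔ, rfl⟩ := hΔ.exists_section hw
  obtain ⟨N, hN, hτN, hsource⟩ := hc.exists_isOpen_mapsTo (σ.dom_subset h₀ h₁ hτ)
    ((chartAt (EuclideanHalfSpace n) (c.pos τ)).open_source.inter hU)
    ⟨mem_chart_source _ _, hqU⟩
  have hSd : N ∩ σ.dom τ₀ τc τ₁ ⊆ σ.dom τ₀ τc τ₁ := inter_subset_right
  have hs : ∀ t ∈ N ∩ σ.dom τ₀ τc τ₁,
      c.pos t ∈ (chartAt (EuclideanHalfSpace n) (c.pos τ)).source ∩ U := fun t ht =>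
    hsource t ⟨ht.1, σ.dom_subset h₀ h₁ ht.2⟩
  have hS : UniqueDiffOn ℝ (N ∩ σ.dom τ₀ τc τ₁) := by
    rw [inter_comm]
    exact (σ.uniqueDiffOn_dom h₀ h₁).inter hN
  have hG : ContinuousOn (fun t => eulerLagrange L τ₀ τc τ₁ c σ t (Y (c.pos t)))
      (N ∩ σ.dom τ₀ τc τ₁) :=
    continuousOn_eulerLagrange h₀ h₁ hL hc hS hSd (fun t ht => (hs t ht).1)
      (fun t ht => hcrit.legendre h₀ h₁ hL hc ht.2) (fun t ht => hcrit.posRate_eq h₀ h₁ hL hc ht.2)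
      ((hY.of_le (by norm_cast)).comp ((hc.pos_smooth σ).mono hSd) fun t ht => (hs t ht).2)
  rw [hD] at hG
  refine eq_zero_of_integral_mul_eq_zero (G := fun t => eulerLagrange L τ₀ τc τ₁ c σ t
    (Y (c.pos t))) hab (hD ▸ hτ) hN hτN hG fun f hf hfs => ?_
  have hz : ∀ t, t ∉ Ioo a b → ∀ᶠ r in 𝓝 t, f r = 0 := fun t ht =>
    eventually_eq_zero_of_notMem_tsupport fun h => ht (hfs h).2
  have hδ : IsAdmissible Δ τ₀ τc τ₁ (fieldVariation c (c.pos τ) Y f) := by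
    have ha := hsub (left_mem_Icc.2 hab.le)
    have hb := hsub (right_mem_Icc.2 hab.le)
    refine isAdmissible_fieldVariation h₀ h₁ hc hY hYΔ hN hsource hf (fun t ht => (hfs ht).1)
      (hz τ₀ fun h => absurd ha.1 (not_le.2 h.1)).self_of_nhds
      (hz τ₁ fun h => absurd hb.2 (not_le.2 h.2)).self_of_nhds
      (Or.inl (hz τc fun h => ?_).self_of_nhds)
    cases σ
    · obtain ⟨rfl, rfl⟩ := (Icc_eq_Icc_iff h₀.le).1 hD
      exact lt_irrefl _ h.2
    · obtain ⟨rfl, rfl⟩ := (Icc_eq_Icc_iff h₁.le).1 hD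
      exact lt_irrefl _ h.1
  have hint := hcrit.integral_eq_zero h₀ h₁ hδ hab hD fun σ' t ht htn =>
    actionDensityVariation_liftVariation_eq_zero h₀ h₁ hc hδ σ' ht
      ((hz t htn).mono fun r hr => ⟨rfl, by simp [hr], rfl, rfl⟩)
  have hpos : ∀ t ∈ Icc a b, (fieldVariation c (c.pos τ) Y f).pos t = f t • Y (c.pos t) :=
    fun t ht => fieldVariation_pos (by
      by_cases hts : t ∈ tsupport f
      · exact Or.inl (hsource t ⟨(hfs hts).1, hsub ht⟩).1
      · exact Or.inr (image_eq_zero_of_notMem_tsupport hts))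
  set δ := fieldVariation c (c.pos τ) Y f with hδdef
  have hpair : ContDiffOn ℝ 1 (fun t => c.mom σ t (δ.pos t)) (Icc a b) := by
    rw [← hD]
    exact (hc.mom_pos_contDiffOn σ (hδ.pos_smooth σ)).of_le one_le_two
  have h2 := intervalIntegral.integral_derivWithin_Icc_of_contDiffOn_Icc hpair hab.le
  rw [hpos a (left_mem_Icc.2 hab.le), hpos b (right_mem_Icc.2 hab.le),
    (hz a fun h => lt_irrefl _ h.1).self_of_nhds, (hz b fun h => lt_irrefl _ h.2).self_of_nhds,
    zero_smul, zero_smul, map_zero, map_zero, sub_zero] at h2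
  have hcG := ContinuousOn.intervalIntegrable (μ := MeasureTheory.volume) (a := a) (b := b)
    (u := fun t => f t * eulerLagrange L τ₀ τc τ₁ c σ t (Y (c.pos t))) (by
      rw [uIcc_of_le hab.le]
      rw [← contDiffOn_zero (𝕜 := ℝ)] at hG ⊢
      exact contDiffOn_smul_of_tsupport_subset (hf.of_le (by simp)) hN hG fun t ht => (hfs ht).1)
  have hcp := ContinuousOn.intervalIntegrable (μ := MeasureTheory.volume) (a := a) (b := b)
    (u := derivWithin (fun t => c.mom σ t (δ.pos t)) (Icc a b)) (by
      rw [uIcc_of_le hab.le]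
      exact hpair.continuousOn_derivWithin (uniqueDiffOn_Icc hab) le_rfl)
  have h3 := intervalIntegral.integral_sub hcp hcG
  rw [h2, zero_sub] at h3
  rw [← neg_eq_zero, ← h3, ← hint]
  refine intervalIntegral.integral_congr fun t ht => ?_
  rw [uIcc_of_le hab.le] at ht
  have htD : t ∈ σ.dom τ₀ τc τ₁ := by rwa [hD]
  have h4 := hasDerivWithinAt_mom_pos hc σ htD
    ((hδ.pos_smooth σ t htD).mdifferentiableWithinAt two_ne_zero)
  rw [hD] at h4
  have h5 : δ.timeRate τ₀ τ₁ t = 0 := congrFun (derivWithin_fun_const (Icc τ₀ τ₁) (0 : ℝ)) t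
  rw [actionDensityVariation_eq hL (hδ.vel_proj σ t htD) (hcrit.legendre h₀ h₁ hL hc htD)
    (hcrit.posRate_eq h₀ h₁ hL hc htD), h4.derivWithin (uniqueDiffOn_Icc hab t ht), h5, hpos t ht,
    eulerLagrange_smul]
  ring

theorem IsCritical.implicitEulerLagrange (h₀ : τ₀ < τc) (h₁ : τc < τ₁)
    (hL : ContMDiff (𝓡∂ n).tangent 𝓘(ℝ, ℝ) ∞ L) {k : ℕ} (hΔ : IsSmoothDistribution k Δ)
    {cov : LinearConnection n Q} (htorsion : cov.torsion = 0) (hc : IsPath τ₀ τc τ₁ c)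
    (hcon : IsConstrained Δ τ₀ τc τ₁ c) (hcrit : IsCritical L Δ τ₀ τc τ₁ c) :
    ImplicitEulerLagrange L cov Δ τ₀ τc τ₁ c where
  momentum σ τ hτ w hw := by
    have hτ' := σ.away_subset_dom hτ
    rw [momentumCovDerivative_sub_eq h₀ h₁ hL htorsion hc σ hτ' (hcrit.legendre h₀ h₁ hL hc hτ')
      (hcrit.posRate_eq h₀ h₁ hL hc hτ')]
    exact hcrit.eulerLagrange_eq_zero h₀ h₁ hL hΔ hc hτ' hw
  energy σ τ hτ := hcrit.energy h₀ h₁ hL hc (σ.away_subset_dom hτ)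
  legendre σ τ hτ := hcrit.legendre h₀ h₁ hL hc (σ.away_subset_dom hτ)
  velocity σ τ hτ := by
    have hτ' := σ.away_subset_dom hτ
    have hpos := hc.time_pos τ (σ.dom_subset h₀ h₁ hτ')
    refine ⟨?_, hcon σ τ hτ'⟩
    rw [hcrit.posRate_eq h₀ h₁ hL hc hτ', smul_smul, inv_mul_cancel₀ hpos.ne', one_smul]

theorem Side.inner_subset_dom (σ : Side) : σ.inner τ₀ τc τ₁ ⊆ σ.dom τ₀ τc τ₁ :=
  σ.inner_subset_away.trans σ.away_subset_dom

theorem IsCritical.jump_eq_zero (h₀ : τ₀ < τc) (h₁ : τc < τ₁)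
    (hL : ContMDiff (𝓡∂ n).tangent 𝓘(ℝ, ℝ) ∞ L) {k : ℕ} (hΔ : IsSmoothDistribution k Δ)
    (hc : IsPath τ₀ τc τ₁ c) (hcrit : IsCritical L Δ τ₀ τc τ₁ c) {δ : Variation c}
    (hδ : IsAdmissible Δ τ₀ τc τ₁ δ) :
    (c.energyAt L .after τc - c.energyAt L .before τc) * δ.time τc -
      (c.mom .after τc - c.mom .before τc) (δ.pos τc) = 0 := by
  rw [← actionVariation_eq h₀ h₁ hL hc hδ
    (fun σ τ hτ => hcrit.legendre h₀ h₁ hL hc (σ.inner_subset_dom hτ))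
    (fun σ τ hτ => hcrit.posRate_eq h₀ h₁ hL hc (σ.inner_subset_dom hτ))
    (fun σ τ hτ w hw => hcrit.eulerLagrange_eq_zero h₀ h₁ hL hΔ hc (σ.inner_subset_dom hτ) hw)
    (fun σ τ hτ => hcrit.energy h₀ h₁ hL hc (σ.inner_subset_dom hτ))]
  exact hcrit δ hδ

theorem IsCritical.elasticImpact (h₀ : τ₀ < τc) (h₁ : τc < τ₁)
    (hL : ContMDiff (𝓡∂ n).tangent 𝓘(ℝ, ℝ) ∞ L) {k : ℕ} (hΔ : IsSmoothDistribution k Δ)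
    (hc : IsPath τ₀ τc τ₁ c) (hcrit : IsCritical L Δ τ₀ τc τ₁ c) :
    ElasticImpact L Δ τc c where
  momentum := by
    rintro w ⟨hwB, hwΔ⟩
    obtain ⟨U, Y, hU, hqU, hY, hYΔ, rfl⟩ := hΔ.exists_section hwΔ
    obtain ⟨N, hN, hτN, hsource⟩ := hc.exists_isOpen_mapsTo ⟨h₀.le, h₁.le⟩
      ((chartAt (EuclideanHalfSpace n) (c.pos τc)).open_source.inter hU)
      ⟨mem_chart_source _ _, hqU⟩
    obtain ⟨f, hfs, -, hf, -, hf1⟩ := exists_contDiff_tsupport_subset (n := ⊤)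
      ((hN.inter isOpen_Ioo).mem_nhds ⟨hτN, h₀, h₁⟩)
    have hδ := isAdmissible_fieldVariation h₀ h₁ hc hY hYΔ hN hsource hf
      (fun t ht => (hfs ht).1)
      (image_eq_zero_of_notMem_tsupport fun h => lt_irrefl _ (hfs h).2.1)
      (image_eq_zero_of_notMem_tsupport fun h => lt_irrefl _ (hfs h).2.2) (Or.inr hwB)
    have h := hcrit.jump_eq_zero h₀ h₁ hL hΔ hc hδ
    rw [fieldVariation_pos (Or.inl (mem_chart_source _ _)), hf1, one_smul] at h
    have h2 : (fieldVariation c (c.pos τc) Y f).time τc = 0 := rfl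
    rw [h2, mul_zero, zero_sub, neg_eq_zero] at h
    exact h
  energy := by
    obtain ⟨f, hfs, -, hf, -, hf1⟩ := exists_contDiff_tsupport_subset (n := ⊤)
      (isOpen_Ioo.mem_nhds ⟨h₀, h₁⟩ : Ioo τ₀ τ₁ ∈ 𝓝 τc)
    have hδ : IsAdmissible Δ τ₀ τc τ₁ (liftVariation c (c.pos τc) f 0 0 0) := by
      refine isAdmissible_liftVariation h₀ h₁ hc hf.contDiffOn
        (image_eq_zero_of_notMem_tsupport fun h => lt_irrefl _ (hfs h).1)
        (image_eq_zero_of_notMem_tsupport fun h => lt_irrefl _ (hfs h).2)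
        (fun _ => contDiffOn_const) (fun _ => contDiffOn_const) (fun _ => contDiffOn_const)
        (fun t ht => Or.inr (Filter.Eventually.of_forall fun _ => ⟨rfl, rfl, rfl⟩)) rfl rfl ?_ ?_
      · intro t ht
        rw [Pi.zero_apply, map_zero]
        exact zero_mem _
      · rw [Pi.zero_apply, map_zero]
        exact zero_mem _
    have h := hcrit.jump_eq_zero h₀ h₁ hL hΔ hc hδ
    have h2 : (liftVariation c (c.pos τc) f 0 0 0).time τc = 1 := hf1
    rw [h2, liftVariation_pos_eq_zero rfl, map_zero, mul_one, sub_zero] at h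
    exact sub_eq_zero.1 h

end Momentum

section Annihilator

variable {n : ℕ} [NeZero n] {Q : Type*} [TopologicalSpace Q]
  [ChartedSpace (EuclideanHalfSpace n) Q]

theorem annihilator_inf {q : Q} (A B : Submodule ℝ (TangentSpace (𝓡∂ n) q)) :
    annihilator (A ⊓ B) = annihilator A ⊔ annihilator B := by
  refine le_antisymm (fun β hβ => ?_) (sup_le ?_ ?_)
  · let A' : Submodule ℝ (Coord n) := A
    let B' : Submodule ℝ (Coord n) := B
    let β' : Coord n →L[ℝ] ℝ := β
    have h : (β' : Coord n →ₗ[ℝ] ℝ) ∈ (A' ⊓ B').dualAnnihilator :=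
      (Submodule.mem_dualAnnihilator _).2 fun w hw => hβ w hw
    rw [Subspace.dualAnnihilator_inf_eq, Submodule.mem_sup] at h
    obtain ⟨f, hf, g, hg, hfg⟩ := h
    refine Submodule.mem_sup.2 ⟨f.toContinuousLinearMap, fun w hw =>
      (Submodule.mem_dualAnnihilator f).1 hf w hw, g.toContinuousLinearMap, fun w hw =>
      (Submodule.mem_dualAnnihilator g).1 hg w hw, ?_⟩
    ext w
    exact DFunLike.congr_fun hfg w
  · exact fun β hβ w hw => hβ w hw.1
  · exact fun β hβ w hw => hβ w hw.2

end Annihilator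

end CollisionMechanics

end

/-- The first part says that `actionVariation` is the differential of the action functional; the
second part is the characterization of the critical paths. -/
theorem theorem1 {n : ℕ} [NeZero n] {Q : Type*} [TopologicalSpace Q] [T2Space Q]
    [SecondCountableTopology Q] [ChartedSpace (EuclideanHalfSpace n) Q] [IsManifold (𝓡∂ n) ∞ Q]
    (L : TangentBundle (𝓡∂ n) Q → ℝ) (hL : ContMDiff (𝓡∂ n).tangent 𝓘(ℝ, ℝ) ∞ L)
    (k : ℕ) (Δ : (q : Q) → Submodule ℝ (TangentSpace (𝓡∂ n) q)) (hΔ : IsSmoothDistribution k Δ)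
    (cov : LinearConnection n Q) (hcov : cov.ContMDiffCovariantDerivative ∞)
    (htorsion : cov.torsion = 0)
    (τ₀ τc τ₁ : ℝ) (h₀ : τ₀ < τc) (h₁ : τc < τ₁) :
    (∀ (ε : ℝ) (C : ℝ → CollisionPath n Q) (δ : Variation (C 0)), 0 < ε →
      IsPathFamily τ₀ τc τ₁ ε C → IsVelocityAtZero τ₀ τc τ₁ C δ →
      HasDerivAt (fun s : ℝ => action L τ₀ τc τ₁ (C s)) (actionVariation L τ₀ τc τ₁ δ) 0) ∧
    (∀ c : CollisionPath n Q, IsPath τ₀ τc τ₁ c → IsConstrained Δ τ₀ τc τ₁ c →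
      (IsCritical L Δ τ₀ τc τ₁ c ↔
        ImplicitEulerLagrange L cov Δ τ₀ τc τ₁ c ∧ ElasticImpact L Δ τc c) ∧
      annihilator (boundaryTangent (c.pos τc) ⊓ Δ (c.pos τc)) =
        annihilator (boundaryTangent (c.pos τc)) ⊔ annihilator (Δ (c.pos τc))) := by
  refine ⟨fun ε C δ hε hC hδ => hC.hasDerivAt_action hL h₀ h₁ hε hδ, fun c hc hcon => ⟨⟨?_, ?_⟩,
    annihilator_inf _ _⟩⟩
  · exact fun hcrit => ⟨hcrit.implicitEulerLagrange h₀ h₁ hL hΔ htorsion hc hcon,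
      hcrit.elasticImpact h₀ h₁ hL hΔ hc⟩
  · exact fun h => IsCritical.of_implicitEulerLagrange h₀ h₁ hL htorsion hc h.1 h.2
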